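/- Let $X$ be a compact complex manifold of dimension $n\ge 3$ with a nowhere vanishing holomorphic $(n,0)$-form $\Omega$. For a Hermitian metric $\omega=i\sum g_{\bar kj}\,dz^j\wedge d\bar z^k$ define $\|\Omega\|_\omega$ by $\|\Omega\|_\omega^2=i^{n^2}n!\,\Omega\wedge\bar\Omega\,\omega^{-n}$. Let $\omega(t)$, $t\in[0,T)$, be a smooth family of Hermitian metrics solving the Anomaly flow $$\partial_t\big(\|\Omega\|_\omega\,\omega^{n-1}\big)=i\partial\bar\partial(\omega^{n-2})$$ with initial metric $\omega_0=\omega(0)$ satisfying $d(\|\Omega\|_{\omega_0}\omega_0^{n-1})=0$. In local holomorphic coordinates let $g^{j\bar k}$ be the inverse of $g_{\bar kj}$ and set (with summation over repeated indices) $$T_{\bar kj\ell}=\partial_jg_{\bar k\ell}-\partial_\ell g_{\bar kj},\qquad \bar T_{k\bar j\bar\ell}=\partial_{\bar j}g_{\bar\ell k}-\partial_{\bar\ell}g_{\bar jk},\qquad T_\ell=g^{j\bar k}T_{\bar kj\ell},\qquad \bar T_{\bar\ell}=\overline{T_\ell},$$ $$|T|^2=g^{m\bar k}g^{j\bar n}g^{\ell\bar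 p}T_{\bar kj\ell}\bar T_{m\bar n\bar p},\qquad |\tau|^2=g^{j\bar k}T_j\bar T_{\bar k},$$ $$R_{\bar kj}{}^p{}_q=-\partial_{\bar k}\big(g^{p\bar\ell}\partial_jg_{\bar\ell q}\big),\qquad \tilde R_{\bar kj}=g^{p\bar q}\,g_{\bar kr}\,R_{\bar qp}{}^r{}_j .$$ Then, at every point and for all $t\in[0,T)$ (the derivative at $t=0$ being one-sided), the metric evolves as follows. If $n=3$, $$\partial_tg_{\bar kj}=\frac1{2\|\Omega\|_\omega}\Big[-\tilde R_{\bar kj}+g^{m\bar\ell}g^{s\bar r}T_{\bar rmj}\bar T_{s\bar\ell\bar k}\Big].$$ If $n\ge4$, $$\partial_tg_{\bar kj}=\frac1{(n-1)\|\Omega\|_\omega}\Big[-\tilde R_{\bar kj}+\frac1{2(n-2)}\big(|T|^2-2|\tau|^2\big)g_{\bar kj}-\frac12g^{q\bar p}g^{s\bar r}T_{\bar kqs}\bar T_{j\bar p\bar r}+g^{s\bar r}\big(T_{\bar kjs}\bar T_{\bar r}+T_s\bar T_{j\bar k\bar r}\big)+T_j\bar T_{\bar k}\Big].$$ -/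

import Mathlib

open scoped Manifold ContDiff

noncomputable section

namespace AnomalyFlow

/-! ### Complex-valued differential forms on open subsets of `ℂⁿ` -/

/-- The model space `ℂⁿ` of local holomorphic coordinates. -/
abbrev Cn (n : ℕ) : Type := Fin n → ℂ

/-- The complexified cotangent space of `ℂⁿ`: real-linear maps with values in `ℂ`. -/
abbrev Cotangent (n : ℕ) : Type := Cn n →ₗ[ℝ] ℂ

/-- Complex-valued exterior forms (of all degrees); the product is the wedge product. -/
abbrev Form (n : ℕ) : Type := ExteriorAlgebra ℂ (Cotangent n)

/-- The covector `dz^j`. -/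
def dzCovector {n : ℕ} (j : Fin n) : Cotangent n :=
  (LinearMap.proj j : Cn n →ₗ[ℂ] ℂ).restrictScalars ℝ

/-- The covector `d z̄^j`. -/
def dzbarCovector {n : ℕ} (j : Fin n) : Cotangent n :=
  Complex.conjAe.toLinearMap ∘ₗ dzCovector j

/-- The one-form `dz^j`. -/
def dz {n : ℕ} (j : Fin n) : Form n := ExteriorAlgebra.ι ℂ (dzCovector j)

/-- The one-form `d z̄^j`. -/
def dzbar {n : ℕ} (j : Fin n) : Form n := ExteriorAlgebra.ι ℂ (dzbarCovector j)

/-- The Wirtinger derivative `∂_j F = ∂F/∂z^j`. -/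
def delz {n : ℕ} (j : Fin n) (F : Cn n → ℂ) (z : Cn n) : ℂ :=
  (1 / 2) * (fderiv ℝ F z (Pi.single j 1) - Complex.I * fderiv ℝ F z (Pi.single j Complex.I))

/-- The Wirtinger derivative `∂_{j̄} F = ∂F/∂z̄^j`. -/
def delzbar {n : ℕ} (j : Fin n) (F : Cn n → ℂ) (z : Cn n) : ℂ :=
  (1 / 2) * (fderiv ℝ F z (Pi.single j 1) + Complex.I * fderiv ℝ F z (Pi.single j Complex.I))

/-- A (constant) basis of the space of exterior forms. -/
def formBasis (n : ℕ) :
    Module.Basis (Finset (Fin (Module.finrank ℂ (Cotangent n)))) ℂ (Form n) :=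
  (Module.finBasis ℂ (Cotangent n)).ExteriorAlgebra

/-- A linear differential operator with constant coefficients applied to the coefficients of a form
(the result does not depend on the constant basis that is used). -/
def coeffwise {n : ℕ} (D : (Cn n → ℂ) → Cn n → ℂ) (α : Cn n → Form n) (z : Cn n) : Form n :=
  ∑ s, D (fun w => (formBasis n).repr (α w) s) z • formBasis n s

/-- The operator `∂ = ∑ dz^j ∧ ∂_j` on forms. -/
def del {n : ℕ} (α : Cn n → Form n) (z : Cn n) : Form n :=
  ∑ j, dz j * coeffwise (delz j) α z

/-- The operator `∂̄ = ∑ d z̄^j ∧ ∂_{j̄}` on forms. -/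
def delbar {n : ℕ} (α : Cn n → Form n) (z : Cn n) : Form n :=
  ∑ j, dzbar j * coeffwise (delzbar j) α z

/-- The exterior derivative `d = ∂ + ∂̄`. -/
def extD {n : ℕ} (α : Cn n → Form n) (z : Cn n) : Form n := del α z + delbar α z

/-- The curve `A` of exterior forms is differentiable at `t` within `s`, with derivative `B`. -/
def FormHasDerivWithinAt {n : ℕ} (A : ℝ → Form n) (B : Form n) (s : Set ℝ) (t : ℝ) : Prop :=
  ∀ L : Form n →ₗ[ℂ] ℂ, HasDerivWithinAt (fun r => L (A r)) (L B) s t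

/-- The quotient `α / β` of two forms of top degree, `β ≠ 0`: the scalar `c` with `α = c β`. -/
def topQuotient {n : ℕ} (α β : Form n) : ℂ :=
  Classical.epsilon fun c : ℂ => α = c • β

/-! ### Hermitian metrics and holomorphic volume forms on complex manifolds -/

section Manifold

variable (n : ℕ) (X : Type*) [TopologicalSpace X] [ChartedSpace (Cn n) X]

/-- The holomorphic charts of a complex manifold. -/
abbrev holoAtlas : Set (OpenPartialHomeomorph X (Cn n)) :=
  IsManifold.maximalAtlas 𝓘(ℂ, Cn n) ω X

variable {n X}

/-- The holomorphic coordinate vector field `∂_j` of a chart, at the point with coordinates `z`. -/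
def coordVec (φ : OpenPartialHomeomorph X (Cn n)) (z : Cn n) (j : Fin n) :
    TangentSpace 𝓘(ℂ, Cn n) (φ.symm z) :=
  mfderiv 𝓘(ℂ, Cn n) 𝓘(ℂ, Cn n) φ.symm z (Pi.single j (1 : ℂ) : Cn n)

variable (n X) in
/-- A smooth Hermitian metric on a complex manifold. -/
structure HermitianMetric where
  /-- The Hermitian form on each tangent space, conjugate-linear in the second argument. -/
  form : ∀ x : X,
    TangentSpace 𝓘(ℂ, Cn n) x →ₗ[ℂ] TangentSpace 𝓘(ℂ, Cn n) x →ₗ⋆[ℂ] ℂ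
  hermitian : ∀ x v w, form x v w = starRingEnd ℂ (form x w v)
  pos : ∀ x v, v ≠ 0 → 0 < (form x v v).re
  smooth : ∀ φ ∈ holoAtlas n X, ∀ k j : Fin n,
    ContDiffOn ℝ ∞ (fun z => form (φ.symm z) (coordVec φ z j) (coordVec φ z k)) φ.target

/-- The components of a Hermitian metric in a chart; the entry in row `k` and column `j` is
`g_{k̄j} = g(∂_j, ∂_k)`. -/
def HermitianMetric.comp (g : HermitianMetric n X) (φ : OpenPartialHomeomorph X (Cn n))
    (z : Cn n) : Matrix (Fin n) (Fin n) ℂ :=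
  Matrix.of fun k j => g.form (φ.symm z) (coordVec φ z j) (coordVec φ z k)

/-- The Kähler form `i ∑ g_{k̄j} dz^j ∧ d z̄^k` of a Hermitian metric in a chart. -/
def HermitianMetric.kahlerForm (g : HermitianMetric n X) (φ : OpenPartialHomeomorph X (Cn n))
    (z : Cn n) : Form n :=
  Complex.I • ∑ k, ∑ j, g.comp φ z k j • (dz j * dzbar k)

variable (n X) in
/-- A nowhere vanishing holomorphic `(n,0)`-form. -/
structure HoloVolumeForm where
  form : ∀ x : X, (TangentSpace 𝓘(ℂ, Cn n) x) [⋀^Fin n]→ₗ[ℂ] ℂ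
  holomorphic : ∀ φ ∈ holoAtlas n X,
    DifferentiableOn ℂ (fun z => form (φ.symm z) (coordVec φ z)) φ.target
  ne_zero : ∀ x, form x ≠ 0

/-- The coefficient `f` in `Ω = f dz^1 ∧ ⋯ ∧ dz^n`. -/
def HoloVolumeForm.coeff (Ω : HoloVolumeForm n X) (φ : OpenPartialHomeomorph X (Cn n))
    (z : Cn n) : ℂ :=
  Ω.form (φ.symm z) (coordVec φ z)

/-- The form `Ω = f dz^1 ∧ ⋯ ∧ dz^n` in a chart. -/
def HoloVolumeForm.toForm (Ω : HoloVolumeForm n X) (φ : OpenPartialHomeomorph X (Cn n))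
    (z : Cn n) : Form n :=
  Ω.coeff φ z • ExteriorAlgebra.ιMulti ℂ n dzCovector

/-- The conjugate form `Ω̄ = f̄ d z̄^1 ∧ ⋯ ∧ d z̄^n` in a chart. -/
def HoloVolumeForm.toFormBar (Ω : HoloVolumeForm n X) (φ : OpenPartialHomeomorph X (Cn n))
    (z : Cn n) : Form n :=
  starRingEnd ℂ (Ω.coeff φ z) • ExteriorAlgebra.ιMulti ℂ n dzbarCovector

/-- The norm `‖Ω‖_ω`, defined by `‖Ω‖_ω² = i^{n²} n! Ω ∧ Ω̄ ω^{-n}`. -/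
def volNorm (Ω : HoloVolumeForm n X) (g : HermitianMetric n X)
    (φ : OpenPartialHomeomorph X (Cn n)) (z : Cn n) : ℝ :=
  Real.sqrt (topQuotient
    ((Complex.I ^ (n ^ 2) * (n.factorial : ℂ)) • (Ω.toForm φ z * Ω.toFormBar φ z))
    (g.kahlerForm φ z ^ n)).re

/-- The form `‖Ω‖_ω ω^{n-1}` in a chart. -/
def balancedForm (Ω : HoloVolumeForm n X) (g : HermitianMetric n X)
    (φ : OpenPartialHomeomorph X (Cn n)) (z : Cn n) : Form n :=
  (volNorm Ω g φ z : ℂ) • g.kahlerForm φ z ^ (n - 1)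

/-- The metric is conformally balanced: `d(‖Ω‖_ω ω^{n-1}) = 0`. -/
def IsConformallyBalanced (Ω : HoloVolumeForm n X) (g : HermitianMetric n X) : Prop :=
  ∀ φ ∈ holoAtlas n X, ∀ z ∈ φ.target, extD (balancedForm Ω g φ) z = 0

/-- `g` is a smooth solution on `[0,T)` of the flow `∂_t(‖Ω‖_ω ω^{n-1}) = i∂∂̄ ω^{n-2}`. -/
structure IsAnomalyFlow (Ω : HoloVolumeForm n X) (g : ℝ → HermitianMetric n X) (T : ℝ) :
    Prop where
  smooth : ∀ φ ∈ holoAtlas n X, ∀ k j : Fin n,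
    ContDiffOn ℝ ∞ (fun p : ℝ × Cn n => (g p.1).comp φ p.2 k j) (Set.Ico 0 T ×ˢ φ.target)
  flow : ∀ φ ∈ holoAtlas n X, ∀ t ∈ Set.Ico 0 T, ∀ z ∈ φ.target,
    FormHasDerivWithinAt (fun s => balancedForm Ω (g s) φ z)
      (Complex.I • del (delbar fun w => (g t).kahlerForm φ w ^ (n - 2)) z) (Set.Ico 0 T) t

end Manifold

/-! ### Torsion and curvature in local coordinates

Here `G z k j` stands for `g_{k̄j}` at `z`, and `(G z)⁻¹ j k` for `g^{jk̄}`. -/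

section Tensors

variable {n : ℕ} (G : Cn n → Matrix (Fin n) (Fin n) ℂ) (z : Cn n)

/-- `T_{k̄jl} = ∂_j g_{k̄l} - ∂_l g_{k̄j}`. -/
def torsion (k j l : Fin n) : ℂ :=
  delz j (fun w => G w k l) z - delz l (fun w => G w k j) z

/-- `T̄_{k j̄ l̄} = ∂_{j̄} g_{l̄k} - ∂_{l̄} g_{j̄k}`. -/
def torsionBar (k j l : Fin n) : ℂ :=
  delzbar j (fun w => G w l k) z - delzbar l (fun w => G w j k) z

/-- The torsion one-form `T_l = g^{jk̄} T_{k̄jl}`. -/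
def torsionTrace (l : Fin n) : ℂ :=
  ∑ j, ∑ k, (G z)⁻¹ j k * torsion G z k j l

/-- The conjugate `T̄_{l̄}` of `T_l`. -/
def torsionTraceBar (l : Fin n) : ℂ := starRingEnd ℂ (torsionTrace G z l)

/-- `|T|² = g^{mk̄} g^{jn̄} g^{lp̄} T_{k̄jl} T̄_{m n̄ p̄}`. -/
def torsionNormSq : ℂ :=
  ∑ m, ∑ k, ∑ j, ∑ a, ∑ l, ∑ p, (G z)⁻¹ m k * (G z)⁻¹ j a * (G z)⁻¹ l p *
    torsion G z k j l * torsionBar G z m a p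

/-- `|τ|² = g^{jk̄} T_j T̄_{k̄}`. -/
def torsionTraceNormSq : ℂ :=
  ∑ j, ∑ k, (G z)⁻¹ j k * torsionTrace G z j * torsionTraceBar G z k

/-- The curvature of the Chern connection, `R_{k̄j}^p_q = -∂_{k̄}(g^{pl̄} ∂_j g_{l̄q})`. -/
def chernCurvature (k j p q : Fin n) : ℂ :=
  -delzbar k (fun w => ∑ l, (G w)⁻¹ p l * delz j (fun u => G u l q) w) z

/-- The Chern curvature with lowered index, `R_{k̄j p̄q} = g_{p̄r} R_{k̄j}^r_q`. -/
def chernCurvatureLower (k j p q : Fin n) : ℂ :=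
  ∑ r, G z p r * chernCurvature G z k j r q

/-- The second Chern-Ricci curvature `R̃_{k̄j} = R^p_{p k̄j} = g^{pq̄} R_{q̄p k̄j}`. -/
def ricciTilde (k j : Fin n) : ℂ :=
  ∑ p, ∑ q, (G z)⁻¹ p q * chernCurvatureLower G z q p k j

end Tensors

end AnomalyFlow

end

/-! In a chart write Ω = f dz^1 ∧ ⋯ ∧ dz^n and c = ‖Ω‖_ω, so that c² det g = f f̄. Put e_a = ∑_j
g_{āj} dz^j; then ω = i ∑ e_k ∧ dz̄^k. Wedging up to four pairs e_a ∧ dz̄^b with the complementary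
power of ∑ e_k ∧ dz̄^k gives a generalized Kronecker delta times its n-th power, up to a falling
factorial (`top₁`, `top₂`, `top₃`, `top₄`). Wedging the flow equation with e_a ∧ dz̄^b therefore
turns it into a matrix identity (`flow_components`), (n-1)(c' δ + c (tr B δ - B)) = S with B = (∂_t
g) g⁻¹. Here S is a δ₃-contraction of ∂∂̄g plus, for n ≥ 4, a δ₄-contraction of ∂g with ∂̄g; the
second part carries the factor n - 3 and is absent for n = 3. Since f f̄ does not depend on time, c'
= -(1/2) c tr B, and taking a trace solves for B (`eq_of_flow_components`).

It remains to identify S. Its scalar second-order term disappears when the trace is subtracted, and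
one of the other four second-order terms is the one in R̃. The remaining three are removed by the
conformally balanced condition. That condition says ∂_m c = c T_m (`wirt_conformal_factor`), so
differentiating c² det g = f f̄ gives ∂_m log f = 2 T_m + tr(g⁻¹ ∂_m g) (`wirt_coeff`). As f is
holomorphic, ∂_{k̄} of the right-hand side vanishes. This identity and its complex conjugate
(`hat_balanced`, `hat_balanced_conj`) replace the three terms by products of first derivatives,
which assemble with those of R̃ into a product of T and T̄ (`hat_second_order`). This is the formula
for n = 3. For n ≥ 4 the δ₄-contraction (`sum_mul_mul_delta₄`) contains the same product, which
cancels, and supplies the remaining torsion terms.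

The balanced condition is assumed at time 0 only. It persists because d(i∂∂̄ω^{n-2}) = 0
(`extD_eq_zero_of_flow`). That argument exchanges time and space derivatives of ‖Ω‖_ω ω^{n-1}, hence
needs f smooth; smoothness is bootstrapped from ∂_m f = f A_m, with A_m smooth, at the initial time
(`contDiffOn_of_wirt_eq`). -/

noncomputable section

namespace AnomalyFlow

/-! ### Contractions with powers of a nondegenerate two-form -/

section Exterior

variable {R V : Type*} [CommRing R] [AddCommGroup V] [Module R V]

open ExteriorAlgebra

/-- Interior product with a covector. -/
def interior (θ : Module.Dual R V) : ExteriorAlgebra R V →ₗ[R] ExteriorAlgebra R V :=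
  CliffordAlgebra.contractLeft (Q := (0 : QuadraticForm R V)) θ

lemma interior_ι_mul (θ : Module.Dual R V) (v : V) (x : ExteriorAlgebra R V) :
    interior θ (ι R v * x) = θ v • x - ι R v * interior θ x :=
  CliffordAlgebra.contractLeft_ι_mul _ _ _

lemma interior_one (θ : Module.Dual R V) : interior θ (1 : ExteriorAlgebra R V) = 0 :=
  CliffordAlgebra.contractLeft_one _ _

lemma ι_mul_ι_swap (v w : V) : ι R v * ι R w = -(ι R w * ι R v) :=
  eq_neg_of_add_eq_zero_left (ι_add_mul_swap v w)

lemma commute_ι_mul_ι (v w : V) (x : ExteriorAlgebra R V) : Commute (ι R v * ι R w) x := by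
  induction x using ExteriorAlgebra.induction with
  | algebraMap r => exact (Algebra.commutes r _).symm
  | ι u =>
    show ι R v * ι R w * ι R u = ι R u * (ι R v * ι R w)
    rw [mul_assoc, ι_mul_ι_swap w u, mul_neg, ← mul_assoc, ι_mul_ι_swap v u]
    simp [mul_assoc]
  | mul a b ha hb => exact ha.mul_right hb
  | add a b ha hb => exact ha.add_right hb

variable {n : ℕ} (e f : Fin n → V)

/-- The two-form `∑ e_k ∧ f_k`. -/
def symplecticForm : ExteriorAlgebra R V := ∑ k, ι R (e k) * ι R (f k)

lemma commute_symplecticForm (x : ExteriorAlgebra R V) :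
    Commute (symplecticForm (R := R) e f) x :=
  Commute.sum_left _ _ _ fun _ _ => commute_ι_mul_ι _ _ _

/-- The functionals `θ j` vanish on the `e k` and are dual to the `f k`, and the exterior algebra
vanishes in degree `2n+1`. -/
structure IsDualFrame (θ : Fin n → Module.Dual R V) : Prop where
  apply_left : ∀ j k, θ j (e k) = 0
  apply_right : ∀ j k, θ j (f k) = if j = k then 1 else 0
  eq_zero_of_mem : ∀ x ∈ ⋀[R]^(2 * n + 1) V, x = 0

/-- The two-form `e_a ∧ f_b`. -/
def pair (a b : Fin n) : ExteriorAlgebra R V := ι R (e a) * ι R (f b)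

lemma commute_pair (a b : Fin n) (x : ExteriorAlgebra R V) : Commute (pair (R := R) e f a b) x :=
  commute_ι_mul_ι _ _ _

lemma right_mul_pair_mul (a b k : Fin n) (x : ExteriorAlgebra R V) :
    ι R (f k) * (pair e f a b * x) = pair e f a b * (ι R (f k) * x) := by
  rw [← mul_assoc, ← (commute_pair e f a b _).eq, mul_assoc]

lemma right_mul_left_mul (a k : Fin n) (x : ExteriorAlgebra R V) :
    ι R (f k) * (ι R (e a) * x) = -(pair e f a k * x) := by
  rw [← mul_assoc, ι_mul_ι_swap, pair, neg_mul]

lemma ι_mem (v : V) : ι R v ∈ ⋀[R]^1 V := by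
  simp [exteriorPower]

lemma pair_mem (a b : Fin n) : pair e f a b ∈ ⋀[R]^2 V :=
  SetLike.mul_mem_graded (i := 1) (j := 1) (A := fun i : ℕ => ⋀[R]^i V) (ι_mem _) (ι_mem _)

lemma symplecticForm_pow_mem (N : ℕ) : symplecticForm e f ^ N ∈ ⋀[R]^(N • 2) V :=
  SetLike.pow_mem_graded (A := fun i : ℕ => ⋀[R]^i V) N
    (Submodule.sum_mem _ fun k _ => pair_mem e f k k)

namespace IsDualFrame

variable {e f} {θ : Fin n → Module.Dual R V}

lemma interior_pair_mul (h : IsDualFrame e f θ) (j a b : Fin n) (x : ExteriorAlgebra R V) :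
    interior (θ j) (pair e f a b * x) =
      pair e f a b * interior (θ j) x - (if j = b then 1 else 0 : R) • (ι R (e a) * x) := by
  rw [pair, mul_assoc, interior_ι_mul, interior_ι_mul, h.apply_left, h.apply_right, zero_smul,
    mul_sub, mul_smul_comm, mul_assoc]
  abel

lemma interior_symplecticForm_mul (h : IsDualFrame e f θ) (j : Fin n) (x : ExteriorAlgebra R V) :
    interior (θ j) (symplecticForm e f * x) =
      symplecticForm e f * interior (θ j) x - ι R (e j) * x := by
  have := fun a => h.interior_pair_mul j a a x
  simp only [pair] at this
  simp only [symplecticForm, Finset.sum_mul, map_sum, this, Finset.sum_sub_distrib]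
  simp

/-- The interior product is an antiderivation and the two-form is even and central, so the ordinary
power rule applies. The sign appears because `θ j` sees only the second factor of each pair. -/
lemma interior_symplecticForm_pow (h : IsDualFrame e f θ) (j : Fin n) (N : ℕ) :
    interior (θ j) (symplecticForm (R := R) e f ^ (N + 1)) =
      -((N + 1 : R) • (ι R (e j) * symplecticForm e f ^ N)) := by
  induction N with
  | zero =>
    have := h.interior_symplecticForm_mul j (1 : ExteriorAlgebra R V)
    simpa [interior_one] using this
  | succ N ih =>
    rw [pow_succ', h.interior_symplecticForm_mul, ih, mul_neg, mul_smul_comm, ← mul_assoc,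
      (commute_symplecticForm e f _).eq, mul_assoc, ← pow_succ']
    push_cast
    module

/-- In top degree `f k ∧ x` vanishes; contracting this zero with `θ j` and expanding by the
antiderivation rule gives the identity. All the contraction formulas below are instances of it. -/
lemma smul_eq_right_mul_interior (h : IsDualFrame e f θ) (j k : Fin n) {x : ExteriorAlgebra R V}
    (hx : x ∈ ⋀[R]^(2 * n) V) :
    (if j = k then 1 else 0 : R) • x = ι R (f k) * interior (θ j) x := by
  have h0 : ι R (f k) * x = 0 := h.eq_zero_of_mem _ <| by
    rw [add_comm]
    exact SetLike.mul_mem_graded (A := fun i : ℕ => ⋀[R]^i V) (ι_mem _) hx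
  have h1 := interior_ι_mul (θ j) (f k) x
  rw [h0, map_zero, h.apply_right] at h1
  exact (sub_eq_zero.mp h1.symm)

lemma pair_mul_pow (h : IsDualFrame e f θ) {N : ℕ} (hN : N + 1 = n) (j k : Fin n) :
    (N + 1 : R) • (pair (R := R) e f j k * symplecticForm e f ^ N) =
      (if j = k then 1 else 0 : R) • symplecticForm e f ^ n := by
  subst hN
  have hx := symplecticForm_pow_mem (R := R) e f (N + 1)
  rw [smul_eq_mul, mul_comm] at hx
  rw [h.smul_eq_right_mul_interior j k hx, h.interior_symplecticForm_pow, mul_neg, mul_smul_comm,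
    right_mul_left_mul, smul_neg, neg_neg]

/-- Apply the top-degree identity to `e_a ∧ f_b ∧ σ^(N+1)`. The contraction either hits the power
and creates the new pair `(j, k)`, or removes `f_b`, whose place is then taken by `f_k`. The longer
versions below are the same computation with more pairs. -/
lemma pair_mul_pair_mul_pow (h : IsDualFrame e f θ) {N : ℕ} (hN : N + 2 = n) (a b j k : Fin n) :
    (N + 1 : R) • (pair (R := R) e f a b * (pair e f j k * symplecticForm e f ^ N)) =
      (if j = k then 1 else 0 : R) • (pair (R := R) e f a b * symplecticForm e f ^ (N + 1)) -
      (if j = b then 1 else 0 : R) • (pair (R := R) e f a k * symplecticForm e f ^ (N + 1)) := by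
  have hx : pair e f a b * symplecticForm e f ^ (N + 1) ∈ ⋀[R]^(2 * n) V := by
    have := SetLike.mul_mem_graded (A := fun i : ℕ => ⋀[R]^i V) (pair_mem e f a b)
      (symplecticForm_pow_mem (R := R) e f (N + 1))
    convert this using 2
    simp only [smul_eq_mul]
    omega
  rw [h.smul_eq_right_mul_interior j k hx, h.interior_pair_mul, h.interior_symplecticForm_pow]
  simp only [mul_neg, mul_smul_comm, mul_sub, right_mul_left_mul, right_mul_pair_mul, smul_neg]
  abel

lemma pair_mul_pair_mul_pair_mul_pow (h : IsDualFrame e f θ) {N : ℕ} (hN : N + 3 = n)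
    (a b c d j k : Fin n) :
    (N + 1 : R) • (pair (R := R) e f a b * (pair e f c d * (pair e f j k * symplecticForm e f ^ N))) =
      (if j = k then 1 else 0 : R) •
        (pair e f a b * (pair e f c d * symplecticForm e f ^ (N + 1))) -
      (if j = d then 1 else 0 : R) •
        (pair e f a b * (pair e f c k * symplecticForm e f ^ (N + 1))) -
      (if j = b then 1 else 0 : R) •
        (pair e f a k * (pair e f c d * symplecticForm e f ^ (N + 1))) := by
  have hx : pair e f a b * (pair e f c d * symplecticForm e f ^ (N + 1)) ∈ ⋀[R]^(2 * n) V := by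
    have := SetLike.mul_mem_graded (A := fun i : ℕ => ⋀[R]^i V) (pair_mem e f a b)
      (SetLike.mul_mem_graded (A := fun i : ℕ => ⋀[R]^i V) (pair_mem e f c d)
      (symplecticForm_pow_mem (R := R) e f (N + 1)))
    convert this using 2
    simp only [smul_eq_mul]
    omega
  rw [h.smul_eq_right_mul_interior j k hx, h.interior_pair_mul, h.interior_pair_mul,
    h.interior_symplecticForm_pow]
  simp only [mul_neg, mul_smul_comm, mul_sub, right_mul_left_mul, right_mul_pair_mul, smul_neg]
  abel

lemma pair_mul_pair_mul_pair_mul_pair_mul_pow (h : IsDualFrame e f θ) {N : ℕ} (hN : N + 4 = n)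
    (a b c d r s j k : Fin n) :
    (N + 1 : R) • (pair (R := R) e f a b * (pair e f c d * (pair e f r s *
        (pair e f j k * symplecticForm e f ^ N)))) =
      (if j = k then 1 else 0 : R) •
        (pair e f a b * (pair e f c d * (pair e f r s * symplecticForm e f ^ (N + 1)))) -
      (if j = s then 1 else 0 : R) •
        (pair e f a b * (pair e f c d * (pair e f r k * symplecticForm e f ^ (N + 1)))) -
      (if j = d then 1 else 0 : R) •
        (pair e f a b * (pair e f c k * (pair e f r s * symplecticForm e f ^ (N + 1)))) -
      (if j = b then 1 else 0 : R) •
        (pair e f a k * (pair e f c d * (pair e f r s * symplecticForm e f ^ (N + 1)))) := by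
  have hx : pair e f a b * (pair e f c d * (pair e f r s * symplecticForm e f ^ (N + 1))) ∈
      ⋀[R]^(2 * n) V := by
    have := SetLike.mul_mem_graded (A := fun i : ℕ => ⋀[R]^i V) (pair_mem e f a b)
      (SetLike.mul_mem_graded (A := fun i : ℕ => ⋀[R]^i V) (pair_mem e f c d)
      (SetLike.mul_mem_graded (A := fun i : ℕ => ⋀[R]^i V) (pair_mem e f r s)
      (symplecticForm_pow_mem (R := R) e f (N + 1))))
    convert this using 2
    simp only [smul_eq_mul]
    omega
  rw [h.smul_eq_right_mul_interior j k hx, h.interior_pair_mul, h.interior_pair_mul,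
    h.interior_pair_mul, h.interior_symplecticForm_pow]
  simp only [mul_neg, mul_smul_comm, mul_sub, right_mul_left_mul, right_mul_pair_mul, smul_neg]
  abel

end IsDualFrame

/-! ### Generalized Kronecker deltas as contractions in top degree. -/

/-- The Kronecker delta. -/
def delta₁ (j k : Fin n) : R := if j = k then 1 else 0

/-- The generalized Kronecker delta with two pairs of indices. -/
def delta₂ (a b j k : Fin n) : R := delta₁ j k * delta₁ a b - delta₁ j b * delta₁ a k

/-- The generalized Kronecker delta with three pairs of indices. -/
def delta₃ (a b c d j k : Fin n) : R :=
  delta₁ j k * delta₂ a b c d - delta₁ j d * delta₂ a b c k - delta₁ j b * delta₂ a k c d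

/-- The generalized Kronecker delta with four pairs of indices. -/
def delta₄ (a b c d r s j k : Fin n) : R :=
  delta₁ j k * delta₃ a b c d r s - delta₁ j s * delta₃ a b c d r k
    - delta₁ j d * delta₃ a b c k r s - delta₁ j b * delta₃ a k c d r s

namespace IsDualFrame

variable {e f} {θ : Fin n → Module.Dual R V}

/-- The recursions above are the cofactor expansions that define the deltas. The falling factorial
stays on the left because integers need not be invertible in `R`. -/
lemma top₁ (h : IsDualFrame e f θ) (hn : 1 ≤ n) (j k : Fin n) :
    (n : R) • (pair (R := R) e f j k * symplecticForm e f ^ (n - 1)) =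
      (delta₁ j k : R) • symplecticForm e f ^ n := by
  rw [delta₁, ← h.pair_mul_pow (N := n - 1) (by omega) j k]
  push_cast [hn]
  simp

lemma top₂ (h : IsDualFrame e f θ) (hn : 2 ≤ n) (a b j k : Fin n) :
    ((n : R) * (n - 1)) • (pair (R := R) e f a b * (pair e f j k * symplecticForm e f ^ (n - 2))) =
      (delta₂ a b j k : R) • symplecticForm e f ^ n := by
  have h2 := congrArg ((n : R) • ·)
    (h.pair_mul_pair_mul_pow (N := n - 2) (by omega) a b j k)
  rw [show n - 2 + 1 = n - 1 by omega] at h2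
  have e1 : ((n - 2 : ℕ) : R) + 1 = n - 1 := by push_cast [hn]; ring
  simp only [e1, smul_sub, smul_comm (n : R) (ite _ _ _), h.top₁ (by omega)] at h2
  rw [mul_smul, h2, delta₂, sub_smul, mul_smul, mul_smul]
  rfl

lemma top₃ (h : IsDualFrame e f θ) (hn : 3 ≤ n) (a b c d j k : Fin n) :
    ((n : R) * (n - 1) * (n - 2)) • (pair (R := R) e f a b * (pair e f c d *
      (pair e f j k * symplecticForm e f ^ (n - 3)))) =
      (delta₃ a b c d j k : R) • symplecticForm e f ^ n := by
  have h2 := congrArg (((n : R) * (n - 1)) • ·)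
    (h.pair_mul_pair_mul_pair_mul_pow (N := n - 3) (by omega) a b c d j k)
  rw [show n - 3 + 1 = n - 2 by omega] at h2
  have e1 : ((n - 3 : ℕ) : R) + 1 = n - 2 := by push_cast [hn]; ring
  simp only [e1, smul_sub, smul_comm ((n : R) * (n - 1)) (ite _ _ _),
    h.top₂ (by omega)] at h2
  rw [mul_smul, h2, delta₃]
  simp only [sub_smul, mul_smul]
  rfl

lemma top₄ (h : IsDualFrame e f θ) (hn : 4 ≤ n) (a b c d r s j k : Fin n) :
    ((n : R) * (n - 1) * (n - 2) * (n - 3)) • (pair (R := R) e f a b * (pair e f c d * (pair e f r s *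
      (pair e f j k * symplecticForm e f ^ (n - 4))))) =
      (delta₄ a b c d r s j k : R) • symplecticForm e f ^ n := by
  have h2 := congrArg (((n : R) * (n - 1) * (n - 2)) • ·)
    (h.pair_mul_pair_mul_pair_mul_pair_mul_pow (N := n - 4) (by omega) a b c d r s j k)
  rw [show n - 4 + 1 = n - 3 by omega] at h2
  have e1 : ((n - 4 : ℕ) : R) + 1 = n - 3 := by push_cast [hn]; ring
  simp only [e1, smul_sub, smul_comm ((n : R) * (n - 1) * (n - 2)) (ite _ _ _),
    h.top₃ (by omega)] at h2
  rw [mul_smul, h2, delta₄]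
  simp only [sub_smul, mul_smul]
  rfl

end IsDualFrame

end Exterior

section Exterior

variable {R V : Type*} [CommRing R] [AddCommGroup V] [Module R V]

open ExteriorAlgebra

/-! ### Decomposable forms of top degree -/

lemma ι_mul_ιMulti (v : V) {m : ℕ} (a : Fin m → V) :
    ι R v * ιMulti R m a = (-1 : R) ^ m • (ιMulti R m a * ι R v) := by
  induction m with
  | zero => simp [ιMulti_zero_apply]
  | succ m ih =>
    rw [ιMulti_succ_apply, ← mul_assoc, ι_mul_ι_swap, neg_mul, mul_assoc, ih, mul_smul_comm,
      pow_succ]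
    simp [mul_assoc]

lemma add_pow_of_sq_eq_zero {A : Type*} [Ring A] {x y : A} (h : Commute x y) (hx : x * x = 0)
    (m : ℕ) : (x + y) ^ (m + 1) = y ^ (m + 1) + (m + 1 : ℕ) • (x * y ^ m) := by
  induction m with
  | zero => simp [add_comm]
  | succ m ih =>
    rw [pow_succ' (x + y), ih, add_mul, mul_add, mul_add, mul_smul_comm, ← mul_assoc x x, hx,
      zero_mul, smul_zero, add_zero, mul_smul_comm, ← mul_assoc y x, ← h.eq, mul_assoc x y,
      ← pow_succ', ← pow_succ', succ_nsmul _ (m + 1)]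
    abel

/-- Split off x = a_0 ∧ b_0 from the sum. Since x² = 0 and the rest y satisfies y^(m+1) = 0, only
(m+1) x y^m survives. Moving b_0 past m covectors gives the sign (-1)^m, which accumulates to the
triangular exponent. The vanishing statement is carried along because the induction needs it. -/
lemma sum_pair_pow_aux {m : ℕ} (a b : Fin m → V) :
    (∑ k, ι R (a k) * ι R (b k)) ^ (m + 1) = 0 ∧
      (∑ k, ι R (a k) * ι R (b k)) ^ m =
        ((-1 : R) ^ (m * (m - 1) / 2) * m.factorial) • (ιMulti R m a * ιMulti R m b) := by
  induction m with
  | zero => simp [ιMulti_zero_apply]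
  | succ m ih =>
    obtain ⟨h0, h1⟩ := ih (fun k => a k.succ) (fun k => b k.succ)
    have hc := commute_ι_mul_ι (a 0) (b 0) (∑ k : Fin m, ι R (a k.succ) * ι R (b k.succ))
    have hsq : ι R (a 0) * ι R (b 0) * (ι R (a 0) * ι R (b 0)) = 0 := by
      rw [mul_assoc, ← mul_assoc (ι R (b 0)), ι_mul_ι_swap (b 0), neg_mul, mul_assoc,
        ι_sq_zero]
      simp
    rw [Fin.sum_univ_succ]
    constructor
    · rw [add_pow_of_sq_eq_zero hc hsq, h0, pow_succ, h0]
      simp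
    · rw [add_pow_of_sq_eq_zero hc hsq, h0, zero_add, h1, ιMulti_succ_apply, ιMulti_succ_apply,
        mul_smul_comm, mul_assoc (ι R (a 0)), mul_assoc (ι R (a 0)),
        ← mul_assoc (ιMulti R m _) (ι R (b 0)), ← mul_assoc (ι R (b 0)), ι_mul_ιMulti,
        ← Nat.cast_smul_eq_nsmul R, smul_mul_assoc, mul_smul_comm, smul_smul, smul_smul]
      congr 1
      have : (m + 1) * (m + 1 - 1) / 2 = m * (m - 1) / 2 + m := by
        have := Nat.triangle_succ m
        omega
      rw [this, pow_add, Nat.factorial_succ]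
      push_cast
      ring

lemma symplecticForm_pow_card {m : ℕ} (a b : Fin m → V) :
    symplecticForm (R := R) a b ^ m =
      ((-1 : R) ^ (m * (m - 1) / 2) * m.factorial) • (ιMulti R m a * ιMulti R m b) :=
  (sum_pair_pow_aux a b).2

/-- Both sides are alternating in the rows of `G`, so it suffices to compare them on injective
families of basis vectors, that is, on permutations. -/
lemma ιMulti_matrix {m : ℕ} (G : Matrix (Fin m) (Fin m) R) (a : Fin m → V) :
    ιMulti R m (fun k => ∑ j, G k j • a j) = G.det • ιMulti R m a := by
  have key : (ιMulti R m).compLinearMap (Fintype.linearCombination R a) =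
      (LinearMap.toSpanSingleton R _ (ιMulti R m a)).compAlternatingMap Matrix.detRowAlternating := by
    apply (Pi.basisFun R (Fin m)).ext_alternating
    intro v hv
    obtain ⟨σ, rfl⟩ : ∃ σ : Equiv.Perm (Fin m), ⇑σ = v :=
      ⟨Equiv.ofBijective v (Finite.injective_iff_bijective.mp hv), rfl⟩
    have e1 : ((ιMulti R m).compLinearMap (Fintype.linearCombination R a))
        (fun i => Pi.basisFun R (Fin m) (σ i)) = ιMulti R m (a ∘ σ) := by
      simp only [AlternatingMap.compLinearMap_apply]
      congr 1
      ext i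
      simp [Fintype.linearCombination_apply, Pi.single_apply]
    have e2 : Matrix.detRowAlternating (fun i => Pi.basisFun R (Fin m) (σ i)) =
        (Equiv.Perm.sign σ : R) := by
      have := (Matrix.detRowAlternating (R := R) (n := Fin m)).map_perm
        (fun i => Pi.basisFun R (Fin m) i) σ
      simp only [Function.comp_def] at this
      rw [this]
      have h1 : Matrix.detRowAlternating (fun i => Pi.basisFun R (Fin m) i) = (1 : R) := by
        have : (fun i => Pi.basisFun R (Fin m) i) = (1 : Matrix (Fin m) (Fin m) R) := by
          ext i j
          simp [Matrix.one_apply, Pi.single_apply, eq_comm]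
        rw [this]
        exact Matrix.det_one
      rw [h1]
      rcases Int.units_eq_one_or (Equiv.Perm.sign σ) with h | h <;> simp [h]
    rw [e1, LinearMap.compAlternatingMap_apply, e2, AlternatingMap.map_perm]
    rcases Int.units_eq_one_or (Equiv.Perm.sign σ) with h | h <;> simp [h]
  exact DFunLike.congr_fun key G

lemma interior_ιMulti_mul_eq_zero (θ : Module.Dual R V) {m : ℕ} (a : Fin m → V)
    (h : ∀ k, θ (a k) = 0) {x : ExteriorAlgebra R V} (hx : interior θ x = 0) :
    interior θ (ιMulti R m a * x) = 0 := by
  induction m with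
  | zero => simpa [ιMulti_zero_apply] using hx
  | succ m ih =>
    rw [ιMulti_succ_apply, mul_assoc, interior_ι_mul, h 0, ih (Matrix.vecTail a) fun k => h k.succ]
    simp

/-- If the product vanished, contracting with `θ 0` would strip off `a 0` and leave a shorter
vanishing product of the same kind. -/
lemma ιMulti_mul_ne_zero {m : ℕ} (a : Fin m → V) (θ : Fin m → Module.Dual R V)
    (h : ∀ j k, θ j (a k) = if j = k then 1 else 0) {x : ExteriorAlgebra R V}
    (hx : ∀ j, interior (θ j) x = 0) (hx0 : x ≠ 0) : ιMulti R m a * x ≠ 0 := by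
  induction m with
  | zero => simpa [ιMulti_zero_apply] using hx0
  | succ m ih =>
    intro h0
    refine ih (Matrix.vecTail a) (fun k => θ k.succ) (fun j k => ?_) (fun j => hx _) ?_
    · simp [Matrix.vecTail, h, Fin.succ_inj]
    · have h1 := congrArg (interior (θ 0)) h0
      rw [ιMulti_succ_apply, mul_assoc, interior_ι_mul, h 0 0, interior_ιMulti_mul_eq_zero] at h1
      · simpa using h1
      · intro k
        simp [Matrix.vecTail, h, (Fin.succ_ne_zero k).symm]
      · exact hx 0

end Exterior

/-! ### The complexified cotangent space of `ℂⁿ` -/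

section Cotangent

variable {n : ℕ}

/-- The functional on covectors that reads the coefficient of `d z̄^k`. -/
def dzbarCoeff (k : Fin n) : Module.Dual ℂ (Cotangent n) where
  toFun α := (1 / 2) * (α (Pi.single k 1) + Complex.I * α (Pi.single k Complex.I))
  map_add' α β := by simp; ring
  map_smul' c α := by simp; ring

/-- The functional on covectors that reads the coefficient of `dz^k`. -/
def dzCoeff (k : Fin n) : Module.Dual ℂ (Cotangent n) where
  toFun α := (1 / 2) * (α (Pi.single k 1) - Complex.I * α (Pi.single k Complex.I))
  map_add' α β := by simp; ring
  map_smul' c α := by simp; ring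

lemma dzCovector_apply (j : Fin n) (v : Cn n) : dzCovector j v = v j := rfl

lemma dzbarCovector_apply (j : Fin n) (v : Cn n) : dzbarCovector j v = starRingEnd ℂ (v j) := rfl

lemma dzbarCoeff_dzbar (j k : Fin n) :
    dzbarCoeff j (dzbarCovector k) = if j = k then 1 else 0 := by
  simp only [dzbarCoeff, LinearMap.coe_mk, AddHom.coe_mk, dzbarCovector_apply, Pi.single_apply]
  rcases eq_or_ne k j with rfl | h
  · norm_num
  · simp [h, h.symm]

lemma dzbarCoeff_dz (j k : Fin n) : dzbarCoeff j (dzCovector k) = 0 := by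
  simp only [dzbarCoeff, LinearMap.coe_mk, AddHom.coe_mk, dzCovector_apply, Pi.single_apply]
  rcases eq_or_ne k j with rfl | h
  · norm_num
  · simp [h]

lemma dzCoeff_dz (j k : Fin n) :
    dzCoeff j (dzCovector k) = if j = k then 1 else 0 := by
  simp only [dzCoeff, LinearMap.coe_mk, AddHom.coe_mk, dzCovector_apply, Pi.single_apply]
  rcases eq_or_ne k j with rfl | h
  · norm_num
  · simp [h, h.symm]

lemma dzCoeff_dzbar (j k : Fin n) : dzCoeff j (dzbarCovector k) = 0 := by
  simp only [dzCoeff, LinearMap.coe_mk, AddHom.coe_mk, dzbarCovector_apply, Pi.single_apply]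
  rcases eq_or_ne k j with rfl | h
  · norm_num
  · simp [h]

lemma finrank_cotangent : Module.finrank ℂ (Cotangent n) = 2 * n := by
  rw [Module.finrank_linearMap]
  have : Module.finrank ℝ (Cn n) = 2 * n := by
    rw [Module.finrank_pi_fintype]
    simp [Complex.finrank_real_complex, mul_comm]
  simp [this]

lemma exteriorPower_cotangent_eq_zero (x : Form n) (hx : x ∈ ⋀[ℂ]^(2 * n + 1) (Cotangent n)) :
    x = 0 := by
  have h : Module.finrank ℂ (⋀[ℂ]^(2 * n + 1) (Cotangent n)) = 0 := by
    rw [exteriorPower.finrank_eq, finrank_cotangent, Nat.choose_eq_zero_of_lt (by omega)]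
  have := Module.finrank_zero_iff.mp h
  exact congrArg Subtype.val (Subsingleton.elim (⟨x, hx⟩ : ⋀[ℂ]^(2 * n + 1) (Cotangent n)) 0)

/-- The `(1,0)`-covectors `∑_j G_{kj} dz^j`. -/
def lowered (G : Matrix (Fin n) (Fin n) ℂ) (k : Fin n) : Cotangent n := ∑ j, G k j • dzCovector j

/-- No invertibility is needed: any combinations of the dz^j are killed by the functionals reading
dz̄-coefficients. Nondegeneracy matters only when the dz^j are recovered from the lowered covectors,
or when the top power must be nonzero. -/
lemma isDualFrame (G : Matrix (Fin n) (Fin n) ℂ) :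
    IsDualFrame (lowered G) dzbarCovector (dzbarCoeff (n := n)) where
  apply_left j k := by simp [lowered, dzbarCoeff_dz]
  apply_right := dzbarCoeff_dzbar
  eq_zero_of_mem := exteriorPower_cotangent_eq_zero

/-- The form `dz^1 ∧ ⋯ ∧ dz^n ∧ d z̄^1 ∧ ⋯ ∧ d z̄^n`. -/
def topForm (n : ℕ) : Form n :=
  ExteriorAlgebra.ιMulti ℂ n dzCovector * ExteriorAlgebra.ιMulti ℂ n dzbarCovector

lemma topForm_ne_zero : topForm n ≠ 0 := by
  refine ιMulti_mul_ne_zero _ dzCoeff dzCoeff_dz (fun j => ?_) ?_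
  · have := interior_ιMulti_mul_eq_zero (dzCoeff j) dzbarCovector (dzCoeff_dzbar j)
      (interior_one _)
    simpa using this
  · have := ιMulti_mul_ne_zero (R := ℂ) dzbarCovector (dzbarCoeff (n := n)) dzbarCoeff_dzbar
      (fun j => interior_one _) one_ne_zero
    simpa using this

lemma symplecticForm_lowered_pow (G : Matrix (Fin n) (Fin n) ℂ) :
    symplecticForm (R := ℂ) (lowered G) dzbarCovector ^ n =
      ((-1 : ℂ) ^ (n * (n - 1) / 2) * n.factorial * G.det) • topForm n := by
  rw [symplecticForm_pow_card, topForm]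
  unfold lowered
  rw [ιMulti_matrix, smul_mul_assoc, smul_smul]

end Cotangent

/-! ### Hermitian metrics and volume forms in a chart -/

section Manifold

variable {n : ℕ} {X : Type*} [TopologicalSpace X] [ChartedSpace (Cn n) X]

lemma kahlerForm_eq (g : HermitianMetric n X) (φ : OpenPartialHomeomorph X (Cn n)) (z : Cn n) :
    g.kahlerForm φ z =
      Complex.I • symplecticForm (R := ℂ) (lowered (g.comp φ z)) dzbarCovector := by
  simp only [HermitianMetric.kahlerForm, symplecticForm, lowered, map_sum, map_smul,
    Finset.sum_mul, smul_mul_assoc]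
  rfl

lemma comp_conj (g : HermitianMetric n X) (φ : OpenPartialHomeomorph X (Cn n)) (z : Cn n)
    (k j : Fin n) : starRingEnd ℂ (g.comp φ z k j) = g.comp φ z j k :=
  (g.hermitian _ _ _).symm

lemma mdifferentiable_of_mem_holoAtlas {φ : OpenPartialHomeomorph X (Cn n)}
    (hφ : φ ∈ holoAtlas n X) : φ.MDifferentiable 𝓘(ℂ, Cn n) 𝓘(ℂ, Cn n) :=
  ⟨(contMDiffOn_of_mem_maximalAtlas hφ).mdifferentiableOn (by simp),
    (contMDiffOn_symm_of_mem_maximalAtlas hφ).mdifferentiableOn (by simp)⟩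

lemma topQuotient_eq {α β : Form n} {c : ℂ} (h : α = c • β) (hβ : β ≠ 0) :
    topQuotient α β = c := by
  have := Classical.epsilon_spec (p := fun c : ℂ => α = c • β) ⟨c, h⟩
  exact (smul_left_injective ℂ hβ (h.symm.trans this)).symm

/-- From n² = n + n(n-1): the normalization in ‖Ω‖² matches the sign obtained by reordering ω^n into
dz^1 ∧ ⋯ ∧ dz^n ∧ dz̄^1 ∧ ⋯ ∧ dz̄^n. -/
lemma I_pow_sq (n : ℕ) :
    Complex.I ^ (n ^ 2) = Complex.I ^ n * (-1) ^ (n * (n - 1) / 2) := by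
  have h2 : 2 ∣ n * (n - 1) := (Nat.even_mul_pred_self n).two_dvd
  obtain ⟨m, hm⟩ := h2
  have : n ^ 2 = n + 2 * m := by
    rw [← hm]
    rcases n with _ | n
    · rfl
    · simp; ring
  rw [this, hm, pow_add, pow_mul, Complex.I_sq]
  simp

lemma kahlerForm_pow_card (g : HermitianMetric n X) (φ : OpenPartialHomeomorph X (Cn n))
    (z : Cn n) : g.kahlerForm φ z ^ n =
      (Complex.I ^ (n ^ 2) * n.factorial * (g.comp φ z).det) • topForm n := by
  rw [kahlerForm_eq, smul_pow, symplecticForm_lowered_pow, smul_smul, I_pow_sq]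
  congr 1
  ring

section Chart

variable {φ : OpenPartialHomeomorph X (Cn n)}
  {z : Cn n}

/-- The coordinate vector fields form a basis of each tangent space. -/
def coordBasis (hφ : φ ∈ holoAtlas n X) (hz : z ∈ φ.target) :
    Module.Basis (Fin n) ℂ (TangentSpace 𝓘(ℂ, Cn n) (φ.symm z)) :=
  (Pi.basisFun ℂ (Fin n)).map
    ((mdifferentiable_of_mem_holoAtlas hφ).symm.mfderiv (x := z) hz).toLinearEquiv

lemma coordBasis_apply (hφ : φ ∈ holoAtlas n X) (hz : z ∈ φ.target) (j : Fin n) :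
    coordBasis hφ hz j = coordVec φ z j := by
  rw [coordBasis]
  erw [Module.Basis.map_apply, Pi.basisFun_apply]
  rfl

lemma coeff_ne_zero (hφ : φ ∈ holoAtlas n X) (hz : z ∈ φ.target) (Ω : HoloVolumeForm n X) :
    Ω.coeff φ z ≠ 0 := by
  have h := ((Ω.form (φ.symm z)).map_basis_ne_zero_iff (coordBasis hφ hz)).mpr (Ω.ne_zero _)
  have e : ⇑(coordBasis hφ hz) = coordVec φ z := funext fun j => coordBasis_apply hφ hz j
  rwa [e] at h

open scoped ComplexOrder in
lemma comp_posDef (hφ : φ ∈ holoAtlas n X) (hz : z ∈ φ.target) (g : HermitianMetric n X) :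
    (g.comp φ z).PosDef := by
  refine Matrix.PosDef.of_dotProduct_mulVec_pos (Matrix.IsHermitian.ext fun i j => ?_)
    fun x hx => ?_
  · exact comp_conj g φ z j i
  · set v := ∑ j, x j • coordVec φ z j with hv
    have hv0 : v ≠ 0 := by
      intro h
      apply hx
      have := (Fintype.linearIndependent_iff.mp (coordBasis hφ hz).linearIndependent) x
      simp only [coordBasis_apply] at this
      exact funext (this h)
    have e : star x ⬝ᵥ ((g.comp φ z).mulVec x) = g.form (φ.symm z) v v := by
      simp only [hv, map_sum, LinearMap.sum_apply, map_smul, map_smulₛₗ, LinearMap.smul_apply,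
        dotProduct, Matrix.mulVec, HermitianMetric.comp, Matrix.of_apply, smul_eq_mul,
        Pi.star_apply, Finset.mul_sum]
      refine Finset.sum_congr rfl fun k _ => Finset.sum_congr rfl fun j _ => ?_
      simp only [starRingEnd_apply]
      ring
    rw [e, Complex.pos_iff]
    refine ⟨g.pos _ _ hv0, ?_⟩
    have := congrArg Complex.im (g.hermitian (φ.symm z) v v)
    simp only [Complex.conj_im] at this
    linarith

open scoped ComplexOrder in
lemma det_comp_pos (hφ : φ ∈ holoAtlas n X) (hz : z ∈ φ.target) (g : HermitianMetric n X) :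
    0 < (g.comp φ z).det.re ∧ (g.comp φ z).det = ((g.comp φ z).det.re : ℂ) := by
  have h := (comp_posDef hφ hz g).det_pos
  rw [Complex.pos_iff] at h
  exact ⟨h.1, Complex.ext rfl (by simpa using h.2.symm)⟩

lemma det_comp_ne_zero (hφ : φ ∈ holoAtlas n X) (hz : z ∈ φ.target) (g : HermitianMetric n X) :
    (g.comp φ z).det ≠ 0 := by
  rw [(det_comp_pos hφ hz g).2]
  exact_mod_cast (det_comp_pos hφ hz g).1.ne'

/-- Since ω^n = i^{n²} n! det g times the coordinate top form, the constants cancel and ‖Ω‖² = |f|²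
/ det g. -/
lemma volNorm_eq (hφ : φ ∈ holoAtlas n X) (hz : z ∈ φ.target) (Ω : HoloVolumeForm n X)
    (g : HermitianMetric n X) :
    volNorm Ω g φ z = Real.sqrt (Complex.normSq (Ω.coeff φ z) / (g.comp φ z).det.re) := by
  have hd := det_comp_ne_zero hφ hz g
  have hI : Complex.I ^ (n ^ 2) * (n.factorial : ℂ) ≠ 0 :=
    mul_ne_zero (pow_ne_zero _ Complex.I_ne_zero) (by exact_mod_cast n.factorial_ne_zero)
  rw [volNorm, topQuotient_eq
    (c := ((Complex.normSq (Ω.coeff φ z) / (g.comp φ z).det.re : ℝ) : ℂ))]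
  · rw [Complex.ofReal_re]
  · rw [kahlerForm_pow_card, HoloVolumeForm.toForm, HoloVolumeForm.toFormBar, smul_mul_assoc,
      mul_smul_comm, smul_smul, smul_smul, smul_smul, topForm]
    congr 1
    rw [mul_assoc _ (Ω.coeff φ z), Complex.mul_conj, Complex.ofReal_div,
      ← (det_comp_pos hφ hz g).2]
    field_simp
  · rw [kahlerForm_pow_card]
    exact smul_ne_zero (mul_ne_zero hI hd) topForm_ne_zero

lemma volNorm_pos (hφ : φ ∈ holoAtlas n X) (hz : z ∈ φ.target) (Ω : HoloVolumeForm n X)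
    (g : HermitianMetric n X) : 0 < volNorm Ω g φ z := by
  rw [volNorm_eq hφ hz]
  exact Real.sqrt_pos.mpr (div_pos (Complex.normSq_pos.mpr (coeff_ne_zero hφ hz Ω))
    (det_comp_pos hφ hz g).1)

/-- The right-hand side is free of the metric. Its time derivative, which is zero, gives the
derivative of ‖Ω‖; its ∂_m-derivative gives that of log f. -/
lemma volNorm_sq_mul_det (hφ : φ ∈ holoAtlas n X) (hz : z ∈ φ.target) (Ω : HoloVolumeForm n X)
    (g : HermitianMetric n X) :
    (volNorm Ω g φ z : ℂ) ^ 2 * (g.comp φ z).det =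
      Ω.coeff φ z * starRingEnd ℂ (Ω.coeff φ z) := by
  have h := det_comp_pos hφ hz g
  rw [h.2, Complex.mul_conj, volNorm_eq hφ hz, ← Complex.ofReal_pow,
    Real.sq_sqrt (div_nonneg (Complex.normSq_nonneg _) h.1.le), ← Complex.ofReal_mul,
    div_mul_cancel₀ _ h.1.ne']

end Chart

end Manifold

/-! ### A norm on exterior forms -/

section FormNorm

variable (n : ℕ)

/-- The left regular representation of the exterior algebra, in coordinates. -/
def formRep : Form n →ₐ[ℂ]
    ((Finset (Fin (Module.finrank ℂ (Cotangent n))) → ℂ) →L[ℂ]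
      (Finset (Fin (Module.finrank ℂ (Cotangent n))) → ℂ)) :=
  (Module.End.toContinuousLinearMap (𝕜 := ℂ) _).toAlgHom.comp
    (((formBasis n).equivFun.conjAlgEquiv ℂ).toAlgHom.comp (Algebra.lmul ℂ (Form n)))

lemma formRep_apply (a b : Form n) :
    formRep n a ((formBasis n).equivFun b) = (formBasis n).equivFun (a * b) := by
  show (formBasis n).equivFun (a * (formBasis n).equivFun.symm ((formBasis n).equivFun b)) = _
  rw [LinearEquiv.symm_apply_apply]

lemma formRep_injective : Function.Injective (formRep n) := by
  intro a b h
  have := congrArg (fun F => F ((formBasis n).equivFun 1)) h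
  simp only [formRep_apply, mul_one] at this
  exact (formBasis n).equivFun.injective this

/-- The norm is auxiliary: it makes product rules and smoothness available for form-valued
functions. The left regular representation provides a submultiplicative one. -/
instance : NormedRing (Form n) :=
  NormedRing.induced (Form n) _ (formRep n) (formRep_injective n)

instance : NormedAlgebra ℂ (Form n) :=
  NormedAlgebra.induced ℂ (Form n) _ (formRep n)

instance : FiniteDimensional ℂ (Form n) := (formBasis n).finiteDimensional_of_finite

end FormNorm

/-! ### Wirtinger derivatives of vector-valued functions -/

section Wirtinger

variable {n : ℕ} {E F A : Type*}
  [NormedAddCommGroup E] [NormedSpace ℂ E]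
  [NormedAddCommGroup F] [NormedSpace ℂ F]
  [NormedRing A] [NormedAlgebra ℂ A]

/-- The Wirtinger derivatives of a vector-valued function: `∂_j` for `ε = -1` and `∂_{j̄}` for
`ε = 1`. -/
def wirt (ε : ℂ) (j : Fin n) (α : Cn n → E) (z : Cn n) : E :=
  (1 / 2 : ℂ) • (fderiv ℝ α z (Pi.single j 1) +
    (ε * Complex.I) • fderiv ℝ α z (Pi.single j Complex.I))

lemma delz_eq_wirt (j : Fin n) (F : Cn n → ℂ) : delz j F = wirt (-1) j F := by
  ext z
  simp [delz, wirt]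
  ring

lemma delzbar_eq_wirt (j : Fin n) (F : Cn n → ℂ) : delzbar j F = wirt 1 j F := by
  ext z
  simp [delzbar, wirt]

variable (ε δ : ℂ) (j k : Fin n) {z : Cn n} {U : Set (Cn n)}

lemma wirt_congr {α β : Cn n → E} (h : α =ᶠ[nhds z] β) : wirt ε j α z = wirt ε j β z := by
  simp only [wirt, h.fderiv_eq]

lemma wirt_congr_of_isOpen (hU : IsOpen U) (hz : z ∈ U) {α β : Cn n → E}
    (h : ∀ w ∈ U, α w = β w) : wirt ε j α z = wirt ε j β z :=
  wirt_congr ε j (Filter.eventually_of_mem (hU.mem_nhds hz) h)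

@[simp]
lemma wirt_const (c : E) : wirt ε j (fun _ : Cn n => c) z = 0 := by
  simp [wirt]

lemma wirt_sub {α β : Cn n → E} (hα : DifferentiableAt ℝ α z) (hβ : DifferentiableAt ℝ β z) :
    wirt ε j (fun w => α w - β w) z = wirt ε j α z - wirt ε j β z := by
  simp only [wirt, fderiv_fun_sub hα hβ, _root_.sub_apply]
  module

lemma wirt_sum {ι : Type*} (s : Finset ι) {α : ι → Cn n → E}
    (hα : ∀ i ∈ s, DifferentiableAt ℝ (α i) z) :
    wirt ε j (fun w => ∑ i ∈ s, α i w) z = ∑ i ∈ s, wirt ε j (α i) z := by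
  simp only [wirt, fderiv_fun_sum hα, _root_.sum_apply, Finset.smul_sum,
    ← Finset.sum_add_distrib]

lemma wirt_clm (L : E →L[ℂ] F) {α : Cn n → E} (hα : DifferentiableAt ℝ α z) :
    wirt ε j (fun w => L (α w)) z = L (wirt ε j α z) := by
  have h : fderiv ℝ (fun w => L (α w)) z = (L.restrictScalars ℝ).comp (fderiv ℝ α z) :=
    ((L.restrictScalars ℝ).hasFDerivAt.comp z hα.hasFDerivAt).fderiv
  simp [wirt, h]

lemma wirt_mul {α β : Cn n → A} (hα : DifferentiableAt ℝ α z) (hβ : DifferentiableAt ℝ β z) :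
    wirt ε j (fun w => α w * β w) z = α z * wirt ε j β z + wirt ε j α z * β z := by
  simp only [wirt, fderiv_fun_mul' hα hβ, _root_.add_apply,
    _root_.smul_apply, smul_eq_mul, MulOpposite.smul_eq_mul_unop,
    MulOpposite.unop_op, mul_add, add_mul, smul_mul_assoc, mul_smul_comm]
  module

lemma wirt_smul {c : Cn n → ℂ} {α : Cn n → E} (hc : DifferentiableAt ℝ c z)
    (hα : DifferentiableAt ℝ α z) :
    wirt ε j (fun w => c w • α w) z = c z • wirt ε j α z + wirt ε j c z • α z := by
  simp only [wirt, fderiv_fun_smul hc hα, _root_.add_apply,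
    _root_.smul_apply, ContinuousLinearMap.smulRight_apply, smul_eq_mul]
  module

lemma wirt_const_smul (c : ℂ) {α : Cn n → E} (hα : DifferentiableAt ℝ α z) :
    wirt ε j (fun w => c • α w) z = c • wirt ε j α z := by
  rw [wirt_smul ε j (differentiableAt_const c) hα]
  simp

lemma wirt_const_mul (c : A) {α : Cn n → A} (hα : DifferentiableAt ℝ α z) :
    wirt ε j (fun w => c * α w) z = c * wirt ε j α z := by
  rw [wirt_mul ε j (differentiableAt_const c) hα]
  simp

lemma contDiffOn_wirt (hU : IsOpen U) {α : Cn n → E} (hα : ContDiffOn ℝ ∞ α U) :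
    ContDiffOn ℝ ∞ (wirt ε j α) U := by
  have h := hα.fderiv_of_isOpen hU (m := ∞) (by simp)
  have h1 : ∀ v : Cn n, ContDiffOn ℝ ∞ (fun w => fderiv ℝ α w v) U := fun v =>
    h.clm_apply contDiffOn_const
  exact contDiffOn_const.smul ((h1 _).add (contDiffOn_const.smul (h1 _)))

lemma wirt_comm {α : Cn n → E} (hα : ContDiffAt ℝ 2 α z) :
    wirt ε j (wirt δ k α) z = wirt δ k (wirt ε j α) z := by
  have hsym := hα.isSymmSndFDerivAt (by simp)
  have hd : DifferentiableAt ℝ (fderiv ℝ α) z :=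
    (hα.fderiv_right (m := 1) (by norm_num)).differentiableAt (by simp)
  have h1 : ∀ v : Cn n, HasFDerivAt (fun w => fderiv ℝ α w v)
      ((fderiv ℝ (fderiv ℝ α) z).flip v) z := fun v => by
    simpa using hd.hasFDerivAt.clm_apply (hasFDerivAt_const v z)
  have key : ∀ (δ : ℂ) (k : Fin n), fderiv ℝ (wirt δ k α) z = (1 / 2 : ℂ) •
      ((fderiv ℝ (fderiv ℝ α) z).flip (Pi.single k 1) +
        (δ * Complex.I) • (fderiv ℝ (fderiv ℝ α) z).flip (Pi.single k Complex.I)) := by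
    intro δ k
    exact (((h1 _).add ((h1 _).const_smul (δ * Complex.I))).const_smul (1 / 2 : ℂ)).fderiv
  have e1 : wirt ε j (wirt δ k α) z = (1 / 2 : ℂ) • (fderiv ℝ (wirt δ k α) z (Pi.single j 1) +
    (ε * Complex.I) • fderiv ℝ (wirt δ k α) z (Pi.single j Complex.I)) := rfl
  have e2 : wirt δ k (wirt ε j α) z = (1 / 2 : ℂ) • (fderiv ℝ (wirt ε j α) z (Pi.single k 1) +
    (δ * Complex.I) • fderiv ℝ (wirt ε j α) z (Pi.single k Complex.I)) := rfl
  rw [e1, e2, key, key]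
  simp only [_root_.smul_apply, _root_.add_apply,
    ContinuousLinearMap.flip_apply]
  rw [hsym.eq (Pi.single k 1) (Pi.single j 1), hsym.eq (Pi.single k 1) (Pi.single j Complex.I),
    hsym.eq (Pi.single k Complex.I) (Pi.single j 1),
    hsym.eq (Pi.single k Complex.I) (Pi.single j Complex.I)]
  module

end Wirtinger

/-! ### Wirtinger derivatives of scalar functions: conjugation and holomorphy. -/

section Scalar

variable {n : ℕ} {z : Cn n} (j : Fin n)

lemma wirt_conj (ε : ℂ) (hε : starRingEnd ℂ ε = ε) {f : Cn n → ℂ} (hf : DifferentiableAt ℝ f z) :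
    wirt ε j (fun w => starRingEnd ℂ (f w)) z = starRingEnd ℂ (wirt (-ε) j f z) := by
  have h : fderiv ℝ (fun w => starRingEnd ℂ (f w)) z =
      (Complex.conjCLE : ℂ →L[ℝ] ℂ).comp (fderiv ℝ f z) :=
    ((Complex.conjCLE : ℂ →L[ℝ] ℂ).hasFDerivAt.comp z hf.hasFDerivAt).fderiv
  simp [wirt, h, hε, Complex.conj_ofNat]

lemma wirt_one_eq_zero {f : Cn n → ℂ} (hf : DifferentiableAt ℂ f z) : wirt 1 j f z = 0 := by
  have h : fderiv ℝ f z = (fderiv ℂ f z).restrictScalars ℝ :=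
    hf.fderiv_restrictScalars ℝ
  have h2 : (Pi.single j Complex.I : Cn n) = Complex.I • (Pi.single j 1 : Cn n) := by
    rw [← Pi.single_smul]; simp
  rw [wirt, h, ContinuousLinearMap.coe_restrictScalars', h2, map_smul, smul_smul, one_mul,
    Complex.I_mul_I]
  simp

lemma fderiv_apply_eq_sum_wirt {f : Cn n → ℂ} (hf : DifferentiableAt ℂ f z) (v : Cn n) :
    fderiv ℝ f z v = ∑ j, v j * wirt (-1) j f z := by
  have h : fderiv ℝ f z = (fderiv ℂ f z).restrictScalars ℝ :=
    hf.fderiv_restrictScalars ℝ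
  have h2 : ∀ j, wirt (-1) j f z = fderiv ℂ f z (Pi.single j 1) := fun j => by
    have h2 : (Pi.single j Complex.I : Cn n) = Complex.I • (Pi.single j 1 : Cn n) := by
      rw [← Pi.single_smul]; simp
    rw [wirt, h, ContinuousLinearMap.coe_restrictScalars', h2, map_smul, smul_smul, mul_assoc,
      Complex.I_mul_I]
    simp
    ring
  simp only [h2, h, ContinuousLinearMap.coe_restrictScalars']
  conv_lhs => rw [pi_eq_sum_univ' v]
  simp only [map_sum, map_smul, smul_eq_mul]

end Scalar

/-! ### The operators `∂` and `∂̄` in terms of Wirtinger derivatives -/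

section Dolbeault

variable {n : ℕ} {z : Cn n} {α : Cn n → Form n}

/-- Wirtinger derivatives commute with the coordinate functionals, so differentiating coefficients
in a constant basis agrees with differentiating the form itself. -/
lemma coeffwise_wirt (ε : ℂ) (j : Fin n) (hα : DifferentiableAt ℝ α z) :
    coeffwise (fun F => wirt ε j F) α z = wirt ε j α z := by
  have h : ∀ s, wirt ε j (fun w => (formBasis n).repr (α w) s) z =
      (formBasis n).repr (wirt ε j α z) s := fun s =>
    wirt_clm ε j (LinearMap.toContinuousLinearMap ((formBasis n).coord s)) hα
  simp only [coeffwise, h]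
  exact (formBasis n).sum_repr _

lemma del_eq (hα : DifferentiableAt ℝ α z) : del α z = ∑ j, dz j * wirt (-1) j α z := by
  simp only [del, ← coeffwise_wirt _ _ hα, ← delz_eq_wirt]

lemma delbar_eq (hα : DifferentiableAt ℝ α z) : delbar α z = ∑ j, dzbar j * wirt 1 j α z := by
  simp only [delbar, ← coeffwise_wirt _ _ hα, ← delzbar_eq_wirt]

end Dolbeault

/-! ### Counting the antiholomorphic factors -/

section NumberOperator

variable {R V : Type*} [CommRing R] [AddCommGroup V] [Module R V] {n : ℕ} {e f : Fin n → V}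
  {θ : Fin n → Module.Dual R V}

open ExteriorAlgebra

namespace IsDualFrame

lemma sum_right_mul_interior_right_mul (h : IsDualFrame e f θ) (b : Fin n) {c : R}
    {x : ExteriorAlgebra R V} (hx : ∑ j, ι R (f j) * interior (θ j) x = c • x) :
    ∑ j, ι R (f j) * interior (θ j) (ι R (f b) * x) = (c + 1) • (ι R (f b) * x) := by
  have e1 : ∀ j, ι R (f j) * interior (θ j) (ι R (f b) * x) =
      (if j = b then 1 else 0 : R) • (ι R (f j) * x) +
        ι R (f b) * (ι R (f j) * interior (θ j) x) := fun j => by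
    rw [interior_ι_mul, h.apply_right, mul_sub, mul_smul_comm, ← mul_assoc (ι R (f j)) (ι R (f b)),
      ι_mul_ι_swap (f j), neg_mul, sub_neg_eq_add, mul_assoc]
  simp only [e1, Finset.sum_add_distrib, ← Finset.mul_sum, hx]
  simp only [ite_smul, one_smul, zero_smul, Finset.sum_ite_eq', Finset.mem_univ, if_true,
    mul_smul_comm]
  module

lemma sum_right_mul_interior_left_mul (h : IsDualFrame e f θ) (a : Fin n) {c : R}
    {x : ExteriorAlgebra R V} (hx : ∑ j, ι R (f j) * interior (θ j) x = c • x) :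
    ∑ j, ι R (f j) * interior (θ j) (ι R (e a) * x) = c • (ι R (e a) * x) := by
  have e1 : ∀ j, ι R (f j) * interior (θ j) (ι R (e a) * x) =
        ι R (e a) * (ι R (f j) * interior (θ j) x) := fun j => by
    rw [interior_ι_mul, h.apply_left, zero_smul, zero_sub, mul_neg, ← mul_assoc,
      ι_mul_ι_swap (f j), neg_mul, neg_neg, mul_assoc]
  simp only [e1, ← Finset.mul_sum, hx, mul_smul_comm]

lemma sum_right_mul_interior_pair_mul (h : IsDualFrame e f θ) (a b : Fin n) {c : R}
    {x : ExteriorAlgebra R V} (hx : ∑ j, ι R (f j) * interior (θ j) x = c • x) :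
    ∑ j, ι R (f j) * interior (θ j) (pair e f a b * x) = (c + 1) • (pair e f a b * x) := by
  rw [pair, mul_assoc]
  exact h.sum_right_mul_interior_left_mul a (h.sum_right_mul_interior_right_mul b hx)

lemma sum_right_mul_interior_pow (h : IsDualFrame e f θ) (m : ℕ) :
    ∑ j, ι R (f j) * interior (θ j) (symplecticForm e f ^ m) =
      (m : R) • symplecticForm (R := R) e f ^ m := by
  induction m with
  | zero => simp [interior_one]
  | succ m ih =>
    have e1 : ∀ j, ι R (f j) * interior (θ j) (symplecticForm e f ^ (m + 1)) =
        ∑ a, ι R (f j) * interior (θ j) (pair e f a a * symplecticForm e f ^ m) := fun j => by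
      rw [pow_succ', ← Finset.mul_sum, ← map_sum, ← Finset.sum_mul]
      rfl
    simp only [e1]
    rw [Finset.sum_comm]
    simp only [h.sum_right_mul_interior_pair_mul _ _ ih]
    rw [← Finset.smul_sum, ← Finset.sum_mul, pow_succ']
    push_cast
    rfl

/-- The operator `∑ f_j ∧ ι_{θ_j}` counts antiholomorphic factors, but in top degree it is
multiplication by n. A top form with n + 1 such factors thus satisfies n x = (n+1) x. -/
lemma eq_zero_of_sum_right_mul_interior (h : IsDualFrame e f θ) {x : ExteriorAlgebra R V}
    (hmem : x ∈ ⋀[R]^(2 * n) V)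
    (hx : ∑ j, ι R (f j) * interior (θ j) x = (n + 1 : R) • x) : x = 0 := by
  have h1 : ∑ j, ι R (f j) * interior (θ j) x = (n : R) • x := by
    simp only [← h.smul_eq_right_mul_interior _ _ hmem]
    simp [Nat.cast_smul_eq_nsmul]
  rw [h1, add_smul, one_smul] at hx
  simpa using hx

lemma right_mul_right_mul_pow (h : IsDualFrame e f θ) (hn : 1 ≤ n) (b k : Fin n) :
    ι R (f b) * (ι R (f k) * symplecticForm e f ^ (n - 1)) = 0 := by
  refine h.eq_zero_of_sum_right_mul_interior ?_ ?_
  · have := SetLike.mul_mem_graded (A := fun i : ℕ => ⋀[R]^i V) (ι_mem (R := R) (f b))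
      (SetLike.mul_mem_graded (A := fun i : ℕ => ⋀[R]^i V) (ι_mem (f k))
      (symplecticForm_pow_mem (R := R) e f (n - 1)))
    convert this using 2
    simp only [smul_eq_mul]
    omega
  · rw [h.sum_right_mul_interior_right_mul b (h.sum_right_mul_interior_right_mul k
      (h.sum_right_mul_interior_pow (n - 1)))]
    congr 1
    push_cast [hn]
    ring

lemma right_mul_right_mul_pair_mul_pow (h : IsDualFrame e f θ) (hn : 2 ≤ n) (b k p q : Fin n) :
    ι R (f b) * (ι R (f k) * (pair e f p q * symplecticForm e f ^ (n - 2))) = 0 := by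
  refine h.eq_zero_of_sum_right_mul_interior ?_ ?_
  · have := SetLike.mul_mem_graded (A := fun i : ℕ => ⋀[R]^i V) (ι_mem (R := R) (f b))
      (SetLike.mul_mem_graded (A := fun i : ℕ => ⋀[R]^i V) (ι_mem (f k))
      (SetLike.mul_mem_graded (A := fun i : ℕ => ⋀[R]^i V) (pair_mem e f p q)
      (symplecticForm_pow_mem (R := R) e f (n - 2))))
    convert this using 2
    simp only [smul_eq_mul]
    omega
  · rw [h.sum_right_mul_interior_right_mul b (h.sum_right_mul_interior_right_mul k
      (h.sum_right_mul_interior_pair_mul p q (h.sum_right_mul_interior_pow (n - 2))))]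
    congr 1
    push_cast [hn]
    ring

end IsDualFrame

end NumberOperator

/-! ### `(1,1)`-forms and their powers -/

section TwoForm

variable {n : ℕ}

/-- The `(1,1)`-form `i ∑ M_{kj} dz^j ∧ d z̄^k`. -/
def twoForm (M : Matrix (Fin n) (Fin n) ℂ) : Form n :=
  Complex.I • ∑ k, ∑ j, M k j • (dz j * dzbar k)

lemma commute_twoForm (M : Matrix (Fin n) (Fin n) ℂ) (x : Form n) : Commute (twoForm M) x := by
  refine Commute.smul_left (Commute.sum_left _ _ _ fun k _ => Commute.sum_left _ _ _ fun j _ =>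
    Commute.smul_left (commute_ι_mul_ι _ _ _) _) _

lemma twoForm_eq_symplecticForm (M : Matrix (Fin n) (Fin n) ℂ) :
    twoForm M = Complex.I • symplecticForm (R := ℂ) (lowered M) dzbarCovector := by
  simp only [twoForm, symplecticForm, lowered, map_sum, map_smul, Finset.sum_mul, smul_mul_assoc]
  rfl

lemma dz_eq_sum_lowered (g : Matrix (Fin n) (Fin n) ℂ) (hg : g.det ≠ 0) (j : Fin n) :
    dz j = ∑ a, g⁻¹ j a • ExteriorAlgebra.ι ℂ (lowered g a) := by
  have h1 : g⁻¹ * g = 1 := Matrix.nonsing_inv_mul g (Ne.isUnit hg)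
  simp only [lowered, map_sum, map_smul, Finset.smul_sum, smul_smul]
  rw [Finset.sum_comm]
  simp only [← Finset.sum_smul, ← Matrix.mul_apply, h1, Matrix.one_apply, ite_smul, one_smul,
    zero_smul, Finset.sum_ite_eq, Finset.mem_univ, if_true]
  rfl

lemma twoForm_eq_sum_pair (g : Matrix (Fin n) (Fin n) ℂ) (hg : g.det ≠ 0)
    (M : Matrix (Fin n) (Fin n) ℂ) :
    twoForm M = Complex.I • ∑ q, ∑ p, (M * g⁻¹) q p • pair (R := ℂ) (lowered g) dzbarCovector p q := by
  simp only [twoForm, Matrix.mul_apply, dz_eq_sum_lowered g hg, Finset.sum_mul, Finset.smul_sum,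
    Finset.sum_smul, smul_mul_assoc, smul_smul]
  refine Finset.sum_congr rfl fun k _ => ?_
  rw [Finset.sum_comm]
  rfl

/-- Normalizing a functional on the top power turns top-degree identities into scalar ones. -/
lemma exists_top_functional (g : Matrix (Fin n) (Fin n) ℂ) (hg : g.det ≠ 0) :
    ∃ L : Form n →ₗ[ℂ] ℂ, L (symplecticForm (R := ℂ) (lowered g) dzbarCovector ^ n) = 1 := by
  have h : symplecticForm (R := ℂ) (lowered g) dzbarCovector ^ n ≠ 0 := by
    rw [symplecticForm_lowered_pow]
    refine smul_ne_zero (mul_ne_zero (mul_ne_zero (pow_ne_zero _ (by norm_num)) ?_) hg)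
      topForm_ne_zero
    exact_mod_cast n.factorial_ne_zero
  obtain ⟨L, hL⟩ := Module.Projective.exists_dual_ne_zero ℂ h
  exact ⟨(L (symplecticForm (R := ℂ) (lowered g) dzbarCovector ^ n))⁻¹ • L, by simp [hL]⟩

variable {g : Matrix (Fin n) (Fin n) ℂ} {L : Form n →ₗ[ℂ] ℂ}

local notation "σ" => symplecticForm (R := ℂ) (lowered g) dzbarCovector
local notation "π" => pair (R := ℂ) (lowered g) dzbarCovector

lemma top_pair (hL : L (σ ^ n) = 1) (hn : 1 ≤ n) (a b : Fin n) :
    L (π a b * σ ^ (n - 1)) = delta₁ a b / n := by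
  have h := congrArg L ((isDualFrame g).top₁ hn a b)
  have hn0 : (n : ℂ) ≠ 0 := by exact_mod_cast (by omega : n ≠ 0)
  simp only [map_smul, smul_eq_mul, hL, mul_one] at h
  rw [eq_div_iff hn0, ← h, mul_comm]

lemma top_pair_pair (hL : L (σ ^ n) = 1) (hn : 2 ≤ n) (a b j k : Fin n) :
    L (π a b * (π j k * σ ^ (n - 2))) = delta₂ a b j k / (n * (n - 1)) := by
  have h := congrArg L ((isDualFrame g).top₂ hn a b j k)
  have hn0 : (n : ℂ) ≠ 0 := by exact_mod_cast (by omega : n ≠ 0)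
  have hn1 : (n : ℂ) - 1 ≠ 0 := sub_ne_zero.mpr (by exact_mod_cast (by omega : n ≠ 1))
  simp only [map_smul, smul_eq_mul, hL, mul_one] at h
  rw [eq_div_iff (mul_ne_zero hn0 hn1), ← h, mul_comm]

lemma top_pair_pair_pair (hL : L (σ ^ n) = 1) (hn : 3 ≤ n) (a b c d j k : Fin n) :
    L (π a b * (π c d * (π j k * σ ^ (n - 3)))) =
      delta₃ a b c d j k / (n * (n - 1) * (n - 2)) := by
  have h := congrArg L ((isDualFrame g).top₃ hn a b c d j k)
  have hn0 : (n : ℂ) ≠ 0 := by exact_mod_cast (by omega : n ≠ 0)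
  have hn1 : (n : ℂ) - 1 ≠ 0 := sub_ne_zero.mpr (by exact_mod_cast (by omega : n ≠ 1))
  have hn2 : (n : ℂ) - 2 ≠ 0 := sub_ne_zero.mpr (by exact_mod_cast (by omega : n ≠ 2))
  simp only [map_smul, smul_eq_mul, hL, mul_one] at h
  rw [eq_div_iff (mul_ne_zero (mul_ne_zero hn0 hn1) hn2), ← h, mul_comm]

lemma top_pair_pair_pair_pair (hL : L (σ ^ n) = 1) (hn : 4 ≤ n) (a b c d r s j k : Fin n) :
    L (π a b * (π c d * (π r s * (π j k * σ ^ (n - 4))))) =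
      delta₄ a b c d r s j k / (n * (n - 1) * (n - 2) * (n - 3)) := by
  have h := congrArg L ((isDualFrame g).top₄ hn a b c d r s j k)
  have hn0 : (n : ℂ) ≠ 0 := by exact_mod_cast (by omega : n ≠ 0)
  have hn1 : (n : ℂ) - 1 ≠ 0 := sub_ne_zero.mpr (by exact_mod_cast (by omega : n ≠ 1))
  have hn2 : (n : ℂ) - 2 ≠ 0 := sub_ne_zero.mpr (by exact_mod_cast (by omega : n ≠ 2))
  have hn3 : (n : ℂ) - 3 ≠ 0 := sub_ne_zero.mpr (by exact_mod_cast (by omega : n ≠ 3))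
  simp only [map_smul, smul_eq_mul, hL, mul_one] at h
  rw [eq_div_iff (mul_ne_zero (mul_ne_zero (mul_ne_zero hn0 hn1) hn2) hn3), ← h, mul_comm]

lemma top_twoForm_pow (hL : L (σ ^ n) = 1) (hn : 1 ≤ n) (a b : Fin n) :
    L (π a b * twoForm g ^ (n - 1)) = Complex.I ^ (n - 1) * (delta₁ a b / n) := by
  rw [twoForm_eq_symplecticForm, smul_pow, mul_smul_comm, map_smul, top_pair hL hn, smul_eq_mul]

lemma top_twoForm_mul_pow (hg : g.det ≠ 0) (hL : L (σ ^ n) = 1) (hn : 2 ≤ n)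
    (M : Matrix (Fin n) (Fin n) ℂ) (a b : Fin n) :
    L (π a b * (twoForm g ^ (n - 2) * twoForm M)) = Complex.I ^ (n - 1) / (n * (n - 1)) *
      ∑ q, ∑ p, (M * g⁻¹) q p * delta₂ a b p q := by
  rw [← (commute_twoForm M _).eq, twoForm_eq_symplecticForm g, smul_pow,
    twoForm_eq_sum_pair g hg M]
  simp only [smul_mul_assoc, mul_smul_comm, Finset.sum_mul, Finset.mul_sum, map_smul, map_sum,
    smul_eq_mul, top_pair_pair hL hn, Finset.smul_sum]
  refine Finset.sum_congr rfl fun q _ => Finset.sum_congr rfl fun p _ => ?_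
  rw [show n - 1 = n - 2 + 1 by omega, pow_succ]
  ring

lemma top_pair_mul_twoForm_mul_pow (hg : g.det ≠ 0) (hL : L (σ ^ n) = 1) (hn : 3 ≤ n)
    (M : Matrix (Fin n) (Fin n) ℂ) (a b c k : Fin n) :
    L (π a b * (π c k * (twoForm g ^ (n - 3) * twoForm M))) =
      Complex.I ^ (n - 2) / (n * (n - 1) * (n - 2)) *
      ∑ q, ∑ p, (M * g⁻¹) q p * delta₃ a b c k p q := by
  rw [← (commute_twoForm M _).eq, twoForm_eq_symplecticForm g, smul_pow,
    twoForm_eq_sum_pair g hg M]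
  simp only [smul_mul_assoc, mul_smul_comm, Finset.sum_mul, Finset.mul_sum, map_smul, map_sum,
    smul_eq_mul, top_pair_pair_pair hL hn, Finset.smul_sum]
  refine Finset.sum_congr rfl fun q _ => Finset.sum_congr rfl fun p _ => ?_
  rw [show n - 2 = n - 3 + 1 by omega, pow_succ]
  ring

lemma top_pair_mul_twoForm_mul_twoForm_mul_pow (hg : g.det ≠ 0) (hL : L (σ ^ n) = 1) (hn : 4 ≤ n)
    (M N : Matrix (Fin n) (Fin n) ℂ) (a b c k : Fin n) :
    L (π a b * (π c k * (twoForm g ^ (n - 4) * twoForm M * twoForm N))) =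
      Complex.I ^ (n - 2) / (n * (n - 1) * (n - 2) * (n - 3)) *
      ∑ s, ∑ r, ∑ q, ∑ p, (M * g⁻¹) q p * (N * g⁻¹) s r * delta₄ a b c k p q r s := by
  rw [← (commute_twoForm M _).eq, mul_assoc (twoForm M), ← (commute_twoForm N _).eq,
    twoForm_eq_symplecticForm g, smul_pow,
    twoForm_eq_sum_pair g hg M, twoForm_eq_sum_pair g hg N]
  simp only [smul_mul_assoc, mul_smul_comm, Finset.sum_mul, Finset.mul_sum, map_smul, map_sum,
    smul_eq_mul, top_pair_pair_pair_pair hL hn, Finset.smul_sum]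
  refine Finset.sum_congr rfl fun s _ => Finset.sum_congr rfl fun r _ =>
    Finset.sum_congr rfl fun q _ => Finset.sum_congr rfl fun p _ => ?_
  rw [show n - 2 = n - 4 + 1 + 1 by omega, pow_succ, pow_succ]
  ring

end TwoForm

/-! ### Derivatives of powers -/

section Powers

variable {n : ℕ} {A : Type*} [NormedRing A] [NormedAlgebra ℂ A]

lemma hasDerivWithinAt_pow_of_commute {α : ℝ → A} {α' : A} {s : Set ℝ} {t : ℝ}
    (h : HasDerivWithinAt α α' s t) (hc : Commute (α t) α') (m : ℕ) :
    HasDerivWithinAt (fun r => α r ^ m) ((m : ℂ) • (α t ^ (m - 1) * α')) s t := by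
  induction m with
  | zero => simpa using hasDerivWithinAt_const t s (1 : A)
  | succ m ih =>
    simp only [pow_succ]
    refine (ih.mul h).congr_deriv ?_
    rcases m with _ | m
    · simp
    · simp only [Nat.add_sub_cancel, smul_mul_assoc, mul_assoc, ← hc.eq]
      rw [← mul_assoc (α t ^ m) (α t), ← pow_succ]
      push_cast
      module

variable {z : Cn n} {U : Set (Cn n)} (ε : ℂ) (j : Fin n)

lemma wirt_pow {α : Cn n → A} (h : DifferentiableAt ℝ α z) (hc : ∀ x, Commute (α z) x) (m : ℕ) :
    wirt ε j (fun w => α w ^ m) z = (m : ℂ) • (α z ^ (m - 1) * wirt ε j α z) := by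
  induction m with
  | zero => simp
  | succ m ih =>
    simp only [pow_succ]
    rw [wirt_mul ε j (h.fun_pow m) h, ih]
    rcases m with _ | m
    · simp
    · simp only [Nat.add_sub_cancel, smul_mul_assoc, mul_assoc, ← (hc (wirt ε j α z)).eq]
      rw [← mul_assoc (α z ^ m) (α z), ← pow_succ]
      push_cast
      module

end Powers

/-! ### Powers of the Kähler form of a matrix-valued function -/

section MatrixFunction

variable {n : ℕ} {U : Set (Cn n)} {z : Cn n} {G : Cn n → Matrix (Fin n) (Fin n) ℂ}

/-- Entrywise Wirtinger derivative of a matrix-valued function. -/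
def wirtMatrix (ε : ℂ) (j : Fin n) (G : Cn n → Matrix (Fin n) (Fin n) ℂ) (z : Cn n) :
    Matrix (Fin n) (Fin n) ℂ :=
  Matrix.of fun k l => wirt ε j (fun w => G w k l) z

lemma contDiffOn_wirtMatrix (hU : IsOpen U) (hG : ∀ k l, ContDiffOn ℝ ∞ (fun w => G w k l) U)
    (ε : ℂ) (j k l : Fin n) : ContDiffOn ℝ ∞ (fun w => wirtMatrix ε j G w k l) U :=
  contDiffOn_wirt ε j hU (hG k l)

lemma contDiffOn_twoForm {E : Type*} [NormedAddCommGroup E] [NormedSpace ℝ E] {U : Set E}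
    {G : E → Matrix (Fin n) (Fin n) ℂ}
    (hG : ∀ k l, ContDiffOn ℝ ∞ (fun w => G w k l) U) :
    ContDiffOn ℝ ∞ (fun w => twoForm (G w)) U := by
  have h : ∀ k j, ContDiffOn ℝ ∞ (fun w => G w k j • (dz j * dzbar k : Form n)) U := fun k j =>
    ContDiffOn.fun_smul (hG k j) (contDiffOn_const (c := (dz j * dzbar k : Form n)))
  exact (ContDiffOn.sum fun k _ => ContDiffOn.sum fun j _ => h k j).const_smul Complex.I

lemma wirt_twoForm (ε : ℂ) (j : Fin n) (hG : ∀ k l, DifferentiableAt ℝ (fun w => G w k l) z) :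
    wirt ε j (fun w => twoForm (G w)) z = twoForm (wirtMatrix ε j G z) := by
  have h1 : ∀ k l, DifferentiableAt ℝ (fun w => G w k l • (dz l * dzbar k : Form n)) z :=
    fun k l => (hG k l).fun_smul (differentiableAt_const _)
  have h2 : ∀ k, DifferentiableAt ℝ (fun w => ∑ l, G w k l • (dz l * dzbar k : Form n)) z :=
    fun k => DifferentiableAt.fun_sum fun l _ => h1 k l
  simp only [twoForm]
  rw [wirt_const_smul ε j _ (DifferentiableAt.fun_sum fun k _ => h2 k), wirt_sum ε j _ fun k _ => h2 k]
  congr 1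
  refine Finset.sum_congr rfl fun k _ => ?_
  rw [wirt_sum ε j _ fun l _ => h1 k l]
  refine Finset.sum_congr rfl fun l _ => ?_
  rw [wirt_smul ε j (hG k l) (differentiableAt_const _)]
  simp [wirtMatrix]

lemma differentiableAt_of_contDiffOn {E F : Type*} [NormedAddCommGroup E] [NormedSpace ℝ E]
    [NormedAddCommGroup F] [NormedSpace ℝ F] {U : Set E}
    (hU : IsOpen U) {f : E → F} (hF : ContDiffOn ℝ ∞ f U) {z : E} (hz : z ∈ U) :
    DifferentiableAt ℝ f z :=
  (hF.contDiffAt (hU.mem_nhds hz)).differentiableAt (by simp)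

lemma wirt_twoForm_pow (hU : IsOpen U) (hG : ∀ k l, ContDiffOn ℝ ∞ (fun w => G w k l) U)
    (hz : z ∈ U) (ε : ℂ) (j : Fin n) (m : ℕ) :
    wirt ε j (fun w => twoForm (G w) ^ m) z =
      (m : ℂ) • (twoForm (G z) ^ (m - 1) * twoForm (wirtMatrix ε j G z)) := by
  rw [wirt_pow ε j (differentiableAt_of_contDiffOn hU (contDiffOn_twoForm hG) hz)
    (commute_twoForm _), wirt_twoForm ε j fun k l => differentiableAt_of_contDiffOn hU (hG k l) hz]

lemma wirt_wirt_twoForm_pow (hU : IsOpen U) (hG : ∀ k l, ContDiffOn ℝ ∞ (fun w => G w k l) U)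
    (hz : z ∈ U) (ε δ : ℂ) (j k : Fin n) (m : ℕ) :
    wirt ε j (wirt δ k (fun w => twoForm (G w) ^ m)) z =
      (m : ℂ) • (twoForm (G z) ^ (m - 1) * twoForm (wirtMatrix ε j (wirtMatrix δ k G) z) +
        ((m - 1 : ℕ) : ℂ) • (twoForm (G z) ^ (m - 2) * twoForm (wirtMatrix ε j G z) *
          twoForm (wirtMatrix δ k G z))) := by
  have hG' := contDiffOn_wirtMatrix hU hG δ k
  have d1 := differentiableAt_of_contDiffOn hU (contDiffOn_twoForm hG') hz
  have d2 : DifferentiableAt ℝ (fun w => twoForm (G w) ^ (m - 1)) z :=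
    (differentiableAt_of_contDiffOn hU (contDiffOn_twoForm hG) hz).fun_pow _
  rw [wirt_congr_of_isOpen ε j hU hz fun w hw => wirt_twoForm_pow hU hG hw δ k m,
    wirt_const_smul ε j _ (d2.fun_mul d1), wirt_mul ε j d2 d1,
    wirt_twoForm ε j fun k l => differentiableAt_of_contDiffOn hU (hG' k l) hz,
    wirt_twoForm_pow hU hG hz, smul_mul_assoc]
  rfl

lemma del_delbar_eq (hU : IsOpen U) {α : Cn n → Form n} (hα : ContDiffOn ℝ ∞ α U) (hz : z ∈ U) :
    del (delbar α) z = ∑ j, ∑ k, dz j * (dzbar k * wirt (-1) j (wirt 1 k α) z) := by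
  have h1 : ∀ w ∈ U, delbar α w = ∑ k, dzbar k * wirt 1 k α w := fun w hw =>
    delbar_eq (differentiableAt_of_contDiffOn hU hα hw)
  have h2 : ∀ k, DifferentiableAt ℝ (wirt 1 k α) z := fun k =>
    differentiableAt_of_contDiffOn hU (contDiffOn_wirt 1 k hU hα) hz
  have h3 : ∀ k, DifferentiableAt ℝ (fun w => dzbar k * wirt 1 k α w) z := fun k =>
    (differentiableAt_const _).mul (h2 k)
  have h4 : DifferentiableAt ℝ (delbar α) z :=
    (DifferentiableAt.fun_sum fun k _ => h3 k).congr_of_eventuallyEq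
      (Filter.eventually_of_mem (hU.mem_nhds hz) h1)
  rw [del_eq h4]
  refine Finset.sum_congr rfl fun j _ => ?_
  rw [wirt_congr_of_isOpen _ _ hU hz h1, wirt_sum _ _ _ fun k _ => h3 k, Finset.mul_sum]
  exact Finset.sum_congr rfl fun k _ => by rw [wirt_const_mul _ _ _ (h2 k)]

/-! ### The flow equation in components -/

/-- The components of `i∂∂̄ω^{n-2}` up to a factor. -/
def flowTensor (G : Cn n → Matrix (Fin n) (Fin n) ℂ) (z : Cn n) (a b : Fin n) : ℂ :=
  ∑ j, ∑ k, ∑ c, (G z)⁻¹ j c *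
    ((∑ q, ∑ p, (wirtMatrix (-1) j (wirtMatrix 1 k G) z * (G z)⁻¹) q p * delta₃ a b c k p q) +
      if 4 ≤ n then ∑ s, ∑ r, ∑ q, ∑ p, (wirtMatrix (-1) j G z * (G z)⁻¹) q p *
        (wirtMatrix 1 k G z * (G z)⁻¹) s r * delta₄ a b c k p q r s else 0)

/-- ∂∂̄ω^{n-2} is n - 2 times ω^{n-3} ∂∂̄ω + (n-3) ω^{n-4} ∂ω ∂̄ω, written with derivatives of
coefficients. The factors n - 2 and n - 3 cancel against the falling factorials of the δ₃- and
δ₄-contractions, leaving one common constant. -/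
lemma top_del_delbar (hn : 3 ≤ n) (hU : IsOpen U) (hG : ∀ k l, ContDiffOn ℝ ∞ (fun w => G w k l) U)
    (hz : z ∈ U) (hg : (G z).det ≠ 0) {L : Form n →ₗ[ℂ] ℂ}
    (hL : L (symplecticForm (R := ℂ) (lowered (G z)) dzbarCovector ^ n) = 1) (a b : Fin n) :
    L (pair (R := ℂ) (lowered (G z)) dzbarCovector a b *
      (Complex.I • del (delbar fun w => twoForm (G w) ^ (n - 2)) z)) =
      Complex.I ^ (n - 1) / (n * (n - 1)) * flowTensor G z a b := by
  have hn0 : (n : ℂ) ≠ 0 := by exact_mod_cast (by omega : n ≠ 0)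
  have hn1 : (n : ℂ) - 1 ≠ 0 := sub_ne_zero.mpr (by exact_mod_cast (by omega : n ≠ 1))
  have hn2 : (n : ℂ) - 2 ≠ 0 := sub_ne_zero.mpr (by exact_mod_cast (by omega : n ≠ 2))
  rw [del_delbar_eq hU ((contDiffOn_twoForm hG).pow (n - 2)) hz, flowTensor]
  simp only [Finset.smul_sum, Finset.mul_sum, map_sum]
  refine Finset.sum_congr rfl fun j _ => Finset.sum_congr rfl fun k _ => ?_
  rw [wirt_wirt_twoForm_pow hU hG hz, dz_eq_sum_lowered _ hg j]
  simp only [Finset.sum_mul, Finset.smul_sum, Finset.mul_sum, map_sum]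
  refine Finset.sum_congr rfl fun c _ => ?_
  have e1 : ∀ x : Form n, ExteriorAlgebra.ι ℂ (lowered (G z) c) * (dzbar k * x) =
      pair (R := ℂ) (lowered (G z)) dzbarCovector c k * x := fun x => by
    rw [pair, mul_assoc]; rfl
  simp only [smul_mul_assoc, e1, mul_smul_comm, mul_add, map_add, map_smul, smul_eq_mul]
  have e2 : ((n - 2 : ℕ) : ℂ) = n - 2 := by push_cast [show 2 ≤ n by omega]; ring
  have e3 : ((n - 2 - 1 : ℕ) : ℂ) = n - 3 := by
    rw [show n - 2 - 1 = n - 3 by omega]; push_cast [hn]; ring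
  have e4 : Complex.I ^ (n - 1) = Complex.I ^ (n - 2) * Complex.I := by
    rw [show n - 1 = n - 2 + 1 by omega, pow_succ]
  rw [e2, e3, show n - 2 - 1 = n - 3 by omega, show n - 2 - 2 = n - 4 by omega,
    top_pair_mul_twoForm_mul_pow hg hL hn, e4]
  split_ifs with h4
  · have hn3 : (n : ℂ) - 3 ≠ 0 := sub_ne_zero.mpr (by exact_mod_cast (by omega : n ≠ 3))
    rw [top_pair_mul_twoForm_mul_twoForm_mul_pow hg hL h4]
    field_simp
  -- For n = 3 the exponent n - 4 truncates to 0, which is harmless because the coefficient n - 3 of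
  -- that term vanishes.
  · have : (n : ℂ) - 3 = 0 := by
      rw [show n = 3 by omega]; norm_num
    rw [this]
    field_simp
    simp [mul_assoc]

/-- Apply the functional `L(e_a ∧ f_b ∧ ·)` to the flow equation and compare the two values of the
derivative, which is unique on the time set. Dividing by i^{n-1}/(n(n-1)) leaves the stated
coefficients. -/
lemma flow_components (hn : 3 ≤ n) (hU : IsOpen U)
    (hG : ∀ k l, ContDiffOn ℝ ∞ (fun w => G w k l) U)
    (hz : z ∈ U) (hg : (G z).det ≠ 0) {M : ℝ → Matrix (Fin n) (Fin n) ℂ}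
    {M' : Matrix (Fin n) (Fin n) ℂ} {c : ℝ → ℂ} {c' : ℂ} {s : Set ℝ} {t : ℝ}
    (hs : UniqueDiffWithinAt ℝ s t)
    (hM : ∀ k l, HasDerivWithinAt (fun r => M r k l) (M' k l) s t)
    (hc : HasDerivWithinAt c c' s t) (hMt : M t = G z)
    (hflow : FormHasDerivWithinAt (fun r => c r • twoForm (M r) ^ (n - 1))
      (Complex.I • del (delbar fun w => twoForm (G w) ^ (n - 2)) z) s t) (a b : Fin n) :
    (n - 1) * c' * delta₁ a b +
      (n - 1) * c t * ∑ q, ∑ p, (M' * (G z)⁻¹) q p * delta₂ a b p q = flowTensor G z a b := by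
  obtain ⟨L, hL⟩ := exists_top_functional (G z) hg
  have hn0 : (n : ℂ) ≠ 0 := by exact_mod_cast (by omega : n ≠ 0)
  have hn1 : (n : ℂ) - 1 ≠ 0 := sub_ne_zero.mpr (by exact_mod_cast (by omega : n ≠ 1))
  have hI : Complex.I ^ (n - 1) ≠ 0 := pow_ne_zero _ Complex.I_ne_zero
  have h2 : HasDerivWithinAt (fun r => twoForm (M r)) (twoForm M') s t := by
    have h : ∀ k l, HasDerivWithinAt (fun r => M r k l • (dz l * dzbar k : Form n))
        (M' k l • (dz l * dzbar k)) s t := fun k l => by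
      simpa using (hM k l).fun_smul (hasDerivWithinAt_const t s (dz l * dzbar k : Form n))
    exact (HasDerivWithinAt.fun_sum fun k _ => HasDerivWithinAt.fun_sum fun l _ => h k l).const_smul
      Complex.I
  have h3 := hc.smul (hasDerivWithinAt_pow_of_commute h2 (commute_twoForm _ _) (n - 1))
  let L' : Form n →ₗ[ℂ] ℂ :=
    L ∘ₗ LinearMap.mulLeft ℂ (pair (R := ℂ) (lowered (G z)) dzbarCovector a b)
  have h4 := (((LinearMap.toContinuousLinearMap L').restrictScalars ℝ).hasFDerivAt.comp_hasDerivWithinAt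
    t h3)
  have h5 := hs.eq_deriv _ h4 (hflow L')
  have e2 : ((n - 1 : ℕ) : ℂ) = n - 1 := by push_cast [show 1 ≤ n by omega]; ring
  have h6 : L (pair (R := ℂ) (lowered (G z)) dzbarCovector a b *
      (c t • ((n - 1 : ℕ) : ℂ) • (twoForm (M t) ^ (n - 1 - 1) * twoForm M') +
        c' • twoForm (M t) ^ (n - 1))) = L (pair (R := ℂ) (lowered (G z)) dzbarCovector a b *
      (Complex.I • del (delbar fun w => twoForm (G w) ^ (n - 2)) z)) := h5
  rw [top_del_delbar hn hU hG hz hg hL, hMt, e2, show n - 1 - 1 = n - 2 by omega] at h6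
  simp only [mul_add, mul_smul_comm, map_add, map_smul, smul_eq_mul,
    top_twoForm_mul_pow hg hL (by omega : 2 ≤ n), top_twoForm_pow hL (by omega : 1 ≤ n)] at h6
  have h7 : Complex.I ^ (n - 1) / (n * (n - 1)) * flowTensor G z a b =
      Complex.I ^ (n - 1) / (n * (n - 1)) * ((n - 1) * c' * delta₁ a b +
      (n - 1) * c t * ∑ q, ∑ p, (M' * (G z)⁻¹) q p * delta₂ a b p q) := by
    rw [← h6]
    field_simp
    ring
  exact (mul_left_cancel₀ (div_ne_zero hI (mul_ne_zero hn0 hn1)) h7).symm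

end MatrixFunction

/-! ### Derivatives of determinants and inverses -/

section Det

variable {n : ℕ}

/-- The δ₁-contraction is a trace. Because the n-th power of a (1,1)-form is its determinant times a
fixed form, this yields Jacobi's formula in time and in space. -/
lemma smul_twoForm_pow_mul (hn : 1 ≤ n) (g : Matrix (Fin n) (Fin n) ℂ) (hg : g.det ≠ 0)
    (M : Matrix (Fin n) (Fin n) ℂ) :
    (n : ℂ) • (twoForm g ^ (n - 1) * twoForm M) = (M * g⁻¹).trace • twoForm g ^ n := by
  have h := (isDualFrame g).top₁ hn
  rw [← (commute_twoForm M _).eq, twoForm_eq_sum_pair g hg M, twoForm_eq_symplecticForm g, smul_pow,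
    smul_pow]
  simp only [smul_mul_assoc, mul_smul_comm, Finset.sum_mul, Finset.smul_sum, smul_smul]
  have e : ∀ q p, ((n : ℂ) * (Complex.I ^ (n - 1) * (Complex.I * (M * g⁻¹) q p))) •
      (pair (R := ℂ) (lowered g) dzbarCovector p q *
        symplecticForm (lowered g) dzbarCovector ^ (n - 1)) =
      (Complex.I ^ n * (M * g⁻¹) q p * delta₁ p q) •
        symplecticForm (R := ℂ) (lowered g) dzbarCovector ^ n := fun q p => by
    rw [mul_smul _ (delta₁ p q), ← h p q, mul_comm, mul_smul]
    congr 1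
    rw [← mul_assoc, ← pow_succ, Nat.sub_add_cancel hn]
  simp only [e, ← Finset.sum_smul]
  congr 1
  simp [delta₁, Matrix.trace, Finset.mul_sum, mul_comm]

lemma twoForm_pow_card (M : Matrix (Fin n) (Fin n) ℂ) :
    twoForm M ^ n = (Complex.I ^ (n ^ 2) * n.factorial * M.det) • topForm n := by
  rw [twoForm_eq_symplecticForm, smul_pow, symplecticForm_lowered_pow, smul_smul, I_pow_sq]
  congr 1
  ring

lemma exists_det_functional (n : ℕ) :
    ∃ L : Form n →ₗ[ℂ] ℂ, ∀ M : Matrix (Fin n) (Fin n) ℂ, L (twoForm M ^ n) = M.det := by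
  obtain ⟨L, hL⟩ := Module.Projective.exists_dual_ne_zero ℂ (topForm_ne_zero (n := n))
  have hI : Complex.I ^ (n ^ 2) * (n.factorial : ℂ) ≠ 0 :=
    mul_ne_zero (pow_ne_zero _ Complex.I_ne_zero) (by exact_mod_cast n.factorial_ne_zero)
  refine ⟨(Complex.I ^ (n ^ 2) * (n.factorial : ℂ) * L (topForm n))⁻¹ • L, fun M => ?_⟩
  rw [twoForm_pow_card, LinearMap.smul_apply, map_smul, smul_eq_mul, smul_eq_mul,
    mul_right_comm _ M.det, inv_mul_cancel_left₀ (mul_ne_zero hI hL)]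

lemma hasDerivWithinAt_twoForm {M : ℝ → Matrix (Fin n) (Fin n) ℂ} {M' : Matrix (Fin n) (Fin n) ℂ}
    {s : Set ℝ} {t : ℝ} (hM : ∀ k l, HasDerivWithinAt (fun r => M r k l) (M' k l) s t) :
    HasDerivWithinAt (fun r => twoForm (M r)) (twoForm M') s t := by
  have h : ∀ k l, HasDerivWithinAt (fun r => M r k l • (dz l * dzbar k : Form n))
      (M' k l • (dz l * dzbar k)) s t := fun k l => by
    simpa using (hM k l).fun_smul (hasDerivWithinAt_const t s (dz l * dzbar k : Form n))
  exact (HasDerivWithinAt.fun_sum fun k _ => HasDerivWithinAt.fun_sum fun l _ => h k l).const_smul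
    Complex.I

lemma hasDerivWithinAt_det (hn : 1 ≤ n) {M : ℝ → Matrix (Fin n) (Fin n) ℂ}
    {M' : Matrix (Fin n) (Fin n) ℂ} {s : Set ℝ} {t : ℝ}
    (hM : ∀ k l, HasDerivWithinAt (fun r => M r k l) (M' k l) s t) (hg : (M t).det ≠ 0) :
    HasDerivWithinAt (fun r => (M r).det) ((M' * (M t)⁻¹).trace * (M t).det) s t := by
  obtain ⟨L, hL⟩ := exists_det_functional n
  have h := (((LinearMap.toContinuousLinearMap L).restrictScalars ℝ).hasFDerivAt.comp_hasDerivWithinAt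
    t (hasDerivWithinAt_pow_of_commute (hasDerivWithinAt_twoForm hM) (commute_twoForm _ _) n))
  rw [smul_twoForm_pow_mul hn _ hg] at h
  refine (h.congr_deriv ?_).congr (fun r _ => ?_) ?_
  · simp [hL]
  · exact (hL _).symm
  · exact (hL _).symm

variable {G : Cn n → Matrix (Fin n) (Fin n) ℂ} {U : Set (Cn n)} {z : Cn n}

lemma wirt_det (hn : 1 ≤ n) (hU : IsOpen U) (hG : ∀ k l, ContDiffOn ℝ ∞ (fun w => G w k l) U)
    (hz : z ∈ U) (hg : (G z).det ≠ 0) (ε : ℂ) (j : Fin n) :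
    wirt ε j (fun w => (G w).det) z = (wirtMatrix ε j G z * (G z)⁻¹).trace * (G z).det := by
  obtain ⟨L, hL⟩ := exists_det_functional n
  have h := wirt_clm ε j (LinearMap.toContinuousLinearMap L)
    (differentiableAt_of_contDiffOn hU ((contDiffOn_twoForm hG).pow n) hz)
  rw [wirt_twoForm_pow hU hG hz, smul_twoForm_pow_mul hn _ hg] at h
  simpa [hL] using h

lemma contDiffOn_det {E : Type*} [NormedAddCommGroup E] [NormedSpace ℝ E] {U : Set E}
    {G : E → Matrix (Fin n) (Fin n) ℂ} (hG : ∀ k l, ContDiffOn ℝ ∞ (fun w => G w k l) U) :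
    ContDiffOn ℝ ∞ (fun w => (G w).det) U := by
  simp only [Matrix.det_apply]
  refine ContDiffOn.sum fun σ _ => ?_
  have : ContDiffOn ℝ ∞ (fun w => ∏ i, G w (σ i) i) U := contDiffOn_prod fun i _ => hG _ _
  rcases Int.units_eq_one_or (Equiv.Perm.sign σ) with h | h
  · simpa [h] using this
  · simpa [h] using this.neg

lemma contDiffOn_inv {E : Type*} [NormedAddCommGroup E] [NormedSpace ℝ E] {U : Set E}
    {G : E → Matrix (Fin n) (Fin n) ℂ} (hG : ∀ k l, ContDiffOn ℝ ∞ (fun w => G w k l) U)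
    (hg : ∀ w ∈ U, (G w).det ≠ 0) (i j : Fin n) :
    ContDiffOn ℝ ∞ (fun w => (G w)⁻¹ i j) U := by
  have h : ContDiffOn ℝ ∞ (fun w => (G w).adjugate i j) U := by
    simp only [Matrix.adjugate_apply]
    refine contDiffOn_det fun k l => ?_
    simp only [Matrix.updateRow_apply]
    split_ifs
    · exact contDiffOn_const
    · exact hG k l
  simp only [Matrix.inv_def, Matrix.smul_apply, Ring.inverse_eq_inv', smul_eq_mul]
  exact ((contDiffOn_det hG).inv hg).mul h

lemma wirt_inv (hU : IsOpen U) (hG : ∀ k l, ContDiffOn ℝ ∞ (fun w => G w k l) U)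
    (hg : ∀ w ∈ U, (G w).det ≠ 0) (hz : z ∈ U) (ε : ℂ) (j p q : Fin n) :
    wirt ε j (fun w => (G w)⁻¹ p q) z = -((G z)⁻¹ * wirtMatrix ε j G z * (G z)⁻¹) p q := by
  have dG := fun k l => differentiableAt_of_contDiffOn hU (hG k l) hz
  have dH := fun k l => differentiableAt_of_contDiffOn hU (contDiffOn_inv hG hg k l) hz
  have h1 : wirtMatrix ε j (fun w => (G w)⁻¹) z * G z = -((G z)⁻¹ * wirtMatrix ε j G z) := by
    ext a b
    have h0 : wirt ε j (fun w => ∑ r, (G w)⁻¹ a r * G w r b) z = 0 := by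
      rw [wirt_congr_of_isOpen ε j hU hz (β := fun _ => (1 : Matrix (Fin n) (Fin n) ℂ) a b)
        fun w hw => ?_, wirt_const]
      rw [← Matrix.mul_apply, Matrix.nonsing_inv_mul _ (Ne.isUnit (hg w hw))]
    rw [wirt_sum ε j _ fun r _ => (dH a r).fun_mul (dG r b)] at h0
    simp only [wirt_mul ε j (dH a _) (dG _ b), Finset.sum_add_distrib] at h0
    rw [Matrix.neg_apply, Matrix.mul_apply, Matrix.mul_apply, eq_neg_iff_add_eq_zero, add_comm]
    exact h0
  have h2 := congrArg (· * (G z)⁻¹) h1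
  simp only [Matrix.mul_assoc, Matrix.mul_nonsing_inv _ (Ne.isUnit (hg z hz)), Matrix.mul_one,
    Matrix.neg_mul] at h2
  have := congrArg (fun M => M p q) h2
  simpa [Matrix.mul_assoc, wirtMatrix] using this

end Det

/-! ### The conformally balanced condition in components -/

section Balanced

variable {n : ℕ} {U : Set (Cn n)} {z : Cn n} {G : Cn n → Matrix (Fin n) (Fin n) ℂ} {c : Cn n → ℂ}

lemma sum_mul_delta₂ (A : Matrix (Fin n) (Fin n) ℂ) (a b : Fin n) :
    ∑ q, ∑ p, A q p * delta₂ a b p q = A.trace * delta₁ a b - A a b := by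
  simp only [delta₂, delta₁, mul_sub, Finset.sum_sub_distrib]
  congr 1
  · simp [Matrix.trace]
  · simp

lemma torsionTrace_eq (G : Cn n → Matrix (Fin n) (Fin n) ℂ) (z : Cn n) (l : Fin n) :
    torsionTrace G z l = ∑ j, ∑ k, (G z)⁻¹ j k *
      (wirtMatrix (-1) j G z k l - wirtMatrix (-1) l G z k j) := by
  simp only [torsionTrace, torsion, delz_eq_wirt, wirtMatrix, Matrix.of_apply]

/-- Wedge the closedness equation with dz̄^b: the ∂̄-part vanishes by type, and the ∂-part is a
δ₂-contraction. Lowering b then gives ∂_m c + c tr(g⁻¹ ∂_m g) = c g^{jk̄} ∂_j g_{k̄m}, and the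
difference of the last two expressions is the torsion trace. -/
lemma wirt_conformal_factor (hn : 2 ≤ n) (hU : IsOpen U)
    (hG : ∀ k l, ContDiffOn ℝ ∞ (fun w => G w k l) U)
    (hz : z ∈ U) (hg : (G z).det ≠ 0) (hc : DifferentiableAt ℝ c z)
    (hbal : extD (fun w => c w • twoForm (G w) ^ (n - 1)) z = 0) (m : Fin n) :
    wirt (-1) m c z = c z * torsionTrace G z m := by
  obtain ⟨L, hL⟩ := exists_top_functional (G z) hg
  have hn0 : (n : ℂ) ≠ 0 := by exact_mod_cast (by omega : n ≠ 0)
  have hn1 : (n : ℂ) - 1 ≠ 0 := sub_ne_zero.mpr (by exact_mod_cast (by omega : n ≠ 1))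
  have hI : Complex.I ^ (n - 1) ≠ 0 := pow_ne_zero _ Complex.I_ne_zero
  have e2 : ((n - 1 : ℕ) : ℂ) = n - 1 := by push_cast [show 1 ≤ n by omega]; ring
  have dpow := differentiableAt_of_contDiffOn hU ((contDiffOn_twoForm hG).pow (n - 1)) hz
  have hW : ∀ ε j, wirt ε j (fun w => c w • twoForm (G w) ^ (n - 1)) z =
      (c z * (n - 1)) • (twoForm (G z) ^ (n - 2) * twoForm (wirtMatrix ε j G z)) +
        wirt ε j c z • twoForm (G z) ^ (n - 1) := fun ε j => by
    rw [wirt_smul ε j hc dpow, wirt_twoForm_pow hU hG hz, smul_smul, e2,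
      show n - 1 - 1 = n - 2 by omega]
  rw [extD, del_eq (hc.fun_smul dpow), delbar_eq (hc.fun_smul dpow)] at hbal
  -- Each summand has n + 1 antiholomorphic factors: two explicit ones and n - 1 from the
  -- (1,1)-forms.
  have hzero : ∀ b k, dzbar b * (dzbar k * wirt 1 k (fun w => c w • twoForm (G w) ^ (n - 1)) z) = 0 :=
    fun b k => by
      have z1 := (isDualFrame (G z)).right_mul_right_mul_pow (by omega : 1 ≤ n) b k
      have z2 := (isDualFrame (G z)).right_mul_right_mul_pair_mul_pow hn b k
      rw [hW, ← (commute_twoForm (wirtMatrix 1 k G z) _).eq, twoForm_eq_symplecticForm (G z),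
        twoForm_eq_sum_pair (G z) hg (wirtMatrix 1 k G z), smul_pow, smul_pow]
      simp only [smul_mul_assoc, mul_smul_comm, Finset.sum_mul, Finset.mul_sum, mul_add]
      have z1' : dzbar b * (dzbar k *
        symplecticForm (R := ℂ) (lowered (G z)) dzbarCovector ^ (n - 1)) = 0 := z1
      have z2' : ∀ p q, dzbar b * (dzbar k * (pair (R := ℂ) (lowered (G z)) dzbarCovector p q *
        symplecticForm (R := ℂ) (lowered (G z)) dzbarCovector ^ (n - 2))) = 0 := z2
      simp [z1', z2']
  have key : ∀ b, ∑ l, ∑ a, (G z)⁻¹ l a * (c z * (∑ q, ∑ p,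
      (wirtMatrix (-1) l G z * (G z)⁻¹) q p * delta₂ a b p q) + wirt (-1) l c z * delta₁ a b) = 0 := by
    intro b
    have h := congrArg (fun x => L (dzbar b * x)) hbal
    simp only [mul_add, Finset.mul_sum, hzero, Finset.sum_const_zero, add_zero, mul_zero,
      map_zero] at h
    have h' : ∑ l, ∑ a, (G z)⁻¹ l a * L (pair (R := ℂ) (lowered (G z)) dzbarCovector a b *
        wirt (-1) l (fun w => c w • twoForm (G w) ^ (n - 1)) z) = 0 := by
      rw [map_sum] at h
      rw [← neg_eq_zero, ← h, ← Finset.sum_neg_distrib]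
      refine Finset.sum_congr rfl fun l _ => ?_
      have e3 : dzbar b * (dz l * wirt (-1) l (fun w => c w • twoForm (G w) ^ (n - 1)) z) =
          -∑ a, (G z)⁻¹ l a • (pair (R := ℂ) (lowered (G z)) dzbarCovector a b *
            wirt (-1) l (fun w => c w • twoForm (G w) ^ (n - 1)) z) := by
        rw [← mul_assoc, dz_eq_sum_lowered _ hg l, Finset.mul_sum, Finset.sum_mul,
          ← Finset.sum_neg_distrib]
        refine Finset.sum_congr rfl fun a _ => ?_
        rw [mul_smul_comm, smul_mul_assoc, dzbar, ι_mul_ι_swap, neg_mul, smul_neg]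
        rfl
      rw [e3]
      simp
    have hc0 : Complex.I ^ (n - 1) / n ≠ 0 := div_ne_zero hI hn0
    refine mul_left_cancel₀ hc0 ?_
    rw [mul_zero, ← h']
    simp only [Finset.mul_sum (s := (Finset.univ : Finset (Fin n)))
      (a := Complex.I ^ (n - 1) / (n : ℂ))]
    refine Finset.sum_congr rfl fun l _ => Finset.sum_congr rfl fun a _ => ?_
    simp only [hW, mul_add, map_add, mul_smul_comm, map_smul,
      top_twoForm_mul_pow hg hL hn, top_twoForm_pow hL (by omega : 1 ≤ n), smul_eq_mul]
    field_simp
  have key2 : ∀ b, ∑ l, (G z)⁻¹ l b *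
      (wirt (-1) l c z + c z * (wirtMatrix (-1) l G z * (G z)⁻¹).trace) =
      c z * ∑ l, ((G z)⁻¹ * wirtMatrix (-1) l G z * (G z)⁻¹) l b := by
    intro b
    rw [← sub_eq_zero, ← key b, Finset.mul_sum, ← Finset.sum_sub_distrib]
    refine Finset.sum_congr rfl fun l _ => ?_
    simp only [sum_mul_delta₂, mul_add, mul_sub, Finset.sum_add_distrib, Finset.sum_sub_distrib,
      Matrix.mul_assoc (G z)⁻¹]
    rw [Matrix.mul_apply (M := (G z)⁻¹)]
    simp only [delta₁, mul_ite, mul_one, mul_zero, Finset.sum_ite_eq', Finset.mem_univ, if_true,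
      Finset.mul_sum]
    have : ∀ x, (G z)⁻¹ l x * (c z * (wirtMatrix (-1) l G z * (G z)⁻¹) x b) =
        c z * ((G z)⁻¹ l x * (wirtMatrix (-1) l G z * (G z)⁻¹) x b) := fun x => by ring
    simp only [this]
    ring
  have hHG : (G z)⁻¹ * G z = 1 := Matrix.nonsing_inv_mul _ (Ne.isUnit hg)
  -- Contract with g_{b̄m} to undo the inverse metric.
  have h1 : ∑ b, (∑ l, (G z)⁻¹ l b *
      (wirt (-1) l c z + c z * (wirtMatrix (-1) l G z * (G z)⁻¹).trace)) * G z b m =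
      wirt (-1) m c z + c z * (wirtMatrix (-1) m G z * (G z)⁻¹).trace := by
    simp only [Finset.sum_mul]
    rw [Finset.sum_comm]
    have : ∀ l, ∑ b, (G z)⁻¹ l b * (wirt (-1) l c z + c z *
        (wirtMatrix (-1) l G z * (G z)⁻¹).trace) * G z b m = ((G z)⁻¹ * G z) l m *
        (wirt (-1) l c z + c z * (wirtMatrix (-1) l G z * (G z)⁻¹).trace) := fun l => by
      rw [Matrix.mul_apply, Finset.sum_mul]
      exact Finset.sum_congr rfl fun b _ => by ring
    simp [this, hHG, Matrix.one_apply]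
  have h2 : ∑ b, (c z * ∑ l, ((G z)⁻¹ * wirtMatrix (-1) l G z * (G z)⁻¹) l b) * G z b m =
      c z * ∑ l, ((G z)⁻¹ * wirtMatrix (-1) l G z) l m := by
    simp only [mul_assoc, ← Finset.mul_sum, Finset.sum_mul]
    rw [Finset.sum_comm]
    simp only [← Matrix.mul_apply, Matrix.mul_assoc, hHG, Matrix.mul_one]
  simp only [key2, h2] at h1
  rw [torsionTrace_eq, ← sub_eq_zero]
  have h3 : (wirtMatrix (-1) m G z * (G z)⁻¹).trace =
      ∑ j, ∑ k, (G z)⁻¹ j k * wirtMatrix (-1) m G z k j := by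
    rw [Matrix.trace_mul_comm]
    rfl
  have h4 : ∑ l, ((G z)⁻¹ * wirtMatrix (-1) l G z) l m =
      ∑ j, ∑ k, (G z)⁻¹ j k * wirtMatrix (-1) j G z k m := by
    simp only [Matrix.mul_apply]
  simp only [mul_sub, Finset.sum_sub_distrib]
  rw [← h3, ← h4, h1]
  ring

/-- The logarithmic derivative of the holomorphic volume form of a conformally balanced metric. -/
def logDerivCoeff (G : Cn n → Matrix (Fin n) (Fin n) ℂ) (z : Cn n) (m : Fin n) : ℂ :=
  2 * torsionTrace G z m + (wirtMatrix (-1) m G z * (G z)⁻¹).trace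

/-- Apply ∂_m to c² det g = f f̄. Holomorphy kills ∂_m f̄, the balanced condition gives 2 T_m from
c², and Jacobi's formula gives the trace from det g. -/
lemma wirt_coeff (hn : 2 ≤ n) (hU : IsOpen U)
    (hG : ∀ k l, ContDiffOn ℝ ∞ (fun w => G w k l) U)
    (hz : z ∈ U) (hg : (G z).det ≠ 0) (hc : DifferentiableAt ℝ c z)
    (hbal : extD (fun w => c w • twoForm (G w) ^ (n - 1)) z = 0)
    {f : Cn n → ℂ} (hf : DifferentiableAt ℂ f z) (hf0 : f z ≠ 0)
    (hcf : ∀ w ∈ U, c w ^ 2 * (G w).det = f w * starRingEnd ℂ (f w)) (m : Fin n) :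
    wirt (-1) m f z = f z * logDerivCoeff G z m := by
  have h1 := wirt_conformal_factor hn hU hG hz hg hc hbal m
  have h2 := wirt_congr_of_isOpen (-1) m hU hz hcf
  have dfr : DifferentiableAt ℝ f z := hf.restrictScalars ℝ
  have dfb : DifferentiableAt ℝ (fun w => starRingEnd ℂ (f w)) z :=
    (Complex.conjCLE : ℂ →L[ℝ] ℂ).differentiableAt.comp z dfr
  rw [wirt_mul _ _ (hc.fun_pow 2) (differentiableAt_of_contDiffOn hU (contDiffOn_det hG) hz),
    wirt_pow _ _ hc (fun _ => Commute.all _ _), wirt_mul _ _ dfr dfb,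
    wirt_conj m (-1) (by simp) dfr, neg_neg, wirt_one_eq_zero m hf,
    wirt_det (by omega) hU hG hz hg, h1] at h2
  have hfb : starRingEnd ℂ (f z) ≠ 0 := by simpa using hf0
  have h3 := hcf z hz
  refine mul_right_cancel₀ hfb ?_
  simp only [map_zero, mul_zero, zero_add] at h2
  rw [← h2, logDerivCoeff, mul_right_comm, ← h3]
  simp
  ring

lemma contDiffOn_torsionTrace (hU : IsOpen U) (hG : ∀ k l, ContDiffOn ℝ ∞ (fun w => G w k l) U)
    (hg : ∀ w ∈ U, (G w).det ≠ 0) (m : Fin n) :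
    ContDiffOn ℝ ∞ (fun w => torsionTrace G w m) U := by
  simp only [torsionTrace_eq]
  exact ContDiffOn.sum fun j _ => ContDiffOn.sum fun k _ => (contDiffOn_inv hG hg j k).mul
    ((contDiffOn_wirtMatrix hU hG _ _ _ _).sub (contDiffOn_wirtMatrix hU hG _ _ _ _))

lemma contDiffOn_logDerivCoeff (hU : IsOpen U) (hG : ∀ k l, ContDiffOn ℝ ∞ (fun w => G w k l) U)
    (hg : ∀ w ∈ U, (G w).det ≠ 0) (m : Fin n) :
    ContDiffOn ℝ ∞ (fun w => logDerivCoeff G w m) U := by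
  simp only [logDerivCoeff, Matrix.trace, Matrix.diag_apply, Matrix.mul_apply]
  exact (contDiffOn_const.mul (contDiffOn_torsionTrace hU hG hg m)).add
    (ContDiffOn.sum fun j _ => ContDiffOn.sum fun k _ =>
      (contDiffOn_wirtMatrix hU hG _ _ _ _).mul (contDiffOn_inv hG hg _ _))

/-- A holomorphic function whose logarithmic derivatives are smooth is smooth. -/
lemma contDiffOn_of_wirt_eq (hU : IsOpen U) {f : Cn n → ℂ} (hf : DifferentiableOn ℂ f U)
    {A : Fin n → Cn n → ℂ} (hA : ∀ m, ContDiffOn ℝ ∞ (A m) U)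
    (h : ∀ w ∈ U, ∀ m, wirt (-1) m f w = f w * A m w) : ContDiffOn ℝ ∞ f U := by
  have hd : ∀ w ∈ U, DifferentiableAt ℂ f w := fun w hw => hf.differentiableAt (hU.mem_nhds hw)
  have hfd : ∀ w ∈ U, fderiv ℝ f w = ∑ m, (f w * A m w) •
      ((ContinuousLinearMap.proj m : Cn n →L[ℂ] ℂ).restrictScalars ℝ) := fun w hw => by
    ext v
    rw [fderiv_apply_eq_sum_wirt (hd w hw)]
    simp [h w hw, mul_comm]
  -- Bootstrap: the differential of f is f times smooth data, so f of class C^k forces its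
  -- differential to be C^k and f to be C^{k+1}. Complex differentiability supplies the continuous
  -- case.
  refine contDiffOn_infty.mpr fun k => ?_
  induction k with
  | zero =>
    exact contDiffOn_zero.mpr fun w hw => (hd w hw).continuousAt.continuousWithinAt
  | succ k ih =>
    push_cast
    rw [contDiffOn_succ_iff_fderiv_of_isOpen hU]
    refine ⟨fun w hw => ((hd w hw).restrictScalars ℝ).differentiableWithinAt, by simp, ?_⟩
    refine ContDiffOn.congr (ContDiffOn.sum fun m _ => ?_) hfd
    exact (ih.mul ((hA m).of_le (by exact_mod_cast le_top))).fun_smul contDiffOn_const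

end Balanced

/-! ### Time derivatives and space derivatives commute -/

section Mixed

lemma two_le_infty : (2 : WithTop ℕ∞) ≤ ∞ := by
  exact WithTop.coe_le_coe.mpr (le_top : (2 : ℕ∞) ≤ ⊤)

variable {n : ℕ} {U : Set (Cn n)} {E : Type*} [NormedAddCommGroup E] [NormedSpace ℂ E]

lemma mem_closure_interior_Ico_prod (hU : IsOpen U) {T t : ℝ} (ht : t ∈ Set.Ico 0 T) {z : Cn n}
    (hz : z ∈ U) : (t, z) ∈ closure (_root_.interior (Set.Ico (0 : ℝ) T ×ˢ U)) := by
  rw [interior_prod_eq, closure_prod_eq, interior_Ico, hU.interior_eq,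
    closure_Ioo (ht.1.trans_lt ht.2).ne]
  exact ⟨⟨ht.1, ht.2.le⟩, subset_closure hz⟩

/-- Both mixed derivatives are values of the second derivative within `[0,T) × U`. That derivative
is symmetric even at t = 0, since every point lies in the closure of the interior. -/
lemma hasDerivWithinAt_wirt (hU : IsOpen U) {T : ℝ} {F : ℝ → Cn n → E} {Φ : ℝ → Cn n → E}
    (hF : ContDiffOn ℝ ∞ (fun p : ℝ × Cn n => F p.1 p.2) (Set.Ico 0 T ×ˢ U))
    (hΦ : ∀ t ∈ Set.Ico 0 T, ∀ w ∈ U,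
      HasDerivWithinAt (fun s => F s w) (Φ t w) (Set.Ico 0 T) t)
    {t : ℝ} (ht : t ∈ Set.Ico 0 T) {z : Cn n} (hz : z ∈ U) (ε : ℂ) (j : Fin n) :
    HasDerivWithinAt (fun s => wirt ε j (F s) z) (wirt ε j (Φ t) z) (Set.Ico 0 T) t := by
  set S := Set.Ico (0 : ℝ) T ×ˢ U with hS
  have huI : UniqueDiffOn ℝ (Set.Ico (0 : ℝ) T) := uniqueDiffOn_Ico 0 T
  have hu : UniqueDiffOn ℝ S := huI.prod hU.uniqueDiffOn
  set F' := fderivWithin ℝ (fun p : ℝ × Cn n => F p.1 p.2) S with hF'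
  have hd : ∀ s ∈ Set.Ico 0 T, ∀ w ∈ U,
      HasFDerivWithinAt (fun p : ℝ × Cn n => F p.1 p.2) (F' (s, w)) S (s, w) := fun s hs w hw =>
    ((hF.differentiableOn (by simp)) (s, w) ⟨hs, hw⟩).hasFDerivWithinAt
  have hF'c : ContDiffOn ℝ ∞ F' S := hF.fderivWithin hu (by simp)
  have hsnd : HasFDerivWithinAt F' (fderivWithin ℝ F' S (t, z)) S (t, z) :=
    ((hF'c.differentiableOn (by simp)) (t, z) ⟨ht, hz⟩).hasFDerivWithinAt
  have hsym : IsSymmSndFDerivWithinAt ℝ (fun p : ℝ × Cn n => F p.1 p.2) S (t, z) :=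
    (hF (t, z) ⟨ht, hz⟩).isSymmSndFDerivWithinAt (by simpa using two_le_infty) hu
      (mem_closure_interior_Ico_prod hU ht hz) ⟨ht, hz⟩
  -- derivatives in space
  have hspace : ∀ s ∈ Set.Ico 0 T, ∀ w : Cn n, w ∈ U → ∀ {A : Type _} [NormedAddCommGroup A]
      [NormedSpace ℝ A] (f : ℝ × Cn n → A) (f' : ℝ × Cn n →L[ℝ] A),
      HasFDerivWithinAt f f' S (s, w) →
      HasFDerivAt (fun x => f (s, x)) (f'.comp (ContinuousLinearMap.inr ℝ ℝ (Cn n))) w := by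
    intro s hs w hw A _ _ f f' hf
    have h1 : HasFDerivWithinAt (fun x : Cn n => (s, x)) (ContinuousLinearMap.inr ℝ ℝ (Cn n)) U w :=
      (hasFDerivAt_prodMk_right s w).hasFDerivWithinAt
    exact (hf.comp w h1 fun x hx => ⟨hs, hx⟩).hasFDerivAt (hU.mem_nhds hw)
  -- derivatives in time
  have htime : ∀ w : Cn n, w ∈ U → ∀ {A : Type _} [NormedAddCommGroup A]
      [NormedSpace ℝ A] (f : ℝ × Cn n → A) (f' : ℝ × Cn n →L[ℝ] A) {s : ℝ},
      HasFDerivWithinAt f f' S (s, w) →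
      HasDerivWithinAt (fun r => f (r, w)) (f' (1, 0)) (Set.Ico 0 T) s := by
    intro w hw A _ _ f f' s hf
    have h1 : HasDerivWithinAt (fun r : ℝ => (r, w)) ((1 : ℝ), (0 : Cn n)) (Set.Ico 0 T) s :=
      (hasDerivWithinAt_id s _).prodMk (hasDerivWithinAt_const s _ w)
    have hm : Set.MapsTo (fun r : ℝ => (r, w)) (Set.Ico 0 T) S := fun x hx => ⟨hx, hw⟩
    exact hf.comp_hasDerivWithinAt s h1 hm
  have hΦ' : ∀ w ∈ U, Φ t w = F' (t, w) (1, 0) := fun w hw =>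
    (huI t ht).eq_deriv _ (hΦ t ht w hw) (htime w hw _ _ (hd t ht w hw))
  have hwirtF : ∀ s ∈ Set.Ico 0 T, wirt ε j (F s) z = (1 / 2 : ℂ) • (F' (s, z) (0, Pi.single j 1) +
      (ε * Complex.I) • F' (s, z) (0, Pi.single j Complex.I)) := fun s hs => by
    rw [wirt, (hspace s hs z hz _ _ (hd s hs z hz)).fderiv]
    rfl
  have hwirtΦ : wirt ε j (Φ t) z = (1 / 2 : ℂ) •
      (fderivWithin ℝ F' S (t, z) (0, Pi.single j 1) (1, 0) +
      (ε * Complex.I) • fderivWithin ℝ F' S (t, z) (0, Pi.single j Complex.I) (1, 0)) := by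
    rw [wirt_congr_of_isOpen ε j hU hz hΦ', wirt]
    have h1 : HasFDerivAt (fun w => F' (t, w) (1, 0)) _ z :=
      (hspace t ht z hz _ _ hsnd).clm_apply (hasFDerivAt_const ((1 : ℝ), (0 : Cn n)) z)
    rw [h1.fderiv]
    simp
  have hdv : ∀ v : ℝ × Cn n, HasDerivWithinAt (fun s => F' (s, z) v)
      (fderivWithin ℝ F' S (t, z) (1, 0) v) (Set.Ico 0 T) t := fun v => by
    simpa using (htime z hz _ _ hsnd).clm_apply (hasDerivWithinAt_const t _ v)
  have hsy : ∀ v w, fderivWithin ℝ F' S (t, z) v w = fderivWithin ℝ F' S (t, z) w v := hsym.eq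
  rw [hwirtΦ, hsy _ (1, 0), hsy _ (1, 0)]
  exact HasDerivWithinAt.congr (((hdv (0, Pi.single j 1)).add
    ((hdv (0, Pi.single j Complex.I)).const_smul (ε * Complex.I))).const_smul (1 / 2 : ℂ))
    hwirtF (hwirtF t ht)

end Mixed

/-! ### The exterior derivative of `i∂∂̄α` vanishes -/

section Exact

variable {n : ℕ} {U : Set (Cn n)} {z : Cn n}

lemma sum_ι_mul_ι_mul_eq_zero (v : Fin n → Cotangent n) (x : Fin n → Fin n → Form n)
    (h : ∀ l j, x l j = x j l) :
    ∑ l, ∑ j, ExteriorAlgebra.ι ℂ (v l) * (ExteriorAlgebra.ι ℂ (v j) * x l j) = 0 := by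
  have h1 : ∑ l, ∑ j, ExteriorAlgebra.ι ℂ (v l) * (ExteriorAlgebra.ι ℂ (v j) * x l j) =
      -∑ l, ∑ j, ExteriorAlgebra.ι ℂ (v l) * (ExteriorAlgebra.ι ℂ (v j) * x l j) := by
    conv_lhs => rw [Finset.sum_comm]
    simp only [← Finset.sum_neg_distrib]
    refine Finset.sum_congr rfl fun l _ => Finset.sum_congr rfl fun j _ => ?_
    rw [← mul_assoc, ι_mul_ι_swap, neg_mul, mul_assoc, h j l]
  have h2 := add_eq_zero_iff_eq_neg.mpr h1
  rw [← two_smul ℂ] at h2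
  exact (smul_eq_zero.mp h2).resolve_left two_ne_zero

lemma wirt_comm_of_contDiffOn {E : Type*} [NormedAddCommGroup E] [NormedSpace ℂ E]
    (hU : IsOpen U) {α : Cn n → E} (hα : ContDiffOn ℝ ∞ α U) (hz : z ∈ U) (ε δ : ℂ) (j k : Fin n) :
    wirt ε j (wirt δ k α) z = wirt δ k (wirt ε j α) z :=
  wirt_comm ε δ j k ((hα.contDiffAt (hU.mem_nhds hz)).of_le two_le_infty)

/-- Second derivatives are symmetric while dz^l ∧ dz^j and dz̄^m ∧ dz̄^k are antisymmetric; this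
gives ∂∂ = 0, and ∂̄∂∂̄ = 0 after moving dz̄^m past dz^j. -/
lemma extD_del_delbar (hU : IsOpen U) {α : Cn n → Form n} (hα : ContDiffOn ℝ ∞ α U) (hz : z ∈ U)
    (c : ℂ) : extD (fun w => c • del (delbar α) w) z = 0 := by
  set β : Cn n → Form n := fun w =>
    c • ∑ j, ∑ k, dz j * (dzbar k * wirt (-1) j (wirt 1 k α) w) with hβ
  have hW : ∀ j k, ContDiffOn ℝ ∞ (wirt (-1) j (wirt 1 k α)) U := fun j k =>
    contDiffOn_wirt _ _ hU (contDiffOn_wirt _ _ hU hα)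
  have hd : ∀ j k, DifferentiableAt ℝ (wirt (-1) j (wirt 1 k α)) z := fun j k =>
    differentiableAt_of_contDiffOn hU (hW j k) hz
  have hd1 : ∀ j k, DifferentiableAt ℝ
      (fun w => dzbar k * wirt (-1) j (wirt 1 k α) w) z := fun j k =>
    (differentiableAt_const _).fun_mul (hd j k)
  have hd2 : ∀ j k, DifferentiableAt ℝ
      (fun w => dz j * (dzbar k * wirt (-1) j (wirt 1 k α) w)) z := fun j k =>
    (differentiableAt_const _).fun_mul (hd1 j k)
  have hd3 : ∀ j, DifferentiableAt ℝ
      (fun w => ∑ k, dz j * (dzbar k * wirt (-1) j (wirt 1 k α) w)) z := fun j =>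
    DifferentiableAt.fun_sum fun k _ => hd2 j k
  have hd4 : DifferentiableAt ℝ
      (fun w => ∑ j, ∑ k, dz j * (dzbar k * wirt (-1) j (wirt 1 k α) w)) z :=
    DifferentiableAt.fun_sum fun j _ => hd3 j
  have hβd : DifferentiableAt ℝ β z := hd4.const_smul c
  have heq : ∀ w ∈ U, c • del (delbar α) w = β w := fun w hw => by
    rw [del_delbar_eq hU hα hw]
  have hd0 : DifferentiableAt ℝ (fun w => c • del (delbar α) w) z :=
    hβd.congr_of_eventuallyEq (Filter.eventually_of_mem (hU.mem_nhds hz) heq)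
  have hwirt : ∀ ε l, wirt ε l (fun w => c • del (delbar α) w) z =
      c • ∑ j, ∑ k, dz j * (dzbar k * wirt ε l (wirt (-1) j (wirt 1 k α)) z) := fun ε l => by
    rw [wirt_congr_of_isOpen ε l hU hz heq, hβ, wirt_const_smul ε l _ hd4,
      wirt_sum ε l _ fun j _ => hd3 j]
    simp only [wirt_sum ε l _ fun k _ => hd2 _ k, wirt_const_mul ε l _ (hd1 _ _),
      wirt_const_mul ε l _ (hd _ _)]
  have h1 : ∑ l, dz l * ∑ j, ∑ k, dz j *
      (dzbar k * wirt (-1) l (wirt (-1) j (wirt 1 k α)) z) = 0 := by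
    have := sum_ι_mul_ι_mul_eq_zero dzCovector
      (fun l j => ∑ k, dzbar k * wirt (-1) l (wirt (-1) j (wirt 1 k α)) z) fun l j =>
        Finset.sum_congr rfl fun k _ => by
          rw [wirt_comm_of_contDiffOn hU (contDiffOn_wirt _ _ hU hα) hz]
    simp only [Finset.mul_sum] at this ⊢
    exact this
  have h2 : ∑ m, dzbar m * ∑ j, ∑ k, dz j *
      (dzbar k * wirt 1 m (wirt (-1) j (wirt 1 k α)) z) = 0 := by
    have h3 : ∀ j, ∑ m, ∑ k, dzbar m *
        (dzbar k * wirt 1 m (wirt (-1) j (wirt 1 k α)) z) = 0 := fun j =>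
      sum_ι_mul_ι_mul_eq_zero dzbarCovector
        (fun m k => wirt 1 m (wirt (-1) j (wirt 1 k α)) z) fun m k => by
          rw [wirt_comm_of_contDiffOn hU (contDiffOn_wirt 1 k hU hα) hz,
            wirt_comm_of_contDiffOn hU (contDiffOn_wirt 1 m hU hα) hz]
          exact wirt_congr_of_isOpen _ _ hU hz fun w hw => wirt_comm_of_contDiffOn hU hα hw 1 1 m k
    have h4 : ∀ m j k, dzbar m * (dz j * (dzbar k * wirt 1 m (wirt (-1) j (wirt 1 k α)) z)) =
        -(dz j * (dzbar m * (dzbar k * wirt 1 m (wirt (-1) j (wirt 1 k α)) z))) := fun m j k => by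
      rw [← mul_assoc, dzbar, dz, ι_mul_ι_swap, neg_mul, mul_assoc]
    simp only [Finset.mul_sum, h4]
    rw [Finset.sum_comm]
    refine Finset.sum_eq_zero fun j _ => ?_
    have h5 := congrArg (dz j * ·) (h3 j)
    simp only [Finset.mul_sum, mul_zero] at h5
    simp only [Finset.sum_neg_distrib, h5, neg_zero]
  rw [extD, del_eq hd0, delbar_eq hd0]
  simp only [hwirt, mul_smul_comm, ← Finset.smul_sum, h1, h2, smul_zero, add_zero]

lemma FormHasDerivWithinAt.hasDerivWithinAt {A : ℝ → Form n} {B : Form n} {s : Set ℝ} {t : ℝ}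
    (h : FormHasDerivWithinAt A B s t) : HasDerivWithinAt A B s t := by
  have h1 : ∀ x : Form n, x = ∑ i, (formBasis n).coord i x • formBasis n i := fun x =>
    ((formBasis n).sum_repr x).symm
  have h2 : HasDerivWithinAt (fun r => ∑ i, (formBasis n).coord i (A r) • formBasis n i)
      (∑ i, (formBasis n).coord i B • formBasis n i) s t :=
    HasDerivWithinAt.fun_sum fun i _ => by
      simpa using (h ((formBasis n).coord i)).fun_smul (hasDerivWithinAt_const t s (formBasis n i))
  rw [h1 B]
  exact h2.congr (fun r _ => h1 _) (h1 _)

/-- Closedness is preserved by an evolution whose right-hand side is `i∂∂̄`-exact. -/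
lemma extD_eq_zero_of_flow (hU : IsOpen U) {T : ℝ} {F α : ℝ → Cn n → Form n}
    (hF : ContDiffOn ℝ ∞ (fun p : ℝ × Cn n => F p.1 p.2) (Set.Ico 0 T ×ˢ U))
    (hα : ∀ t ∈ Set.Ico 0 T, ContDiffOn ℝ ∞ (α t) U)
    (hflow : ∀ t ∈ Set.Ico 0 T, ∀ w ∈ U, HasDerivWithinAt (fun s => F s w)
      (Complex.I • del (delbar (α t)) w) (Set.Ico 0 T) t)
    (h0 : ∀ w ∈ U, extD (F 0) w = 0) {t : ℝ} (ht : t ∈ Set.Ico 0 T) (hz : z ∈ U) :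
    extD (F t) z = 0 := by
  have hFt : ∀ s ∈ Set.Ico 0 T, DifferentiableAt ℝ (F s) z := fun s hs => by
    have h1 : ContDiffOn ℝ ∞ (F s) U :=
      hF.comp (contDiffOn_const.prodMk contDiffOn_id) fun w hw => ⟨hs, hw⟩
    exact differentiableAt_of_contDiffOn hU h1 hz
  have hE : ∀ s ∈ Set.Ico 0 T, extD (F s) z =
      ∑ j, dz j * wirt (-1) j (F s) z + ∑ j, dzbar j * wirt 1 j (F s) z := fun s hs => by
    rw [extD, del_eq (hFt s hs), delbar_eq (hFt s hs)]
  -- Differentiate d F under the space derivatives: the time derivative is d(i∂∂̄α) = 0. An interval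
  -- being convex, d F is then constant.
  have hder : ∀ s ∈ Set.Ico 0 T, HasDerivWithinAt (fun r => extD (F r) z) 0 (Set.Ico 0 T) s := by
    intro s hs
    have hw := fun ε j => hasDerivWithinAt_wirt hU hF hflow hs hz ε j
    have hc : ∀ (x : Form n) ε j, HasDerivWithinAt (fun r => x * wirt ε j (F r) z)
        (x * wirt ε j (fun w => Complex.I • del (delbar (α s)) w) z) (Set.Ico 0 T) s :=
      fun x ε j => by simpa using (hasDerivWithinAt_const s _ x).fun_mul (hw ε j)
    have hsum := (HasDerivWithinAt.fun_sum (u := Finset.univ) fun j _ => hc (dz j) (-1) j).add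
      (HasDerivWithinAt.fun_sum (u := Finset.univ) fun j _ => hc (dzbar j) 1 j)
    have hd0 : DifferentiableAt ℝ (fun w => Complex.I • del (delbar (α s)) w) z := by
      have : ContDiffOn ℝ ∞ (fun w => Complex.I • ∑ j, ∑ k,
          dz j * (dzbar k * wirt (-1) j (wirt 1 k (α s)) w)) U := by
        have hh : ∀ j k, ContDiffOn ℝ ∞
            (fun w => dz j * (dzbar k * wirt (-1) j (wirt 1 k (α s)) w)) U := fun j k =>
          contDiffOn_const.mul (contDiffOn_const.mul
            (contDiffOn_wirt _ _ hU (contDiffOn_wirt _ _ hU (hα s hs))))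
        exact (ContDiffOn.sum fun j _ => ContDiffOn.sum fun k _ => hh j k).const_smul Complex.I
      exact (differentiableAt_of_contDiffOn hU this hz).congr_of_eventuallyEq
        (Filter.eventually_of_mem (hU.mem_nhds hz) fun w hw => by
          dsimp only
          rw [del_delbar_eq hU (hα s hs) hw])
    have hz0 := extD_del_delbar hU (hα s hs) hz Complex.I
    rw [extD, del_eq hd0, delbar_eq hd0] at hz0
    rw [hz0] at hsum
    exact hsum.congr hE (hE s hs)
  have h00 : (0 : ℝ) ∈ Set.Ico 0 T := ⟨le_rfl, ht.1.trans_lt ht.2⟩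
  have hconst := (convex_Ico (0 : ℝ) T).is_const_of_fderivWithin_eq_zero (𝕜 := ℝ)
    (f := fun r => extD (F r) z) (fun s hs => (hder s hs).differentiableWithinAt)
    (fun s hs => by
      have := (hder s hs).hasFDerivWithinAt.fderivWithin (uniqueDiffOn_Ico 0 T s hs)
      rw [this]; ext; simp) ht h00
  exact hconst.trans (h0 z hz)

end Exact

/-! ### Second-order consequences of the conformally balanced condition -/

section SecondOrder

variable {n : ℕ} {U : Set (Cn n)} {z : Cn n} {G : Cn n → Matrix (Fin n) (Fin n) ℂ}

/-- ∂_{k̄}∂_m f = ∂_m∂_{k̄} f = 0, while ∂_m f = f A turns the left-hand side into f ∂_{k̄} A. -/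
lemma wirt_eq_zero_of_logDeriv (hU : IsOpen U) {f A : Cn n → ℂ} {m : Fin n}
    (hf : DifferentiableOn ℂ f U) (hfs : ContDiffOn ℝ ∞ f U) (hA : ContDiffOn ℝ ∞ A U)
    (h : ∀ w ∈ U, wirt (-1) m f w = f w * A w) (hz : z ∈ U) (hf0 : f z ≠ 0) (k : Fin n) :
    wirt 1 k A z = 0 := by
  have hbar : ∀ w ∈ U, wirt 1 k f w = 0 := fun w hw =>
    wirt_one_eq_zero k (hf.differentiableAt (hU.mem_nhds hw))
  have h1 := wirt_comm_of_contDiffOn hU hfs hz 1 (-1) k m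
  rw [wirt_congr_of_isOpen _ _ hU hz h, wirt_congr_of_isOpen (-1) m hU hz hbar, wirt_const,
    wirt_mul _ _ (differentiableAt_of_contDiffOn hU hfs hz) (differentiableAt_of_contDiffOn hU hA hz),
    hbar z hz, zero_mul, add_zero] at h1
  exact (mul_eq_zero.mp h1).resolve_left hf0

lemma logDerivCoeff_eq (G : Cn n → Matrix (Fin n) (Fin n) ℂ) (z : Cn n) (m : Fin n) :
    logDerivCoeff G z m = ∑ j, ∑ q, (G z)⁻¹ j q *
      (2 * wirtMatrix (-1) j G z q m - wirtMatrix (-1) m G z q j) := by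
  rw [logDerivCoeff, torsionTrace_eq, Matrix.trace_mul_comm]
  simp only [Matrix.trace, Matrix.diag_apply, Matrix.mul_apply, Finset.mul_sum,
    ← Finset.sum_add_distrib]
  refine Finset.sum_congr rfl fun j _ => Finset.sum_congr rfl fun q _ => ?_
  ring

lemma wirt_logDerivCoeff (hU : IsOpen U) (hG : ∀ k l, ContDiffOn ℝ ∞ (fun w => G w k l) U)
    (hg : ∀ w ∈ U, (G w).det ≠ 0) (hz : z ∈ U) (k m : Fin n) :
    wirt 1 k (fun w => logDerivCoeff G w m) z =
      ∑ j, ∑ q, ((G z)⁻¹ j q * (2 * wirtMatrix (-1) j (wirtMatrix 1 k G) z q m -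
        wirtMatrix (-1) m (wirtMatrix 1 k G) z q j) -
        ((G z)⁻¹ * wirtMatrix 1 k G z * (G z)⁻¹) j q *
          (2 * wirtMatrix (-1) j G z q m - wirtMatrix (-1) m G z q j)) := by
  have dH := fun k l => differentiableAt_of_contDiffOn hU (contDiffOn_inv hG hg k l) hz
  have dP := fun j k l => differentiableAt_of_contDiffOn hU (contDiffOn_wirtMatrix hU hG (-1) j k l) hz
  have d2P := fun j k l => (dP j k l).const_mul 2
  have d3 := fun j q => (d2P j q m).fun_sub (dP m q j)
  have d4 := fun j q => (dH j q).fun_mul (d3 j q)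
  have hcomm : ∀ j q l, wirt 1 k (fun w => wirtMatrix (-1) j G w q l) z =
      wirtMatrix (-1) j (wirtMatrix 1 k G) z q l := fun j q l =>
    wirt_comm_of_contDiffOn hU (hG q l) hz 1 (-1) k j
  simp only [logDerivCoeff_eq]
  rw [wirt_sum _ _ _ fun j _ => DifferentiableAt.fun_sum fun q _ => d4 j q]
  refine Finset.sum_congr rfl fun j _ => ?_
  rw [wirt_sum _ _ _ fun q _ => d4 j q]
  refine Finset.sum_congr rfl fun q _ => ?_
  rw [wirt_mul _ _ (dH j q) (d3 j q), wirt_sub _ _ (d2P j q m) (dP m q j),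
    wirt_const_mul _ _ _ (dP j q m), hcomm, hcomm, wirt_inv hU hG hg hz]
  ring

/-- `∂_c g_{q̄ p}` with the holomorphic indices raised. -/
def hatP (G : Cn n → Matrix (Fin n) (Fin n) ℂ) (z : Cn n) (c q p : Fin n) : ℂ :=
  ∑ j, (G z)⁻¹ j c * (wirtMatrix (-1) j G z * (G z)⁻¹) q p

/-- `∂_{k̄} g_{s̄ r}` with the holomorphic index raised. -/
def hatQ (G : Cn n → Matrix (Fin n) (Fin n) ℂ) (z : Cn n) (k s r : Fin n) : ℂ :=
  (wirtMatrix 1 k G z * (G z)⁻¹) s r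

/-- `∂_c ∂_{k̄} g_{q̄ p}` with the holomorphic indices raised. -/
def hatK (G : Cn n → Matrix (Fin n) (Fin n) ℂ) (z : Cn n) (c k q p : Fin n) : ℂ :=
  ∑ j, (G z)⁻¹ j c * (wirtMatrix (-1) j (wirtMatrix 1 k G) z * (G z)⁻¹) q p

lemma flowTensor_eq (G : Cn n → Matrix (Fin n) (Fin n) ℂ) (z : Cn n) (a b : Fin n) :
    flowTensor G z a b = ∑ c, ∑ k,
      ((∑ q, ∑ p, hatK G z c k q p * delta₃ a b c k p q) +
      if 4 ≤ n then ∑ s, ∑ r, ∑ q, ∑ p, hatP G z c q p * hatQ G z k s r *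
        delta₄ a b c k p q r s else 0) := by
  have h1 : flowTensor G z a b = ∑ c, ∑ k, ∑ j, (G z)⁻¹ j c *
    ((∑ q, ∑ p, (wirtMatrix (-1) j (wirtMatrix 1 k G) z * (G z)⁻¹) q p * delta₃ a b c k p q) +
      if 4 ≤ n then ∑ s, ∑ r, ∑ q, ∑ p, (wirtMatrix (-1) j G z * (G z)⁻¹) q p *
        (wirtMatrix 1 k G z * (G z)⁻¹) s r * delta₄ a b c k p q r s else 0) := by
    rw [flowTensor]
    calc _ = ∑ j, ∑ c, ∑ k, _ := Finset.sum_congr rfl fun j _ => Finset.sum_comm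
      _ = ∑ c, ∑ j, ∑ k, _ := Finset.sum_comm
      _ = _ := Finset.sum_congr rfl fun c _ => Finset.sum_comm
  rw [h1]
  refine Finset.sum_congr rfl fun c _ => Finset.sum_congr rfl fun k _ => ?_
  simp only [mul_add, Finset.sum_add_distrib]
  congr 1
  · simp only [hatK, Finset.mul_sum, Finset.sum_mul]
    rw [Finset.sum_comm]
    refine Finset.sum_congr rfl fun q _ => ?_
    rw [Finset.sum_comm]
    refine Finset.sum_congr rfl fun p _ => Finset.sum_congr rfl fun j _ => ?_
    ring
  · split_ifs
    · simp only [hatP, hatQ, Finset.mul_sum, Finset.sum_mul]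
      rw [Finset.sum_comm]
      refine Finset.sum_congr rfl fun s _ => ?_
      rw [Finset.sum_comm]
      refine Finset.sum_congr rfl fun r _ => ?_
      rw [Finset.sum_comm]
      refine Finset.sum_congr rfl fun q _ => ?_
      rw [Finset.sum_comm]
      refine Finset.sum_congr rfl fun p _ => Finset.sum_congr rfl fun j _ => ?_
      ring
    · simp

lemma sum_comm₃ (f : Fin n → Fin n → Fin n → ℂ) :
    ∑ a, ∑ b, ∑ c, f a b c = ∑ c, ∑ b, ∑ a, f a b c := by
  calc _ = ∑ a, ∑ c, ∑ b, f a b c := Finset.sum_congr rfl fun a _ => Finset.sum_comm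
    _ = ∑ c, ∑ a, ∑ b, f a b c := Finset.sum_comm
    _ = _ := Finset.sum_congr rfl fun c _ => Finset.sum_comm

lemma sum_comm₄ (f : Fin n → Fin n → Fin n → Fin n → ℂ) :
    ∑ a, ∑ b, ∑ c, ∑ d, f a b c d = ∑ d, ∑ c, ∑ b, ∑ a, f a b c d := by
  calc _ = ∑ a, ∑ d, ∑ c, ∑ b, f a b c d := Finset.sum_congr rfl fun a _ => sum_comm₃ _
    _ = ∑ d, ∑ a, ∑ c, ∑ b, f a b c d := Finset.sum_comm
    _ = ∑ d, ∑ c, ∑ a, ∑ b, f a b c d := Finset.sum_congr rfl fun d _ => Finset.sum_comm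
    _ = _ := Finset.sum_congr rfl fun d _ => Finset.sum_congr rfl fun c _ => Finset.sum_comm

lemma sum_raise_left (H A : Matrix (Fin n) (Fin n) ℂ) (B : Fin n → Matrix (Fin n) (Fin n) ℂ)
    (b : Fin n) :
    ∑ m, (∑ j, ∑ q, (H * A) j q * B j q m) * H m b =
      ∑ r, ∑ q, A r q * ∑ j, H j r * (B j * H) q b := by
  simp only [Matrix.mul_apply, Finset.sum_mul, Finset.mul_sum]
  refine (sum_comm₄ _).trans (Finset.sum_congr rfl fun r _ => Finset.sum_congr rfl fun q _ =>
    Finset.sum_congr rfl fun j _ => Finset.sum_congr rfl fun m _ => ?_)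
  ring

lemma sum_raise_right (H A : Matrix (Fin n) (Fin n) ℂ) (B : Fin n → Matrix (Fin n) (Fin n) ℂ)
    (b : Fin n) :
    ∑ m, (∑ j, ∑ q, (H * A) j q * B m q j) * H m b =
      ∑ r, ∑ q, A r q * ∑ m, H m b * (B m * H) q r := by
  simp only [Matrix.mul_apply, Finset.sum_mul, Finset.mul_sum]
  refine (sum_comm₄ _).trans (Finset.sum_congr rfl fun r _ => Finset.sum_congr rfl fun q _ => ?_)
  rw [Finset.sum_comm]
  refine Finset.sum_congr rfl fun m _ => Finset.sum_congr rfl fun j _ => ?_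
  ring

lemma sum_raise_conj (H : Matrix (Fin n) (Fin n) ℂ) (A : Fin n → Matrix (Fin n) (Fin n) ℂ)
    (D : Fin n → Fin n → ℂ) (b : Fin n) :
    ∑ m, (∑ j, ∑ q, (H * A m) q j * D j q) * H m b =
      ∑ r, ∑ j, (∑ m, H m b * A m r j) * ∑ q, D j q * H q r := by
  simp only [Matrix.mul_apply, Finset.sum_mul, Finset.mul_sum]
  refine (sum_comm₄ _).trans (Finset.sum_congr rfl fun r _ => ?_)
  refine Finset.sum_comm.trans (Finset.sum_congr rfl fun j _ => Finset.sum_congr rfl fun q _ =>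
    Finset.sum_congr rfl fun m _ => ?_)
  ring

lemma hat_balanced (hX : ∀ m k, ∑ j, ∑ q, ((G z)⁻¹ j q *
        (2 * wirtMatrix (-1) j (wirtMatrix 1 k G) z q m -
        wirtMatrix (-1) m (wirtMatrix 1 k G) z q j) -
        ((G z)⁻¹ * wirtMatrix 1 k G z * (G z)⁻¹) j q *
          (2 * wirtMatrix (-1) j G z q m - wirtMatrix (-1) m G z q j)) = 0) (k b : Fin n) :
    2 * ∑ q, hatK G z q k q b - ∑ q, hatK G z b k q q =
      ∑ r, ∑ q, hatQ G z k r q * (2 * hatP G z r q b - hatP G z b q r) := by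
  have h1 := sum_raise_left (G z)⁻¹ 1 (fun j => wirtMatrix (-1) j (wirtMatrix 1 k G) z) b
  have h2 := sum_raise_right (G z)⁻¹ 1 (fun j => wirtMatrix (-1) j (wirtMatrix 1 k G) z) b
  have h3 := sum_raise_left (G z)⁻¹ (wirtMatrix 1 k G z * (G z)⁻¹) (fun j => wirtMatrix (-1) j G z) b
  have h4 := sum_raise_right (G z)⁻¹ (wirtMatrix 1 k G z * (G z)⁻¹) (fun j => wirtMatrix (-1) j G z) b
  have h0 : ∑ m, (∑ j, ∑ q, ((G z)⁻¹ j q *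
        (2 * wirtMatrix (-1) j (wirtMatrix 1 k G) z q m -
        wirtMatrix (-1) m (wirtMatrix 1 k G) z q j) -
        ((G z)⁻¹ * wirtMatrix 1 k G z * (G z)⁻¹) j q *
          (2 * wirtMatrix (-1) j G z q m - wirtMatrix (-1) m G z q j))) * (G z)⁻¹ m b = 0 := by
    exact Finset.sum_eq_zero fun m _ => by rw [hX m k, zero_mul]
  simp only [Matrix.mul_one, Matrix.one_apply, ite_mul, one_mul, zero_mul, Finset.sum_ite_eq,
    Finset.mem_univ, if_true, ← Matrix.mul_assoc] at h1 h2 h3 h4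
  simp only [mul_sub, mul_left_comm _ (2 : ℂ), Finset.sum_sub_distrib, ← Finset.mul_sum,
    sub_mul, mul_assoc (2 : ℂ), h1, h2, h3, h4] at h0
  simp only [hatK, hatQ, hatP, mul_sub, mul_left_comm _ (2 : ℂ), Finset.sum_sub_distrib,
    ← Finset.mul_sum]
  linear_combination h0

/-- The counterpart coming from the conjugate equation. It constrains a different trace of ∂∂̄g, so
both are needed. -/
lemma hat_balanced_conj (hX : ∀ m k, ∑ j, ∑ q, ((G z)⁻¹ q j *
        (2 * wirtMatrix (-1) m (wirtMatrix 1 j G) z k q -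
        wirtMatrix (-1) m (wirtMatrix 1 k G) z j q) -
        ((G z)⁻¹ * wirtMatrix (-1) m G z * (G z)⁻¹) q j *
          (2 * wirtMatrix 1 j G z k q - wirtMatrix 1 k G z j q)) = 0) (k b : Fin n) :
    2 * ∑ j, hatK G z b j k j - ∑ j, hatK G z b k j j =
      ∑ r, ∑ j, hatP G z b r j * (2 * hatQ G z j k r - hatQ G z k j r) := by
  have h1 : ∑ m, (∑ j, ∑ q, (G z)⁻¹ q j * wirtMatrix (-1) m (wirtMatrix 1 j G) z k q) *
      (G z)⁻¹ m b = ∑ j, hatK G z b j k j := by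
    simp only [hatK, Matrix.mul_apply, Finset.sum_mul, Finset.mul_sum]
    rw [Finset.sum_comm]
    refine Finset.sum_congr rfl fun j _ => Finset.sum_congr rfl fun m _ =>
      Finset.sum_congr rfl fun q _ => ?_
    ring
  have h2 : ∑ m, (∑ j, ∑ q, (G z)⁻¹ q j * wirtMatrix (-1) m (wirtMatrix 1 k G) z j q) *
      (G z)⁻¹ m b = ∑ j, hatK G z b k j j := by
    simp only [hatK, Matrix.mul_apply, Finset.sum_mul, Finset.mul_sum]
    rw [Finset.sum_comm]
    refine Finset.sum_congr rfl fun j _ => Finset.sum_congr rfl fun m _ =>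
      Finset.sum_congr rfl fun q _ => ?_
    ring
  have h3 := sum_raise_conj (G z)⁻¹ (fun m => wirtMatrix (-1) m G z * (G z)⁻¹)
    (fun j q => wirtMatrix 1 j G z k q) b
  have h4 := sum_raise_conj (G z)⁻¹ (fun m => wirtMatrix (-1) m G z * (G z)⁻¹)
    (fun j q => wirtMatrix 1 k G z j q) b
  have h0 : ∑ m, (∑ j, ∑ q, ((G z)⁻¹ q j *
        (2 * wirtMatrix (-1) m (wirtMatrix 1 j G) z k q -
        wirtMatrix (-1) m (wirtMatrix 1 k G) z j q) -
        ((G z)⁻¹ * wirtMatrix (-1) m G z * (G z)⁻¹) q j *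
          (2 * wirtMatrix 1 j G z k q - wirtMatrix 1 k G z j q))) * (G z)⁻¹ m b = 0 := by
    exact Finset.sum_eq_zero fun m _ => by rw [hX m k, zero_mul]
  simp only [← Matrix.mul_assoc] at h3 h4
  simp only [mul_sub, mul_left_comm _ (2 : ℂ), Finset.sum_sub_distrib, ← Finset.mul_sum,
    sub_mul, mul_assoc (2 : ℂ), h1, h2, h3, h4] at h0
  simp only [← Matrix.mul_apply] at h0
  simp only [mul_sub, mul_left_comm _ (2 : ℂ), Finset.sum_sub_distrib, ← Finset.mul_sum]
  simp only [hatP, hatQ]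
  linear_combination h0

lemma wirtMatrix_conj (hU : IsOpen U) (hG : ∀ k l, ContDiffOn ℝ ∞ (fun w => G w k l) U)
    (hherm : ∀ w k l, starRingEnd ℂ (G w k l) = G w l k) (hz : z ∈ U) (ε : ℂ)
    (hε : starRingEnd ℂ ε = ε) (j k l : Fin n) :
    starRingEnd ℂ (wirtMatrix (-ε) j G z k l) = wirtMatrix ε j G z l k := by
  simp only [wirtMatrix, Matrix.of_apply]
  rw [← wirt_conj j ε hε (differentiableAt_of_contDiffOn hU (hG k l) hz)]
  simp only [hherm]

lemma wirtMatrix_wirtMatrix_conj (hU : IsOpen U)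
    (hG : ∀ k l, ContDiffOn ℝ ∞ (fun w => G w k l) U)
    (hherm : ∀ w k l, starRingEnd ℂ (G w k l) = G w l k) (hz : z ∈ U) (j k q m : Fin n) :
    starRingEnd ℂ (wirtMatrix (-1) j (wirtMatrix 1 k G) z q m) =
      wirtMatrix (-1) k (wirtMatrix 1 j G) z m q := by
  have h1 : wirtMatrix 1 j (wirtMatrix (-1) k G) z m q =
      wirtMatrix (-1) k (wirtMatrix 1 j G) z m q :=
    wirt_comm_of_contDiffOn hU (hG m q) hz 1 (-1) j k
  rw [← h1]
  simp only [wirtMatrix, Matrix.of_apply]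
  rw [← wirt_conj j 1 (by simp)
    (differentiableAt_of_contDiffOn hU (contDiffOn_wirt 1 k hU (hG q m)) hz)]
  refine wirt_congr_of_isOpen _ _ hU hz fun w hw => ?_
  have := wirtMatrix_conj hU hG hherm hw (-1) (by simp) k q m
  simpa [wirtMatrix] using this

lemma inv_conj (hherm : ∀ w k l, starRingEnd ℂ (G w k l) = G w l k) (k l : Fin n) :
    starRingEnd ℂ ((G z)⁻¹ k l) = (G z)⁻¹ l k := by
  have h : (G z).IsHermitian := Matrix.IsHermitian.ext fun i j => hherm z j i
  exact h.inv.apply l k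

end SecondOrder

/-! ### Contractions with generalized Kronecker deltas -/

section Contractions

variable {n : ℕ}

/-- The torsion of an array of first derivatives. -/
def hatTorsion (P : Fin n → Fin n → Fin n → ℂ) (q c l : Fin n) : ℂ := P c q l - P l q c

/-- The conjugate torsion of an array of first derivatives. -/
def hatTorsionBar (Q : Fin n → Fin n → Fin n → ℂ) (r k s : Fin n) : ℂ := Q k s r - Q s k r

/-- The trace of a torsion array. -/
def hatTrace (T : Fin n → Fin n → Fin n → ℂ) (l : Fin n) : ℂ := ∑ j, T j j l

lemma sum_sum_mul_left (u : Fin n → ℂ) (v : Fin n → Fin n → ℂ) :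
    ∑ x, ∑ y, u y * v y x = ∑ x, u x * ∑ y, v x y := by
  rw [Finset.sum_comm]
  simp only [Finset.mul_sum]

lemma sum_sum_mul_right (u : Fin n → Fin n → ℂ) (v : Fin n → ℂ) :
    ∑ x, ∑ y, u y x * v y = ∑ x, (∑ y, u x y) * v x := by
  rw [Finset.sum_comm]
  simp only [Finset.sum_mul]

/-- Moves the row indices of `delta₄` outside and the column indices inside, so that each Kronecker
delta collapses an inner sum. -/
lemma sum_rows_first (f : Fin n → Fin n → Fin n → Fin n → Fin n → Fin n → ℂ) :
    ∑ c, ∑ k, ∑ s, ∑ r, ∑ q, ∑ p, f c k s r q p =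
      ∑ r, ∑ p, ∑ c, ∑ k, ∑ q, ∑ s, f c k s r q p := by
  calc _ = ∑ c, ∑ k, ∑ p, ∑ q, ∑ r, ∑ s, f c k s r q p :=
        Finset.sum_congr rfl fun c _ => Finset.sum_congr rfl fun k _ => sum_comm₄ _
    _ = ∑ c, ∑ k, ∑ p, ∑ r, ∑ q, ∑ s, f c k s r q p :=
        Finset.sum_congr rfl fun c _ => Finset.sum_congr rfl fun k _ =>
          Finset.sum_congr rfl fun p _ => Finset.sum_comm
    _ = ∑ c, ∑ r, ∑ p, ∑ k, ∑ q, ∑ s, f c k s r q p :=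
        Finset.sum_congr rfl fun c _ => sum_comm₃ _
    _ = ∑ p, ∑ r, ∑ c, ∑ k, ∑ q, ∑ s, f c k s r q p := sum_comm₃ _
    _ = _ := Finset.sum_comm

lemma sum_mul_delta₃ (K : Fin n → Fin n → Fin n → Fin n → ℂ) (a b : Fin n) :
    ∑ c, ∑ k, ∑ q, ∑ p, K c k q p * delta₃ a b c k p q =
      (∑ c, ∑ q, K c c q q - ∑ c, ∑ k, K c k c k) * delta₁ a b - ∑ q, K b a q q
        + ∑ k, K b k a k + ∑ c, K c a c b - ∑ c, K c c a b := by
  simp only [delta₃, delta₂, delta₁, mul_sub, mul_ite, mul_one, mul_zero,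
    Finset.sum_sub_distrib, Finset.sum_ite_eq, Finset.sum_ite_eq', Finset.mem_univ, if_true,
    Finset.sum_ite_irrel, Finset.sum_const_zero]
  split_ifs <;> ring

/-- `delta₄` is antisymmetric in its row indices and in its column indices. Hence it sees `P` only
through its antisymmetrization in c, p and `Q` only in k, s, which are the two torsions. -/
lemma sum_mul_mul_delta₄ (P Q : Fin n → Fin n → Fin n → ℂ) (a b : Fin n) :
    ∑ c, ∑ k, ∑ s, ∑ r, ∑ q, ∑ p, P c q p * Q k s r * delta₄ a b c k p q r s =
      (-1 / 2 * (∑ r, ∑ k, ∑ s, hatTorsion P r k s * hatTorsionBar Q r k s) +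
        ∑ l, hatTrace (hatTorsion P) l * hatTrace (hatTorsionBar Q) l) * delta₁ a b
      + 1 / 2 * ∑ p, ∑ r, hatTorsion P a p r * hatTorsionBar Q b p r
      - ∑ s, (hatTorsion P a b s * hatTrace (hatTorsionBar Q) s +
          hatTrace (hatTorsion P) s * hatTorsionBar Q b a s)
      - hatTrace (hatTorsion P) b * hatTrace (hatTorsionBar Q) a
      + ∑ r, ∑ p, hatTorsion P r p b * hatTorsionBar Q r p a := by
  rw [sum_rows_first]
  simp only [delta₄, delta₃, delta₂, delta₁, mul_sub, mul_ite, mul_one, mul_zero,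
    Finset.sum_sub_distrib, Finset.sum_ite_eq, Finset.sum_ite_eq', Finset.mem_univ, if_true,
    Finset.sum_ite_irrel, Finset.sum_const_zero]
  simp only [hatTorsion, hatTorsionBar, hatTrace, Finset.sum_sub_distrib, mul_sub, sub_mul,
    Finset.sum_add_distrib, ← Finset.mul_sum, ← Finset.sum_mul]
  have e1 := sum_sum_mul_left (P b a) fun y x => Q y x x
  have e2 := sum_sum_mul_left (fun y => P y a b) fun y x => Q y x x
  have e3 := sum_sum_mul_left (P b a) fun y x => Q x y x
  have e4 := sum_sum_mul_left (fun y => P y a b) fun y x => Q x y x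
  have e5 := sum_sum_mul_right (fun y x => P y x x) fun y => Q y a b
  have e6 := sum_sum_mul_right (fun y x => P y x x) fun y => Q a y b
  have e7 : ∑ x, ∑ y, P y a x * Q x y b = ∑ x, ∑ y, P x a y * Q y x b := Finset.sum_comm
  have e8 : ∑ x, ∑ y, P y a x * Q y x b = ∑ x, ∑ y, P x a y * Q x y b := Finset.sum_comm
  have e9 : ∑ x, ∑ y, ∑ z, P z x y * Q z y x = ∑ x, ∑ y, ∑ z, P y x z * Q y z x :=
    Finset.sum_congr rfl fun x _ => Finset.sum_comm
  have e10 : ∑ x, ∑ y, ∑ z, P z x y * Q y z x = ∑ x, ∑ y, ∑ z, P y x z * Q z y x :=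
    Finset.sum_congr rfl fun x _ => Finset.sum_comm
  have e11 := sum_sum_mul_left (fun y => ∑ i, P i i y) fun y x => Q y x x
  have e12 := sum_sum_mul_left (fun y => ∑ i, P i i y) fun y x => Q x y x
  have e13 : ∑ x, ∑ y, ∑ z, P z y y * Q z x x = ∑ x, (∑ y, P x y y) * ∑ y, Q x y y := by
    rw [sum_comm₃]
    simp only [Finset.sum_mul_sum]
  have e14 : ∑ x, ∑ y, ∑ z, P z y y * Q x z x = ∑ x, (∑ y, P x y y) * ∑ y, Q y x y := by
    rw [sum_comm₃]
    simp only [Finset.sum_mul_sum]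
  -- The scalar contractions enter only on the diagonal a = b; off it, `e1` to `e8` suffice.
  split_ifs
  · linear_combination e1 - e2 - e3 + e4 - e5 + e6 - 1 / 2 * e7 + 1 / 2 * e8 - 1 / 2 * e9 +
      1 / 2 * e10 - e11 + e12 + e13 - e14
  · linear_combination e1 - e2 - e3 + e4 - e5 + e6 - 1 / 2 * e7 + 1 / 2 * e8

lemma sum_delta₁_self : ∑ a : Fin n, (delta₁ a a : ℂ) = n := by simp [delta₁]

lemma trace_sum_mul_mul_delta₄ (P Q : Fin n → Fin n → Fin n → ℂ) :
    ∑ a, ∑ c, ∑ k, ∑ s, ∑ r, ∑ q, ∑ p, P c q p * Q k s r * delta₄ a a c k p q r s =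
      (n - 3) * (-1 / 2 * (∑ r, ∑ k, ∑ s, hatTorsion P r k s * hatTorsionBar Q r k s) +
        ∑ l, hatTrace (hatTorsion P) l * hatTrace (hatTorsionBar Q) l) := by
  simp only [sum_mul_mul_delta₄, Finset.sum_add_distrib, Finset.sum_sub_distrib,
    ← Finset.mul_sum, sum_delta₁_self]
  have h1 : ∑ a, ∑ s, hatTorsion P a a s * hatTrace (hatTorsionBar Q) s =
      ∑ l, hatTrace (hatTorsion P) l * hatTrace (hatTorsionBar Q) l := by
    rw [Finset.sum_comm]
    simp only [← Finset.sum_mul]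
    rfl
  have h2 : ∑ a, ∑ s, hatTrace (hatTorsion P) s * hatTorsionBar Q a a s =
      ∑ l, hatTrace (hatTorsion P) l * hatTrace (hatTorsionBar Q) l := by
    rw [Finset.sum_comm]
    simp only [← Finset.mul_sum]
    rfl
  have h3 : ∑ a, ∑ r, ∑ p, hatTorsion P r p a * hatTorsionBar Q r p a =
      ∑ r, ∑ k, ∑ s, hatTorsion P r k s * hatTorsionBar Q r k s := by
    calc _ = ∑ r, ∑ a, ∑ p, hatTorsion P r p a * hatTorsionBar Q r p a := Finset.sum_comm
      _ = _ := Finset.sum_congr rfl fun r _ => Finset.sum_comm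
  rw [h1, h2, h3]
  ring

end Contractions

/-! ### Raising indices -/

section Raising

variable {n : ℕ} (H : Matrix (Fin n) (Fin n) ℂ) (T U : Fin n → Fin n → Fin n → ℂ)

/-- The array `T` with its last two indices raised. -/
def raise₂ (q c l : Fin n) : ℂ := ∑ m, ∑ j, H m c * H j l * T q m j

/-- The array `U` with its first index raised. -/
def raise₁ (r k s : Fin n) : ℂ := ∑ m, H m r * U m k s

/-- As for the other contractions of this section, nested sums are flattened to one sum over tuples,
whose entries are then permuted. -/
lemma sum_raise_mul_raise (k b : Fin n) :
    ∑ j, (∑ m, ∑ l, ∑ s, ∑ r, H m l * H s r * T r m j * U s l k) * H j b =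
      ∑ r, ∑ l, raise₂ H T r l b * raise₁ H U r l k := by
  calc _ = ∑ x : Fin n × Fin n × Fin n × Fin n × Fin n, H x.2.1 x.2.2.1 * H x.2.2.2.1 x.2.2.2.2 *
        T x.2.2.2.2 x.2.1 x.1 * U x.2.2.2.1 x.2.2.1 k * H x.1 b := by
        simp only [Fintype.sum_prod_type, Finset.sum_mul]
    _ = ∑ y : Fin n × Fin n × Fin n × Fin n × Fin n, H y.2.2.2.1 y.2.1 * H y.2.2.2.2 b *
        T y.1 y.2.2.2.1 y.2.2.2.2 * (H y.2.2.1 y.1 * U y.2.2.1 y.2.1 k) :=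
        Fintype.sum_equiv ⟨fun x => (x.2.2.2.2, x.2.2.1, x.2.2.2.1, x.2.1, x.1),
          fun y => (y.2.2.2.2, y.2.2.2.1, y.2.1, y.2.2.1, y.1), fun _ => rfl, fun _ => rfl⟩ _ _
          fun x => by simp only [Equiv.coe_fn_mk]; ring
    _ = _ := by simp only [Fintype.sum_prod_type, raise₂, raise₁, Finset.sum_mul, Finset.mul_sum]

lemma sum_raise_normSq :
    ∑ m, ∑ k, ∑ j, ∑ a, ∑ l, ∑ p, H m k * H j a * H l p * T k j l * U m a p =
      ∑ r, ∑ k, ∑ s, raise₂ H T r k s * raise₁ H U r k s := by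
  calc _ = ∑ x : Fin n × Fin n × Fin n × Fin n × Fin n × Fin n, H x.1 x.2.1 *
        H x.2.2.1 x.2.2.2.1 * H x.2.2.2.2.1 x.2.2.2.2.2 * T x.2.1 x.2.2.1 x.2.2.2.2.1 *
        U x.1 x.2.2.2.1 x.2.2.2.2.2 := by
        simp only [Fintype.sum_prod_type]
    _ = ∑ y : Fin n × Fin n × Fin n × Fin n × Fin n × Fin n,
        H y.2.2.2.2.1 y.2.1 * H y.2.2.2.2.2 y.2.2.1 * T y.1 y.2.2.2.2.1 y.2.2.2.2.2 *
        (H y.2.2.2.1 y.1 * U y.2.2.2.1 y.2.1 y.2.2.1) :=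
        Fintype.sum_equiv ⟨fun x => (x.2.1, x.2.2.2.1, x.2.2.2.2.2, x.1, x.2.2.1, x.2.2.2.2.1),
          fun y => (y.2.2.2.1, y.1, y.2.2.2.2.1, y.2.1, y.2.2.2.2.2, y.2.2.1),
          fun _ => rfl, fun _ => rfl⟩ _ _ fun x => by simp only [Equiv.coe_fn_mk]; ring
    _ = _ := by simp only [Fintype.sum_prod_type, raise₂, raise₁, Finset.sum_mul, Finset.mul_sum]

lemma sum_raise_row (k b : Fin n) :
    ∑ j, (∑ q, ∑ p, ∑ s, ∑ r, H q p * H s r * T k q s * U j p r) * H j b =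
      ∑ p, ∑ r, raise₂ H T k p r * raise₁ H U b p r := by
  calc _ = ∑ x : Fin n × Fin n × Fin n × Fin n × Fin n, H x.2.1 x.2.2.1 * H x.2.2.2.1 x.2.2.2.2 *
        T k x.2.1 x.2.2.2.1 * U x.1 x.2.2.1 x.2.2.2.2 * H x.1 b := by
        simp only [Fintype.sum_prod_type, Finset.sum_mul]
    _ = ∑ y : Fin n × Fin n × Fin n × Fin n × Fin n, H y.2.2.2.1 y.1 * H y.2.2.2.2 y.2.1 *
        T k y.2.2.2.1 y.2.2.2.2 * (H y.2.2.1 b * U y.2.2.1 y.1 y.2.1) :=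
        Fintype.sum_equiv ⟨fun x => (x.2.2.1, x.2.2.2.2, x.1, x.2.1, x.2.2.2.1),
          fun y => (y.2.2.1, y.2.2.2.1, y.1, y.2.2.2.2, y.2.1), fun _ => rfl, fun _ => rfl⟩ _ _
          fun x => by simp only [Equiv.coe_fn_mk]; ring
    _ = _ := by simp only [Fintype.sum_prod_type, raise₂, raise₁, Finset.sum_mul, Finset.mul_sum]

lemma sum_raise_trace (τ τ' : Fin n → ℂ) (k b : Fin n) :
    ∑ j, (∑ s, ∑ r, H s r * (T k j s * τ' r + τ s * U j k r)) * H j b =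
      ∑ r, (raise₂ H T k b r * τ' r + (∑ s, H s r * τ s) * raise₁ H U b k r) := by
  have h1 : ∑ j, (∑ s, ∑ r, H s r * (T k j s * τ' r)) * H j b =
      ∑ r, raise₂ H T k b r * τ' r := by
    simp only [raise₂, Finset.sum_mul]
    rw [sum_comm₃]
    refine Finset.sum_congr rfl fun r _ => ?_
    rw [Finset.sum_comm]
    exact Finset.sum_congr rfl fun j _ => Finset.sum_congr rfl fun s _ => by ring
  have h2 : ∑ j, (∑ s, ∑ r, H s r * (τ s * U j k r)) * H j b =
      ∑ r, (∑ s, H s r * τ s) * raise₁ H U b k r := by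
    simp only [raise₁, Finset.sum_mul, Finset.mul_sum]
    rw [sum_comm₃]
    refine Finset.sum_congr rfl fun r _ => ?_
    rw [Finset.sum_comm]
    exact Finset.sum_congr rfl fun j _ => Finset.sum_congr rfl fun s _ => by ring
  simp only [mul_add, Finset.sum_add_distrib, add_mul, h1, h2]

lemma hatTrace_raise₂ (l : Fin n) :
    hatTrace (raise₂ H T) l = ∑ m, H m l * ∑ j, ∑ k, H j k * T k j m := by
  simp only [hatTrace, raise₂, Finset.mul_sum]
  rw [sum_comm₃]
  exact Finset.sum_congr rfl fun m _ => Finset.sum_congr rfl fun j _ =>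
    Finset.sum_congr rfl fun k _ => by ring

lemma sum_raise_traceNormSq (τ τ' : Fin n → ℂ) :
    ∑ j, ∑ k, H j k * τ j * τ' k = ∑ l, (∑ m, H m l * τ m) * τ' l := by
  rw [Finset.sum_comm]
  simp only [Finset.sum_mul]

end Raising

/-! ### Torsion and second Chern–Ricci curvature in raised indices. -/

section Hats

variable {n : ℕ} {U : Set (Cn n)} {z : Cn n} {G : Cn n → Matrix (Fin n) (Fin n) ℂ}

lemma hatTorsion_hatP (q c l : Fin n) :
    hatTorsion (hatP G z) q c l = raise₂ (G z)⁻¹ (torsion G z) q c l := by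
  have h1 : hatP G z c q l = ∑ m, ∑ j, (G z)⁻¹ m c * (G z)⁻¹ j l * wirtMatrix (-1) m G z q j := by
    simp only [hatP, Matrix.mul_apply, Finset.mul_sum]
    exact Finset.sum_congr rfl fun m _ => Finset.sum_congr rfl fun j _ => by ring
  have h2 : hatP G z l q c = ∑ m, ∑ j, (G z)⁻¹ m c * (G z)⁻¹ j l * wirtMatrix (-1) j G z q m := by
    simp only [hatP, Matrix.mul_apply, Finset.mul_sum]
    rw [Finset.sum_comm]
    exact Finset.sum_congr rfl fun m _ => Finset.sum_congr rfl fun j _ => by ring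
  simp only [hatTorsion, h1, h2, raise₂, torsion, mul_sub, Finset.sum_sub_distrib,
    delz_eq_wirt, wirtMatrix, Matrix.of_apply]

lemma hatTorsionBar_hatQ (r k s : Fin n) :
    hatTorsionBar (hatQ G z) r k s = raise₁ (G z)⁻¹ (torsionBar G z) r k s := by
  simp only [hatTorsionBar, hatQ, raise₁, torsionBar, mul_sub, Finset.sum_sub_distrib,
    delzbar_eq_wirt, wirtMatrix, Matrix.of_apply, Matrix.mul_apply]
  congr 1 <;> exact Finset.sum_congr rfl fun m _ => by ring

lemma torsionTraceBar_eq (hU : IsOpen U) (hG : ∀ k l, ContDiffOn ℝ ∞ (fun w => G w k l) U)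
    (hherm : ∀ w k l, starRingEnd ℂ (G w k l) = G w l k) (hz : z ∈ U) (l : Fin n) :
    torsionTraceBar G z l = hatTrace (raise₁ (G z)⁻¹ (torsionBar G z)) l := by
  have h : ∀ k j, starRingEnd ℂ (torsion G z k j l) = torsionBar G z k j l := fun k j => by
    have h1 := wirtMatrix_conj hU hG hherm hz 1 (by simp) j k l
    have h2 := wirtMatrix_conj hU hG hherm hz 1 (by simp) l k j
    simp only [wirtMatrix, Matrix.of_apply] at h1 h2
    rw [torsion, torsionBar, map_sub, delz_eq_wirt, delz_eq_wirt, h1, h2, delzbar_eq_wirt,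
      delzbar_eq_wirt]
  simp only [torsionTraceBar, torsionTrace, map_sum, map_mul, inv_conj hherm, h, hatTrace, raise₁]

lemma hatTrace_hatTorsion (l : Fin n) :
    hatTrace (hatTorsion (hatP G z)) l = ∑ m, (G z)⁻¹ m l * torsionTrace G z m := by
  have h : hatTorsion (hatP G z) = raise₂ (G z)⁻¹ (torsion G z) := by
    ext q c l
    exact hatTorsion_hatP q c l
  rw [h, hatTrace_raise₂]
  rfl

/-- Expand -∂_{q̄}(g⁻¹ ∂_p g) by the product rule with ∂(g⁻¹) = -g⁻¹ (∂g) g⁻¹; lowering the index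
removes the leading g⁻¹. -/
lemma ricciTilde_eq (hU : IsOpen U) (hG : ∀ k l, ContDiffOn ℝ ∞ (fun w => G w k l) U)
    (hg : ∀ w ∈ U, (G w).det ≠ 0) (hz : z ∈ U) (k j : Fin n) :
    ricciTilde G z k j = ∑ p, ∑ q, (G z)⁻¹ p q *
      ((wirtMatrix 1 q G z * (G z)⁻¹ * wirtMatrix (-1) p G z) k j -
        wirtMatrix (-1) p (wirtMatrix 1 q G) z k j) := by
  have dH := fun k l => differentiableAt_of_contDiffOn hU (contDiffOn_inv hG hg k l) hz
  have dP := fun j k l => differentiableAt_of_contDiffOn hU (contDiffOn_wirtMatrix hU hG (-1) j k l) hz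
  refine Finset.sum_congr rfl fun p _ => Finset.sum_congr rfl fun q _ => congrArg _ ?_
  have hR : ∀ r, chernCurvature G z q p r j =
      ((G z)⁻¹ * (wirtMatrix 1 q G z * (G z)⁻¹ * wirtMatrix (-1) p G z -
        wirtMatrix (-1) p (wirtMatrix 1 q G) z)) r j := fun r => by
    have hcomm : ∀ l, wirt 1 q (fun w => wirtMatrix (-1) p G w l j) z =
        wirtMatrix (-1) p (wirtMatrix 1 q G) z l j := fun l =>
      wirt_comm_of_contDiffOn hU (hG l j) hz 1 (-1) q p
    have h1 : chernCurvature G z q p r j =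
        -wirt 1 q (fun w => ∑ l, (G w)⁻¹ r l * wirtMatrix (-1) p G w l j) z := by
      simp only [chernCurvature, delzbar_eq_wirt, delz_eq_wirt, wirtMatrix, Matrix.of_apply]
    rw [h1, wirt_sum _ _ _ fun l _ => (dH r l).fun_mul (dP p l j)]
    simp only [wirt_mul _ _ (dH r _) (dP p _ j), hcomm, wirt_inv hU hG hg hz]
    rw [mul_sub, Matrix.sub_apply, ← mul_assoc, ← mul_assoc, Matrix.mul_apply, Matrix.mul_apply,
      ← Finset.sum_sub_distrib, ← Finset.sum_neg_distrib]
    exact Finset.sum_congr rfl fun l _ => by ring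
  simp only [chernCurvatureLower, hR]
  rw [← Matrix.mul_apply, Matrix.mul_nonsing_inv_cancel_left _ _ (hg z hz).isUnit,
    Matrix.sub_apply]

lemma sum_ricciTilde_mul (hU : IsOpen U) (hG : ∀ k l, ContDiffOn ℝ ∞ (fun w => G w k l) U)
    (hg : ∀ w ∈ U, (G w).det ≠ 0) (hz : z ∈ U) (k b : Fin n) :
    ∑ j, ricciTilde G z k j * (G z)⁻¹ j b =
      ∑ q, ∑ r, hatQ G z q k r * hatP G z q r b - ∑ q, hatK G z q q k b := by
  simp only [ricciTilde_eq hU hG hg hz, mul_sub, Finset.sum_sub_distrib, sub_mul]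
  congr 1
  · simp only [Finset.sum_mul]
    rw [sum_comm₃]
    refine Finset.sum_congr rfl fun q _ => ?_
    simp only [hatP, Finset.mul_sum]
    rw [Finset.sum_comm]
    conv_rhs => rw [Finset.sum_comm]
    rw [Finset.sum_comm]
    refine Finset.sum_congr rfl fun p _ => ?_
    simp only [mul_assoc, mul_left_comm _ ((G z)⁻¹ p q), ← Finset.mul_sum, hatQ]
    rw [← Matrix.mul_apply, ← Matrix.mul_apply]
    simp only [Matrix.mul_assoc]
  · simp only [Finset.sum_mul]
    rw [sum_comm₃]
    simp only [hatK, Matrix.mul_apply, Finset.mul_sum]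
    exact Finset.sum_congr rfl fun q _ => Finset.sum_congr rfl fun p _ =>
      Finset.sum_congr rfl fun j _ => by ring

end Hats

/-! ### Solving the flow equation for the derivative of the metric -/

section Solve

variable {n : ℕ} {U : Set (Cn n)} {z : Cn n} {G : Cn n → Matrix (Fin n) (Fin n) ℂ}

/-- The hypotheses combine to (n-1) c ((1/2) tr B δ - B) = S. Its trace, (n-1) c ((n-2)/2) tr B = tr
S, determines tr B and then B. -/
lemma eq_of_flow_components (hn : 3 ≤ n) {B S : Matrix (Fin n) (Fin n) ℂ} {c c' : ℂ} (hc : c ≠ 0)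
    (hc' : c' = -(1 / 2) * c * B.trace)
    (h : ∀ a b, ((n : ℂ) - 1) * c' * delta₁ a b +
      ((n : ℂ) - 1) * c * ∑ q, ∑ p, B q p * delta₂ a b p q = S a b) (a b : Fin n) :
    B a b = 1 / (((n : ℂ) - 1) * c) * (-S a b + 1 / ((n : ℂ) - 2) * S.trace * delta₁ a b) := by
  have hn1 : (n : ℂ) - 1 ≠ 0 := by
    rw [sub_ne_zero]
    exact_mod_cast (by omega : n ≠ 1)
  have hn2 : (n : ℂ) - 2 ≠ 0 := by
    rw [sub_ne_zero]
    exact_mod_cast (by omega : n ≠ 2)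
  simp only [sum_mul_delta₂] at h
  have htr : ((n : ℂ) - 1) * c * ((n - 2) / 2 * B.trace) = S.trace := by
    have h1 : S.trace = ∑ a, (((n : ℂ) - 1) * c' * delta₁ a a +
        ((n : ℂ) - 1) * c * (B.trace * delta₁ a a - B a a)) :=
      Finset.sum_congr rfl fun a _ => (h a a).symm
    simp only [Finset.sum_add_distrib, ← Finset.mul_sum, Finset.sum_sub_distrib,
      sum_delta₁_self] at h1
    have h2 : ∑ a, B a a = B.trace := rfl
    rw [h1, h2, hc']
    ring
  rw [← h a b, ← htr, hc']
  field_simp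
  ring

/-- The terms with second derivatives, using the differentiated balanced condition. -/
lemma hat_second_order (hn : 3 ≤ n) {P Q : Fin n → Fin n → Fin n → ℂ}
    {K : Fin n → Fin n → Fin n → Fin n → ℂ}
    (h1 : ∀ k b, 2 * ∑ q, K q k q b - ∑ q, K b k q q =
      ∑ r, ∑ q, Q k r q * (2 * P r q b - P b q r))
    (h2 : ∀ k b, 2 * ∑ j, K b j k j - ∑ j, K b k j j =
      ∑ r, ∑ j, P b r j * (2 * Q j k r - Q k j r)) (a b : Fin n) :
    -(∑ c, ∑ k, ∑ q, ∑ p, K c k q p * delta₃ a b c k p q) + 1 / ((n : ℂ) - 2) *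
      (∑ e, ∑ c, ∑ k, ∑ q, ∑ p, K c k q p * delta₃ e e c k p q) * delta₁ a b =
    -(∑ q, ∑ r, Q q a r * P q r b - ∑ q, K q q a b) +
      ∑ r, ∑ p, hatTorsion P r p b * hatTorsionBar Q r p a := by
  have hn2 : (n : ℂ) - 2 ≠ 0 := by
    rw [sub_ne_zero]
    exact_mod_cast (by omega : n ≠ 2)
  have e1 : ∀ a b, ∑ r, ∑ q, Q a r q * P b q r = ∑ r, ∑ q, P b r q * Q a q r := fun a b => by
    rw [Finset.sum_comm]
    exact Finset.sum_congr rfl fun q _ => Finset.sum_congr rfl fun r _ => mul_comm _ _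
  have e2 : ∀ a b, ∑ r, ∑ q, Q a r q * P r q b = ∑ r, ∑ q, P q r b * Q a q r := fun a b => by
    rw [Finset.sum_comm]
    exact Finset.sum_congr rfl fun q _ => Finset.sum_congr rfl fun r _ => mul_comm _ _
  have e3 : ∑ q, ∑ r, Q q a r * P q r b = ∑ r, ∑ q, P q r b * Q q a r := by
    rw [Finset.sum_comm]
    exact Finset.sum_congr rfl fun q _ => Finset.sum_congr rfl fun r _ => mul_comm _ _
  simp only [mul_sub, Finset.sum_sub_distrib, mul_left_comm _ (2 : ℂ), ← Finset.mul_sum, e1,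
    e2] at h1 h2
  have t1 : ∑ b, (2 * ∑ q, K q b q b - ∑ q, K b b q q) = ∑ b, (2 * ∑ r, ∑ q, P q r b * Q b q r -
      ∑ r, ∑ q, P b r q * Q b q r) := Finset.sum_congr rfl fun b _ => h1 b b
  have t2 : ∑ b, ∑ r, ∑ q, P q r b * Q b q r = ∑ b, ∑ r, ∑ q, P b r q * Q q b r :=
    sum_comm₃ _
  have t3 : ∑ e, ∑ q, K e e q q = ∑ e, ∑ c, K c c e e := Finset.sum_comm
  have t4 : ∑ b, ∑ q, K q b q b = ∑ c, ∑ k, K c k c k := Finset.sum_comm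
  have t5 : ∑ b, ∑ c, K c b c b = ∑ b, ∑ k, K b k b k := Finset.sum_comm
  -- The trace is n - 2 times the scalar coefficient of δ_ab, so the correction 1/(n-2) removes that
  -- term entirely.
  have hs : ∑ e, ∑ c, ∑ k, ∑ q, ∑ p, K c k q p * delta₃ e e c k p q =
      (n - 2) * (∑ c, ∑ q, K c c q q - ∑ c, ∑ k, K c k c k) := by
    simp only [sum_mul_delta₃, Finset.sum_add_distrib, Finset.sum_sub_distrib, ← Finset.mul_sum,
      sum_delta₁_self, t5, ← t3]
    ring
  rw [hs, sum_mul_delta₃, e3]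
  simp only [hatTorsion, hatTorsionBar, mul_sub, sub_mul, Finset.sum_sub_distrib]
  field_simp
  -- Each balanced identity contains K_{b a q q} once and one of the other two traces twice, so half
  -- their sum is exactly the unwanted combination.
  linear_combination -(1 / 2) * h1 a b - 1 / 2 * h2 a b

lemma logDerivCoeff_conj (hU : IsOpen U) (hG : ∀ k l, ContDiffOn ℝ ∞ (fun w => G w k l) U)
    (hherm : ∀ w k l, starRingEnd ℂ (G w k l) = G w l k) (hz : z ∈ U) (m k : Fin n) :
    starRingEnd ℂ (∑ j, ∑ q, ((G z)⁻¹ j q * (2 * wirtMatrix (-1) j (wirtMatrix 1 m G) z q k -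
        wirtMatrix (-1) k (wirtMatrix 1 m G) z q j) -
        ((G z)⁻¹ * wirtMatrix 1 m G z * (G z)⁻¹) j q *
          (2 * wirtMatrix (-1) j G z q k - wirtMatrix (-1) k G z q j))) =
      ∑ j, ∑ q, ((G z)⁻¹ q j * (2 * wirtMatrix (-1) m (wirtMatrix 1 j G) z k q -
        wirtMatrix (-1) m (wirtMatrix 1 k G) z j q) -
        ((G z)⁻¹ * wirtMatrix (-1) m G z * (G z)⁻¹) q j *
          (2 * wirtMatrix 1 j G z k q - wirtMatrix 1 k G z j q)) := by
  have h1 : ∀ j k l, starRingEnd ℂ (wirtMatrix (-1) j G z k l) = wirtMatrix 1 j G z l k :=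
    wirtMatrix_conj hU hG hherm hz 1 (by simp)
  have h2 : ∀ j k l, starRingEnd ℂ (wirtMatrix 1 j G z k l) = wirtMatrix (-1) j G z l k := by
    intro j k l
    rw [← h1, Complex.conj_conj]
  have h3 : ∀ j q, starRingEnd ℂ (((G z)⁻¹ * wirtMatrix 1 m G z * (G z)⁻¹) j q) =
      ((G z)⁻¹ * wirtMatrix (-1) m G z * (G z)⁻¹) q j := fun j q => by
    rw [Matrix.mul_assoc]
    simp only [Matrix.mul_apply, map_sum, map_mul, inv_conj hherm, h2, Finset.mul_sum,
      Finset.sum_mul]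
    exact Finset.sum_congr rfl fun _ _ => Finset.sum_congr rfl fun _ _ => by ring
  simp only [map_sum, map_sub, map_mul, inv_conj hherm, h1, h3, map_ofNat,
    wirtMatrix_wirtMatrix_conj hU hG hherm hz]

/-- The bracket in the evolution equation for `n = 3`. -/
def evolutionBracket₃ (G : Cn n → Matrix (Fin n) (Fin n) ℂ) (z : Cn n) :
    Matrix (Fin n) (Fin n) ℂ := .of fun k j =>
  -ricciTilde G z k j + ∑ m, ∑ l, ∑ s, ∑ r, (G z)⁻¹ m l * (G z)⁻¹ s r * torsion G z r m j *
    torsionBar G z s l k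

/-- The bracket in the evolution equation for `n ≥ 4`. -/
def evolutionBracket (G : Cn n → Matrix (Fin n) (Fin n) ℂ) (z : Cn n) :
    Matrix (Fin n) (Fin n) ℂ := .of fun k j =>
  -ricciTilde G z k j
    + 1 / (2 * ((n : ℂ) - 2)) * (torsionNormSq G z - 2 * torsionTraceNormSq G z) * G z k j
    - 1 / 2 * ∑ q, ∑ p, ∑ s, ∑ r, (G z)⁻¹ q p * (G z)⁻¹ s r * torsion G z k q s *
        torsionBar G z j p r
    + ∑ s, ∑ r, (G z)⁻¹ s r * (torsion G z k j s * torsionTraceBar G z r +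
        torsionTrace G z s * torsionBar G z j k r)
    + torsionTrace G z j * torsionTraceBar G z k

lemma hatTorsion_hatP_eq : hatTorsion (hatP G z) = raise₂ (G z)⁻¹ (torsion G z) := by
  ext q c l
  exact hatTorsion_hatP q c l

lemma hatTorsionBar_hatQ_eq :
    hatTorsionBar (hatQ G z) = raise₁ (G z)⁻¹ (torsionBar G z) := by
  ext q c l
  exact hatTorsionBar_hatQ q c l

lemma evolutionBracket₃_mul (hU : IsOpen U) (hG : ∀ k l, ContDiffOn ℝ ∞ (fun w => G w k l) U)
    (hg : ∀ w ∈ U, (G w).det ≠ 0) (hz : z ∈ U) (a b : Fin n) :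
    (evolutionBracket₃ G z * (G z)⁻¹) a b =
      -(∑ q, ∑ r, hatQ G z q a r * hatP G z q r b - ∑ q, hatK G z q q a b) +
      ∑ r, ∑ p, hatTorsion (hatP G z) r p b * hatTorsionBar (hatQ G z) r p a := by
  rw [hatTorsion_hatP_eq, hatTorsionBar_hatQ_eq, ← sum_raise_mul_raise,
    ← sum_ricciTilde_mul hU hG hg hz]
  simp only [Matrix.mul_apply, evolutionBracket₃, Matrix.of_apply, add_mul, neg_mul,
    Finset.sum_add_distrib, Finset.sum_neg_distrib]

lemma evolutionBracket_mul (hU : IsOpen U) (hG : ∀ k l, ContDiffOn ℝ ∞ (fun w => G w k l) U)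
    (hherm : ∀ w k l, starRingEnd ℂ (G w k l) = G w l k)
    (hg : ∀ w ∈ U, (G w).det ≠ 0) (hz : z ∈ U) (a b : Fin n) :
    (evolutionBracket G z * (G z)⁻¹) a b =
      -(∑ q, ∑ r, hatQ G z q a r * hatP G z q r b - ∑ q, hatK G z q q a b) +
      1 / (2 * ((n : ℂ) - 2)) * ((∑ r, ∑ k, ∑ s, hatTorsion (hatP G z) r k s *
        hatTorsionBar (hatQ G z) r k s) - 2 * ∑ l, hatTrace (hatTorsion (hatP G z)) l *
        hatTrace (hatTorsionBar (hatQ G z)) l) * delta₁ a b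
      - 1 / 2 * ∑ p, ∑ r, hatTorsion (hatP G z) a p r * hatTorsionBar (hatQ G z) b p r
      + ∑ s, (hatTorsion (hatP G z) a b s * hatTrace (hatTorsionBar (hatQ G z)) s +
          hatTrace (hatTorsion (hatP G z)) s * hatTorsionBar (hatQ G z) b a s)
      + hatTrace (hatTorsion (hatP G z)) b * hatTrace (hatTorsionBar (hatQ G z)) a := by
  have hδ : ∑ j, G z a j * (G z)⁻¹ j b = delta₁ a b := by
    rw [← Matrix.mul_apply, Matrix.mul_nonsing_inv _ (hg z hz).isUnit, Matrix.one_apply, delta₁]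
  have hτ : ∀ l, hatTrace (hatTorsionBar (hatQ G z)) l = torsionTraceBar G z l := fun l => by
    rw [hatTorsionBar_hatQ_eq, torsionTraceBar_eq hU hG hherm hz]
  have hM : torsionTraceNormSq G z = ∑ l, (∑ m, (G z)⁻¹ m l * torsionTrace G z m) *
      torsionTraceBar G z l := sum_raise_traceNormSq _ _ _
  have hb : hatTrace (hatTorsion (hatP G z)) b * torsionTraceBar G z a =
      ∑ j, torsionTrace G z j * torsionTraceBar G z a * (G z)⁻¹ j b := by
    rw [hatTrace_hatTorsion, Finset.sum_mul]
    exact Finset.sum_congr rfl fun _ _ => by ring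
  simp only [hτ]
  rw [hb]
  simp only [hatTrace_hatTorsion]
  rw [hatTorsion_hatP_eq, hatTorsionBar_hatQ_eq, ← sum_raise_row, ← sum_raise_normSq,
    ← sum_ricciTilde_mul hU hG hg hz, ← sum_raise_trace, ← hM, ← hδ, Finset.mul_sum,
    Finset.mul_sum]
  simp only [Matrix.mul_apply, evolutionBracket, Matrix.of_apply, add_mul, sub_mul, neg_mul,
    Finset.sum_add_distrib, Finset.sum_neg_distrib, Finset.sum_sub_distrib, mul_assoc,
    torsionNormSq]

theorem eq_evolutionBracket (hn : 3 ≤ n) (hU : IsOpen U)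
    (hG : ∀ k l, ContDiffOn ℝ ∞ (fun w => G w k l) U)
    (hherm : ∀ w k l, starRingEnd ℂ (G w k l) = G w l k)
    (hg : ∀ w ∈ U, (G w).det ≠ 0) (hz : z ∈ U)
    (hlog : ∀ k m, wirt 1 k (fun w => logDerivCoeff G w m) z = 0)
    {M' : Matrix (Fin n) (Fin n) ℂ} {c c' : ℂ} (hc : c ≠ 0)
    (hc' : c' = -(1 / 2) * c * (M' * (G z)⁻¹).trace)
    (h : ∀ a b, ((n : ℂ) - 1) * c' * delta₁ a b +
      ((n : ℂ) - 1) * c * ∑ q, ∑ p, (M' * (G z)⁻¹) q p * delta₂ a b p q = flowTensor G z a b) :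
    M' = (1 / (((n : ℂ) - 1) * c)) •
      (if 4 ≤ n then evolutionBracket G z else evolutionBracket₃ G z) := by
  have hX := fun m k => (wirt_logDerivCoeff hU hG hg hz k m).symm.trans (hlog k m)
  have hX' := fun m k => (logDerivCoeff_conj hU hG hherm hz m k).symm.trans
    ((congrArg _ (hX k m)).trans (map_zero _))
  have hB := eq_of_flow_components hn (S := .of (flowTensor G z)) hc hc' h
  have h2 := hat_second_order hn (hat_balanced hX) (hat_balanced_conj hX')
  -- Compare after multiplication by g⁻¹, where everything is expressed through the raised arrays.
  have key : M' * (G z)⁻¹ = ((1 / (((n : ℂ) - 1) * c)) •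
      (if 4 ≤ n then evolutionBracket G z else evolutionBracket₃ G z)) * (G z)⁻¹ := by
    ext a b
    rw [hB, Matrix.smul_mul, Matrix.smul_apply, smul_eq_mul]
    congr 1
    simp only [Matrix.trace, Matrix.diag_apply, Matrix.of_apply, flowTensor_eq,
      Finset.sum_add_distrib]
    split_ifs with h4
    · have hn2 : (n : ℂ) - 2 ≠ 0 := by
        rw [sub_ne_zero]
        exact_mod_cast (by omega : n ≠ 2)
      rw [evolutionBracket_mul hU hG hherm hg hz, trace_sum_mul_mul_delta₄,
        sum_mul_mul_delta₄, mul_add, add_mul, neg_add]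
      have h2' := h2 a b
      set x := 1 / ((n : ℂ) - 2) with hx
      -- The δ₄-scalar has trace factor n - 3, so its coefficient becomes -1 + (n-3)/(n-2) =
      -- -1/(n-2), the source of 1/(2(n-2)) in the bracket.
      have hx1 : ((n : ℂ) - 3) * x = 1 - x := by rw [hx]; field_simp; ring
      have hx2 : 1 / (2 * ((n : ℂ) - 2)) = x / 2 := by rw [hx]; field_simp
      rw [hx2]
      linear_combination h2' + hx1 * (-1 / 2 * (∑ r, ∑ k, ∑ s, hatTorsion (hatP G z) r k s *
        hatTorsionBar (hatQ G z) r k s) + ∑ l, hatTrace (hatTorsion (hatP G z)) l *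
        hatTrace (hatTorsionBar (hatQ G z)) l) * delta₁ a b
    · rw [evolutionBracket₃_mul hU hG hg hz, ← h2 a b]
      simp
  have := congrArg (· * G z) key
  simpa only [Matrix.nonsing_inv_mul_cancel_right _ _ (hg z hz).isUnit] using this

end Solve

/-! ### The evolution of the metric -/

section Evolution

variable {n : ℕ} {X : Type*} [TopologicalSpace X] [ChartedSpace (Cn n) X]
  {φ : OpenPartialHomeomorph X (Cn n)}
  {Ω : HoloVolumeForm n X} {g : ℝ → HermitianMetric n X} {T : ℝ}

lemma sqrt_normSq_div_contDiffOn {E : Type*} [NormedAddCommGroup E] [NormedSpace ℝ E] {S : Set E}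
    {m : WithTop ℕ∞} {f d : E → ℂ} (hf : ContDiffOn ℝ m f S) (hd : ContDiffOn ℝ m d S)
    (hf0 : ∀ x ∈ S, f x ≠ 0) (hd0 : ∀ x ∈ S, 0 < (d x).re) :
    ContDiffOn ℝ m (fun x => ((Real.sqrt (Complex.normSq (f x) / (d x).re) : ℝ) : ℂ)) S := by
  have hre : ContDiffOn ℝ m (fun x => (f x).re) S := Complex.reCLM.contDiff.comp_contDiffOn hf
  have him : ContDiffOn ℝ m (fun x => (f x).im) S := Complex.imCLM.contDiff.comp_contDiffOn hf
  have hdr : ContDiffOn ℝ m (fun x => (d x).re) S := Complex.reCLM.contDiff.comp_contDiffOn hd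
  have h : ContDiffOn ℝ m (fun x => Complex.normSq (f x) / (d x).re) S := by
    simp only [Complex.normSq_apply]
    exact ((hre.mul hre).add (him.mul him)).div hdr fun x hx => (hd0 x hx).ne'
  exact Complex.ofRealCLM.contDiff.comp_contDiffOn
    (h.sqrt fun x hx => (div_pos (Complex.normSq_pos.mpr (hf0 x hx)) (hd0 x hx)).ne')

/-- First-order differentiability follows from complex differentiability of f alone. It must precede
smoothness of f, whose proof uses it. -/
lemma differentiableAt_volNorm (hφ : φ ∈ holoAtlas n X) {z : Cn n} (hz : z ∈ φ.target)
    (Ω : HoloVolumeForm n X) (g : HermitianMetric n X) :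
    DifferentiableAt ℝ (fun w => (volNorm Ω g φ w : ℂ)) z := by
  have hf : DifferentiableAt ℝ (Ω.coeff φ) z :=
    ((Ω.holomorphic φ hφ).differentiableAt (φ.open_target.mem_nhds hz)).restrictScalars ℝ
  have hd := differentiableAt_of_contDiffOn φ.open_target
    (contDiffOn_det (G := g.comp φ) (g.smooth φ hφ)) hz
  have hre : DifferentiableAt ℝ (fun x => (Ω.coeff φ x).re) z :=
    Complex.reCLM.differentiableAt.comp z hf
  have him : DifferentiableAt ℝ (fun x => (Ω.coeff φ x).im) z :=
    Complex.imCLM.differentiableAt.comp z hf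
  have hdr : DifferentiableAt ℝ (fun x => (g.comp φ x).det.re) z :=
    Complex.reCLM.differentiableAt.comp z hd
  have h : DifferentiableAt ℝ
      (fun x => Complex.normSq (Ω.coeff φ x) / (g.comp φ x).det.re) z := by
    simp only [Complex.normSq_apply, div_eq_mul_inv]
    exact ((hre.fun_mul hre).fun_add (him.fun_mul him)).fun_mul
      (hdr.fun_inv (det_comp_pos hφ hz g).1.ne')
  have h2 := Complex.ofRealCLM.differentiableAt.comp z (h.sqrt
    (div_pos (Complex.normSq_pos.mpr (coeff_ne_zero hφ hz Ω)) (det_comp_pos hφ hz g).1).ne')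
  refine h2.congr_of_eventuallyEq ?_
  filter_upwards [φ.open_target.mem_nhds hz] with w hw
  simp [volNorm_eq hφ hw]

lemma wirt_coeff_of_balanced (hn : 3 ≤ n) (hφ : φ ∈ holoAtlas n X) {g : HermitianMetric n X}
    (hbal : ∀ z ∈ φ.target, extD (balancedForm Ω g φ) z = 0) {z : Cn n} (hz : z ∈ φ.target)
    (m : Fin n) :
    wirt (-1) m (Ω.coeff φ) z = Ω.coeff φ z * logDerivCoeff (g.comp φ) z m :=
  wirt_coeff (by omega) φ.open_target (g.smooth φ hφ) hz (det_comp_ne_zero hφ hz g)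
    (differentiableAt_volNorm hφ hz Ω g) (hbal z hz)
    ((Ω.holomorphic φ hφ).differentiableAt (φ.open_target.mem_nhds hz)) (coeff_ne_zero hφ hz Ω)
    (fun _ hw => volNorm_sq_mul_det hφ hw Ω g) m

lemma contDiffOn_coeff (hn : 3 ≤ n) (hφ : φ ∈ holoAtlas n X) {g : HermitianMetric n X}
    (hbal : IsConformallyBalanced Ω g) : ContDiffOn ℝ ∞ (Ω.coeff φ) φ.target :=
  contDiffOn_of_wirt_eq φ.open_target (Ω.holomorphic φ hφ)
    (fun m => contDiffOn_logDerivCoeff φ.open_target (g.smooth φ hφ)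
      (fun _ hw => det_comp_ne_zero hφ hw g) m)
    fun _ hw m => wirt_coeff_of_balanced hn hφ (hbal φ hφ) hw m

lemma contDiffOn_volNorm (hφ : φ ∈ holoAtlas n X) (hflow : IsAnomalyFlow Ω g T)
    (hf : ContDiffOn ℝ ∞ (Ω.coeff φ) φ.target) :
    ContDiffOn ℝ ∞ (fun p : ℝ × Cn n => (volNorm Ω (g p.1) φ p.2 : ℂ))
      (Set.Ico 0 T ×ˢ φ.target) := by
  refine (sqrt_normSq_div_contDiffOn (f := fun p : ℝ × Cn n => Ω.coeff φ p.2)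
    (d := fun p : ℝ × Cn n => ((g p.1).comp φ p.2).det)
    (hf.comp contDiffOn_snd fun p hp => hp.2)
    (contDiffOn_det (G := fun p : ℝ × Cn n => (g p.1).comp φ p.2) (hflow.smooth φ hφ))
    (fun p hp => coeff_ne_zero hφ hp.2 Ω)
    fun p hp => (det_comp_pos hφ hp.2 (g p.1)).1).congr fun p hp => ?_
  rw [volNorm_eq hφ hp.2]

lemma contDiffOn_balancedForm (hφ : φ ∈ holoAtlas n X) (hflow : IsAnomalyFlow Ω g T)
    (hf : ContDiffOn ℝ ∞ (Ω.coeff φ) φ.target) :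
    ContDiffOn ℝ ∞ (fun p : ℝ × Cn n => balancedForm Ω (g p.1) φ p.2)
      (Set.Ico 0 T ×ˢ φ.target) :=
  (contDiffOn_volNorm hφ hflow hf).fun_smul
    ((contDiffOn_twoForm (G := fun p : ℝ × Cn n => (g p.1).comp φ p.2)
      (hflow.smooth φ hφ)).pow (n - 1))

/-- The flow preserves the conformally balanced condition. -/
lemma extD_balancedForm_eq_zero (hn : 3 ≤ n) (hφ : φ ∈ holoAtlas n X)
    (hflow : IsAnomalyFlow Ω g T) (hbal : IsConformallyBalanced Ω (g 0)) {t : ℝ}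
    (ht : t ∈ Set.Ico 0 T) {z : Cn n} (hz : z ∈ φ.target) :
    extD (balancedForm Ω (g t) φ) z = 0 :=
  extD_eq_zero_of_flow φ.open_target (F := fun s => balancedForm Ω (g s) φ)
    (α := fun s w => (g s).kahlerForm φ w ^ (n - 2))
    (contDiffOn_balancedForm hφ hflow (contDiffOn_coeff hn hφ hbal))
    (fun s _ => (contDiffOn_twoForm (G := (g s).comp φ) ((g s).smooth φ hφ)).pow (n - 2))
    (fun s hs w hw => (hflow.flow φ hφ s hs w hw).hasDerivWithinAt) (hbal φ hφ) ht hz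

lemma hasDerivWithinAt_of_contDiffOn_prod {E : Type*} [NormedAddCommGroup E] [NormedSpace ℝ E]
    {U : Set (Cn n)} {F : ℝ → Cn n → E}
    (hF : ContDiffOn ℝ ∞ (fun p : ℝ × Cn n => F p.1 p.2) (Set.Ico 0 T ×ˢ U)) {t : ℝ}
    (ht : t ∈ Set.Ico 0 T) {z : Cn n} (hz : z ∈ U) :
    HasDerivWithinAt (fun s => F s z) (derivWithin (fun s => F s z) (Set.Ico 0 T) t)
      (Set.Ico 0 T) t := by
  have h : ContDiffOn ℝ ∞ (fun s => F s z) (Set.Ico 0 T) :=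
    hF.comp (contDiffOn_id.prodMk contDiffOn_const) fun s hs => ⟨hs, hz⟩
  exact ((h.differentiableOn (by simp)) t ht).hasDerivWithinAt

/-- Smoothness of the data provides some time derivative of g; the flow equation in components then
identifies it. -/
theorem hasDerivWithinAt_comp (hn : 3 ≤ n) (hφ : φ ∈ holoAtlas n X)
    (hflow : IsAnomalyFlow Ω g T) (hbal : IsConformallyBalanced Ω (g 0)) {t : ℝ}
    (ht : t ∈ Set.Ico 0 T) {z : Cn n} (hz : z ∈ φ.target) (k j : Fin n) :
    HasDerivWithinAt (fun s => (g s).comp φ z k j)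
      (1 / (((n : ℂ) - 1) * (volNorm Ω (g t) φ z : ℂ)) *
        (if 4 ≤ n then evolutionBracket ((g t).comp φ) z
          else evolutionBracket₃ ((g t).comp φ) z) k j) (Set.Ico 0 T) t := by
  have hU := φ.open_target
  have hG := (g t).smooth φ hφ
  have hg : ∀ w ∈ φ.target, ((g t).comp φ w).det ≠ 0 := fun w hw => det_comp_ne_zero hφ hw (g t)
  have hf := contDiffOn_coeff (φ := φ) hn hφ hbal
  have hu : UniqueDiffWithinAt ℝ (Set.Ico 0 T) t := uniqueDiffOn_Ico 0 T t ht
  have hM := fun k l => hasDerivWithinAt_of_contDiffOn_prod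
    (F := fun s w => (g s).comp φ w k l) (hflow.smooth φ hφ k l) ht hz
  have hC := hasDerivWithinAt_of_contDiffOn_prod (F := fun s w => (volNorm Ω (g s) φ w : ℂ))
    (contDiffOn_volNorm hφ hflow hf) ht hz
  have hC0 : (volNorm Ω (g t) φ z : ℂ) ≠ 0 := by exact_mod_cast (volNorm_pos hφ hz Ω (g t)).ne'
  set M' : Matrix (Fin n) (Fin n) ℂ := .of fun k l =>
    derivWithin (fun s => (g s).comp φ z k l) (Set.Ico 0 T) t with hM'
  set c' := derivWithin (fun s => (volNorm Ω (g s) φ z : ℂ)) (Set.Ico 0 T) t with hc'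
  have hdet := hasDerivWithinAt_det (by omega) (M := fun s => (g s).comp φ z) (M' := M') hM (hg z hz)
  have hC' : c' = -(1 / 2) * (volNorm Ω (g t) φ z : ℂ) * (M' * ((g t).comp φ z)⁻¹).trace := by
    -- Differentiate ‖Ω‖² det g, which is constant in time.
    have h1 := (hC.fun_pow 2).fun_mul hdet
    simp only [volNorm_sq_mul_det hφ hz] at h1
    have h2 := hu.eq_deriv _ h1 (hasDerivWithinAt_const t _ _)
    have h3 : (2 * c' + (volNorm Ω (g t) φ z : ℂ) * (M' * ((g t).comp φ z)⁻¹).trace) *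
        ((volNorm Ω (g t) φ z : ℂ) * ((g t).comp φ z).det) = 0 := by
      rw [← h2]
      push_cast
      ring
    have h4 := (mul_eq_zero.mp h3).resolve_right (mul_ne_zero hC0 (hg z hz))
    linear_combination h4 / 2
  have hcomp := flow_components hn hU hG hz (hg z hz) (M := fun s => (g s).comp φ z) (M' := M')
    hu hM hC rfl (hflow.flow φ hφ t ht z hz)
  -- The formula for ∂_m log f is needed throughout the chart at time t, not only at z, because it
  -- is differentiated once more; preservation of the balanced condition provides it.
  have hlog : ∀ k m, wirt 1 k (fun w => logDerivCoeff ((g t).comp φ) w m) z = 0 := fun k m =>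
    wirt_eq_zero_of_logDeriv hU (Ω.holomorphic φ hφ) hf (contDiffOn_logDerivCoeff hU hG hg m)
      (fun w hw => wirt_coeff_of_balanced hn hφ
        (fun _ hw' => extD_balancedForm_eq_zero hn hφ hflow hbal ht hw') hw m) hz
      (coeff_ne_zero hφ hz Ω) k
  have key := eq_evolutionBracket hn hU hG (fun w k l => comp_conj (g t) φ w k l) hg hz hlog hC0 hC'
    hcomp
  refine (hM k j).congr_deriv ?_
  have := congrFun (congrFun key k) j
  rwa [Matrix.smul_apply, smul_eq_mul] at this

end Evolution

end AnomalyFlow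

end

theorem theorem4 {n : ℕ} (hn : 3 ≤ n) {X : Type*} [TopologicalSpace X] [CompactSpace X]
    [T2Space X] [ChartedSpace (AnomalyFlow.Cn n) X]
    [IsManifold 𝓘(ℂ, AnomalyFlow.Cn n) ω X]
    (Ω : AnomalyFlow.HoloVolumeForm n X) (T : ℝ) (g : ℝ → AnomalyFlow.HermitianMetric n X)
    (hflow : AnomalyFlow.IsAnomalyFlow Ω g T)
    (hbal : AnomalyFlow.IsConformallyBalanced Ω (g 0)) :
    (n = 3 → ∀ φ ∈ AnomalyFlow.holoAtlas n X, ∀ t ∈ Set.Ico 0 T, ∀ z ∈ φ.target,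
      ∀ k j : Fin n,
      HasDerivWithinAt (fun s => (g s).comp φ z k j)
        (1 / (2 * (AnomalyFlow.volNorm Ω (g t) φ z : ℂ)) *
          (-AnomalyFlow.ricciTilde ((g t).comp φ) z k j
            + ∑ m, ∑ l, ∑ s, ∑ r,
                ((g t).comp φ z)⁻¹ m l * ((g t).comp φ z)⁻¹ s r *
                AnomalyFlow.torsion ((g t).comp φ) z r m j *
                AnomalyFlow.torsionBar ((g t).comp φ) z s l k))
        (Set.Ico 0 T) t) ∧
    (4 ≤ n → ∀ φ ∈ AnomalyFlow.holoAtlas n X, ∀ t ∈ Set.Ico 0 T, ∀ z ∈ φ.target,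
      ∀ k j : Fin n,
      HasDerivWithinAt (fun s => (g s).comp φ z k j)
        (1 / (((n : ℂ) - 1) * (AnomalyFlow.volNorm Ω (g t) φ z : ℂ)) *
          (-AnomalyFlow.ricciTilde ((g t).comp φ) z k j
            + 1 / (2 * ((n : ℂ) - 2)) *
                (AnomalyFlow.torsionNormSq ((g t).comp φ) z
                  - 2 * AnomalyFlow.torsionTraceNormSq ((g t).comp φ) z) *
                (g t).comp φ z k j
            - 1 / 2 * ∑ q, ∑ p, ∑ s, ∑ r,
                ((g t).comp φ z)⁻¹ q p * ((g t).comp φ z)⁻¹ s r *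
                AnomalyFlow.torsion ((g t).comp φ) z k q s *
                AnomalyFlow.torsionBar ((g t).comp φ) z j p r
            + ∑ s, ∑ r, ((g t).comp φ z)⁻¹ s r *
                (AnomalyFlow.torsion ((g t).comp φ) z k j s *
                    AnomalyFlow.torsionTraceBar ((g t).comp φ) z r
                  + AnomalyFlow.torsionTrace ((g t).comp φ) z s *
                    AnomalyFlow.torsionBar ((g t).comp φ) z j k r)
            + AnomalyFlow.torsionTrace ((g t).comp φ) z j *
                AnomalyFlow.torsionTraceBar ((g t).comp φ) z k))
        (Set.Ico 0 T) t) := by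
  refine ⟨fun h3 φ hφ t ht z hz k j => ?_, fun h4 φ hφ t ht z hz k j => ?_⟩
  · have h := AnomalyFlow.hasDerivWithinAt_comp hn hφ hflow hbal ht hz k j
    have h2 : (n : ℂ) - 1 = 2 := by
      have : (n : ℂ) = 3 := by exact_mod_cast h3
      rw [this]
      norm_num
    rwa [if_neg (by omega), h2] at h
  · have h := AnomalyFlow.hasDerivWithinAt_comp hn hφ hflow hbal ht hz k j
    rwa [if_pos h4] at h
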